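/- **Setting.** Write $z=(x,t)\in\mathbb R^2\times\mathbb R$, $\eta\in\mathbb R^2$, $\mathbf e_2=(0,1)$, and for $r>0$ let $\Gamma_r=\{\eta\in\mathbb R^2:|\eta_1|<r\,\eta_2\}$. A *phase* on $B(0,\rho)\times\Gamma_r$ is a real function $\phi(z,\eta)$ that is smooth there, homogeneous of degree $1$ in $\eta$, and satisfies at each point $(z,\eta_0)$ of this set * $(\mathbf H_1)$ $\operatorname{rank}\partial^2_{z\eta}\phi(z,\eta_0)=2$; * $(\mathbf H_2)$ $\operatorname{rank}\,\partial^2_{\eta\eta}\langle\partial_z\phi(z,\eta),G(z,\eta_0)\rangle|_{\eta=\eta_0}=1$, where $G=G_0/|G_0|$ and $G_0=\partial_{\eta_1}\partial_z\phi\wedge\partial_{\eta_2}\partial_z\phi$. For $\lambda\ge 1$, $M>0$ and a sequence $C=(C_k)_{k\ge0}$, a *sector decomposition at scale $\lambda$ with constants $(M,C)$* consists of angles $-\pi/2<s_0<s_1<\dots<s_n<\pi/2$ with $M^{-1}\lambda^{-1/2}\le s_\nu-s_{\nu-1}\le M\lambda^{-1/2}$, the sectors $\theta_\nu=\{(\sin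 s,\cos s):s_{\nu-1}\le s\le s_\nu\}$, $1\le\nu\le n$, and real cutoffs $\chi_\nu$, smooth on $\mathbb R^2\setminus0$, homogeneous of degree $0$, vanishing on $\mathbb R^2\setminus 0$ outside the directions $(\sin s,\cos s)$ with $s_{\nu-1}-M\lambda^{-1/2}\le s\le s_\nu+M\lambda^{-1/2}$, with $|D^k\chi_\nu(\eta)|\le C_k\lambda^{k/2}$ for $|\eta|=1$ and all $k$. It is *adapted to* an amplitude $a(z,\eta)$ if $\sum_\nu\chi_\nu(\eta)=1$ whenever $a(z,\eta)\neq0$ for some $z$. Put $$T_\lambda f(z)=\int e^{i\lambda\phi(z,\eta)}a(z,\eta)f(\eta)\,d\eta,\qquad T^\nu_\lambda f(z)=\int e^{i\lambda\phi(z,\eta)}\chi_\nu(\eta)a(z,\eta)f(\eta)\,d\eta .$$ **Hypothesis (bilinear square function estimate).** For all $c_0,\rho,r,M>0$, all sequences $A,B,C$ of reals, all $\varepsilon>0$ and $N\in\mathbb N$ there is a constant $K$ such that the following holds. Let $\phi$ be a phase on $B(0,2\rho)\times\Gamma_{2r}$ such that for $|\eta|=1$ one has $|D^k_{z,\eta}\phi|\le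 A_k$ for all $k$, $|\det\partial^2_{x\eta}\phi|\ge c_0$, and the trace (that is, the nonzero eigenvalue) of the matrix in $(\mathbf H_2)$ is at least $c_0$ in absolute value; and let $q(z,\xi)$ be a function, differentiable in $\xi$ at the points $\xi=\partial_x\phi(z,\eta)$, with $\partial_t\phi(z,\eta)=q(z,\partial_x\phi(z,\eta))$. Let $a\in C_c^\infty(\mathbb R^3\times\mathbb R^2)$ be complex valued, supported in $\{|z|\le\rho,\ |\eta_1|\le r\eta_2,\ r^{-1}\le|\eta|\le r\}$, with $|D^ka|\le B_k$ for all $k$. Let $\lambda\ge1$, take a sector decomposition at scale $\lambda$ with constants $(M,C)$ adapted to $a$, and let $\Omega,\Omega'$ be sets of indices such that for all $\nu\in\Omega,\nu'\in\Omega'$: any vector of $\theta_\nu$ and any vector of $\theta_{\nu'}$ make an angle at least $c_0$; and, whenever $\chi_\nu(\eta)a(z,\eta)\ne0$ and $\chi_{\nu'}(\eta')a(z,\eta')\neq0$, with $\xi=\partial_x\phi(z,\eta)$ and $\xi'=\partial_x\phi(z,\eta')$, $$\Bigl|\Bigl\langle\tfrac{\zeta}{|\zeta|},\partial_\xi q(z,\xi)-\partial_\xi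 q(z,\xi')\Bigr\rangle\Bigr|\ge c_0\quad\text{for }\zeta=\xi\text{ and }\zeta=\xi'.$$ Then for all $g,h\in L^{10/3}(\mathbb R^2)$ $$\Bigl\|\sum_{\nu\in\Omega}T^\nu_\lambda g\sum_{\nu'\in\Omega'}T^{\nu'}_\lambda h\Bigr\|_{L^{5/3}(\mathbb R^{3})}\le K\lambda^{\frac1{10}+\varepsilon}\Bigl\|\Bigl(\sum_{\nu\in\Omega}|T^\nu_\lambda g|^2\Bigr)^{\frac12}\Bigr\|_{L^{10/3}(\mathbb R^3)}\Bigl\|\Bigl(\sum_{\nu'\in\Omega'}|T^{\nu'}_\lambda h|^2\Bigr)^{\frac12}\Bigr\|_{L^{10/3}(\mathbb R^3)}+K\lambda^{-N}\|g\|_{L^{10/3}}\|h\|_{L^{10/3}} .$$ **Conclusion.** Assume the hypothesis. Let $r>0$ and let $\phi$ be a phase on $B(0,r)\times\Gamma_r$. Then there is $\varepsilon_0>0$ such that for every complex valued $a\in C_c^\infty(\mathbb R^3\times\mathbb R^2)$ with support in $B(0,\varepsilon_0)\times B(\mathbf e_2,\varepsilon_0)$ the linear square function estimate holds: for all $M>0$,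 all sequences $C$, all $\varepsilon>0$ and $N\in\mathbb N$ there is a constant $K$ such that for all $\lambda\ge1$, all sector decompositions at scale $\lambda$ with constants $(M,C)$ adapted to $a$, and all $f\in L^{10/3}(\mathbb R^2)$, $$\|T_\lambda f\|_{L^{10/3}(\mathbb R^3)}\le K\lambda^{\frac1{20}+\varepsilon}\Bigl\|\Bigl(\sum_{\nu}|T^\nu_\lambda f|^2\Bigr)^{\frac12}\Bigr\|_{L^{10/3}(\mathbb R^3)}+K\lambda^{-N}\|f\|_{L^{10/3}(\mathbb R^2)} .$$ -/

import Mathlib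

open MeasureTheory Set
open scoped ContDiff

noncomputable section

namespace SqFn

/-- Space-time `z = (x, t) ∈ ℝ² × ℝ`: the coordinates `0, 1` are `x`, the coordinate `2` is `t`. -/
abbrev E3 := EuclideanSpace ℝ (Fin 3)

/-- The frequency plane `η ∈ ℝ²`. -/
abbrev E2 := EuclideanSpace ℝ (Fin 2)

/-- The north pole `(0, 1)`. -/
def e₂ : E2 := !₂[0, 1]

/-- The open cone `|η₁| < r η₂`. -/
def cone (r : ℝ) : Set E2 := {η | |η 0| < r * η 1}

/-! ### Derivatives of the phase -/

/-- The partial derivative `∂φ/∂z_i`. -/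
def dz (i : Fin 3) (φ : E3 → E2 → ℝ) : E3 → E2 → ℝ := fun z η =>
  fderiv ℝ (fun w => φ w η) z (EuclideanSpace.single i 1)

/-- The partial derivative `∂φ/∂η_j`. -/
def dη (j : Fin 2) (φ : E3 → E2 → ℝ) : E3 → E2 → ℝ := fun z η =>
  fderiv ℝ (fun w => φ z w) η (EuclideanSpace.single j 1)

/-- The spatial gradient `∂_x φ(z, η)`. -/
def gradX (φ : E3 → E2 → ℝ) (z : E3) (η : E2) : E2 := !₂[dz 0 φ z η, dz 1 φ z η]

/-- The `3 × 2` matrix `∂²_{zη} φ(z, η)`. -/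
def hessZη (φ : E3 → E2 → ℝ) (z : E3) (η : E2) : Matrix (Fin 3) (Fin 2) ℝ :=
  Matrix.of fun i j => dη j (dz i φ) z η

/-- The `2 × 2` matrix `∂²_{xη} φ(z, η)`. -/
def hessXη (φ : E3 → E2 → ℝ) (z : E3) (η : E2) : Matrix (Fin 2) (Fin 2) ℝ :=
  Matrix.of fun i j => dη j (dz i.castSucc φ) z η

/-- `G₀(z, η) = ∂_{η₁} ∂_z φ ∧ ∂_{η₂} ∂_z φ`. -/
def gauss₀ (φ : E3 → E2 → ℝ) (z : E3) (η : E2) : E3 :=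
  WithLp.toLp 2 (crossProduct (fun i => hessZη φ z η i 0) (fun i => hessZη φ z η i 1))

/-- The Gauss map `G = G₀ / |G₀|`. -/
def gauss (φ : E3 → E2 → ℝ) (z : E3) (η : E2) : E3 := ‖gauss₀ φ z η‖⁻¹ • gauss₀ φ z η

/-- The `2 × 2` matrix `∂²_{ηη} ⟨∂_z φ(z, η), G(z, η₀)⟩` at `η = η₀`. -/
def curvature (φ : E3 → E2 → ℝ) (z : E3) (η₀ : E2) : Matrix (Fin 2) (Fin 2) ℝ :=
  Matrix.of fun j k =>
    dη j (dη k (fun w η => ∑ i, dz i φ w η * gauss φ z η₀ i)) z η₀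

/-- Condition `H₁` at the point `(z, η)`. -/
def H1 (φ : E3 → E2 → ℝ) (z : E3) (η : E2) : Prop := (hessZη φ z η).rank = 2

/-- Condition `H₂` at the point `(z, η)`. -/
def H2 (φ : E3 → E2 → ℝ) (z : E3) (η : E2) : Prop := (curvature φ z η).rank = 1

/-- `φ` is a phase function on `B(0, ρ) × {|η₁| < r η₂}`: it is smooth there, homogeneous of degree
one in `η`, and satisfies `H₁` and `H₂`. -/
structure IsPhase (ρ r : ℝ) (φ : E3 → E2 → ℝ) : Prop where
  smooth : ContDiffOn ℝ ∞ (fun p : E3 × E2 => φ p.1 p.2) (Metric.ball 0 ρ ×ˢ cone r)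
  homogeneous : ∀ z ∈ Metric.ball (0 : E3) ρ, ∀ η ∈ cone r, ∀ s : ℝ, 0 < s →
    φ z (s • η) = s * φ z η
  h1 : ∀ z ∈ Metric.ball (0 : E3) ρ, ∀ η ∈ cone r, H1 φ z η
  h2 : ∀ z ∈ Metric.ball (0 : E3) ρ, ∀ η ∈ cone r, H2 φ z η

/-- A phase function with quantitative control: the derivatives of order `k` are bounded by the
numbers `A k`, the nondegeneracy in `H₁` and `H₂` is bounded below by `c₀`, and
`∂_t φ(z, η) = q(z, ∂_x φ(z, η))`. By homogeneity it suffices to ask for the bounds at `|η| = 1`.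
The curvature matrix is symmetric of rank one, so its trace is its nonzero eigenvalue. -/
structure IsControlledPhase (c₀ ρ r : ℝ) (A : ℕ → ℝ) (φ : E3 → E2 → ℝ) (q : E3 → E2 → ℝ) : Prop
    extends IsPhase ρ r φ where
  bound : ∀ k : ℕ, ∀ z ∈ Metric.ball (0 : E3) ρ, ∀ η ∈ cone r, ‖η‖ = 1 →
    ‖iteratedFDeriv ℝ k (fun p : E3 × E2 => φ p.1 p.2) (z, η)‖ ≤ A k
  nondegenerate : ∀ z ∈ Metric.ball (0 : E3) ρ, ∀ η ∈ cone r, ‖η‖ = 1 →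
    c₀ ≤ |(hessXη φ z η).det|
  curved : ∀ z ∈ Metric.ball (0 : E3) ρ, ∀ η ∈ cone r, ‖η‖ = 1 →
    c₀ ≤ |(curvature φ z η).trace|
  q_differentiable : ∀ z ∈ Metric.ball (0 : E3) ρ, ∀ η ∈ cone r,
    DifferentiableAt ℝ (q z) (gradX φ z η)
  q_eq : ∀ z ∈ Metric.ball (0 : E3) ρ, ∀ η ∈ cone r, dz 2 φ z η = q z (gradX φ z η)

/-! ### Sectors and operators -/

/-- The unit vector at angle `s` from the north pole. -/
def dir (s : ℝ) : E2 := !₂[Real.sin s, Real.cos s]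

/-- A decomposition of an arc of the upper half circle into consecutive sectors
`θ_ν = {dir s : ang ν ≤ s ≤ ang (ν + 1)}` of aperture comparable (up to the factor `M`) to `lam^{-1/2}`,
with associated cutoffs `χ_ν` which are smooth away from the origin, homogeneous of degree zero,
supported in a comparable enlargement of `θ_ν`, and satisfy `|∂^k χ_ν| ≤ C k lam^{k/2}` on the
unit circle. -/
structure SectorDecomposition (lam M : ℝ) (C : ℕ → ℝ) where
  n : ℕ
  ang : Fin (n + 1) → ℝ
  χ : Fin n → E2 → ℝ
  ang_mem : ∀ i, ang i ∈ Ioo (-(Real.pi / 2)) (Real.pi / 2)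
  le_aperture : ∀ ν : Fin n, M⁻¹ * lam ^ (-(1 / 2) : ℝ) ≤ ang ν.succ - ang ν.castSucc
  aperture_le : ∀ ν : Fin n, ang ν.succ - ang ν.castSucc ≤ M * lam ^ (-(1 / 2) : ℝ)
  χ_smooth : ∀ ν, ContDiffOn ℝ ∞ (χ ν) {0}ᶜ
  χ_homogeneous : ∀ ν, ∀ η : E2, η ≠ 0 → ∀ s : ℝ, 0 < s → χ ν (s • η) = χ ν η
  χ_bound : ∀ ν, ∀ k : ℕ, ∀ η : E2, ‖η‖ = 1 →
    ‖iteratedFDeriv ℝ k (χ ν) η‖ ≤ C k * lam ^ ((k : ℝ) / 2)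
  χ_support : ∀ ν, ∀ η : E2, η ≠ 0 → χ ν η ≠ 0 →
    ∃ s ∈ Icc (ang ν.castSucc - M * lam ^ (-(1 / 2) : ℝ)) (ang ν.succ + M * lam ^ (-(1 / 2) : ℝ)),
      η = ‖η‖ • dir s

/-- The sector `θ_ν`, as a subset of the unit circle. -/
def SectorDecomposition.sector {lam M : ℝ} {C : ℕ → ℝ} (D : SectorDecomposition lam M C)
    (ν : Fin D.n) : Set E2 :=
  dir '' Icc (D.ang ν.castSucc) (D.ang ν.succ)

/-- The cutoffs form a partition of unity on the `η`-support of the amplitude `a`. -/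
def SectorDecomposition.IsPartition {lam M : ℝ} {C : ℕ → ℝ} (D : SectorDecomposition lam M C)
    (a : E3 → E2 → ℂ) : Prop :=
  ∀ z η, a z η ≠ 0 → ∑ ν, D.χ ν η = 1

/-- The amplitude `a^ν(z, η) = χ_ν(η) a(z, η)`. -/
def SectorDecomposition.amp {lam M : ℝ} {C : ℕ → ℝ} (D : SectorDecomposition lam M C)
    (a : E3 → E2 → ℂ) (ν : Fin D.n) : E3 → E2 → ℂ :=
  fun z η => (D.χ ν η : ℂ) * a z η

/-- The angle between `θ_ν` and `θ_ν'` is at least `c₀` for all `ν ∈ Ω` and `ν' ∈ Ω'`. -/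
def SectorDecomposition.Separated {lam M : ℝ} {C : ℕ → ℝ} (D : SectorDecomposition lam M C)
    (c₀ : ℝ) (Ω Ω' : Finset (Fin D.n)) : Prop :=
  ∀ ν ∈ Ω, ∀ ν' ∈ Ω', ∀ u ∈ D.sector ν, ∀ v ∈ D.sector ν', c₀ ≤ InnerProductGeometry.angle u v

/-- The operator `f ↦ ∫ e^{i lam φ(z, η)} a(z, η) f(η) dη`. -/
def osc (φ : E3 → E2 → ℝ) (a : E3 → E2 → ℂ) (lam : ℝ) (f : E2 → ℂ) (z : E3) : ℂ :=
  ∫ η, Complex.exp (Complex.I * ((lam * φ z η : ℝ) : ℂ)) * a z η * f η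

/-- The square function `(∑_{ν ∈ Ω} |T^ν f|²)^{1/2}`. -/
def SectorDecomposition.square {lam M : ℝ} {C : ℕ → ℝ} (D : SectorDecomposition lam M C)
    (φ : E3 → E2 → ℝ) (a : E3 → E2 → ℂ) (Ω : Finset (Fin D.n)) (f : E2 → ℂ) (z : E3) : ℝ :=
  √(∑ ν ∈ Ω, ‖osc φ (D.amp a ν) lam f z‖ ^ 2)

/-- The transversality condition for the pieces of the amplitude that belong to `Ω` and `Ω'`:
with `ξ = ∂_x φ(z, η)` and `ξ' = ∂_x φ(z, η')`, the vector `∂_ξ q(z, ξ) - ∂_ξ q(z, ξ')` has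
a component of size at least `c₀` in each of the directions `ξ / |ξ|` and `ξ' / |ξ'|`. -/
def SectorDecomposition.Transversal {lam M : ℝ} {C : ℕ → ℝ} (D : SectorDecomposition lam M C)
    (c₀ : ℝ) (φ q : E3 → E2 → ℝ) (a : E3 → E2 → ℂ) (Ω Ω' : Finset (Fin D.n)) : Prop :=
  ∀ ν ∈ Ω, ∀ ν' ∈ Ω', ∀ z η η', D.amp a ν z η ≠ 0 → D.amp a ν' z η' ≠ 0 →
    c₀ ≤ |inner ℝ (‖gradX φ z η‖⁻¹ • gradX φ z η)
      (gradient (q z) (gradX φ z η) - gradient (q z) (gradX φ z η'))| ∧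
    c₀ ≤ |inner ℝ (‖gradX φ z η'‖⁻¹ • gradX φ z η')
      (gradient (q z) (gradX φ z η) - gradient (q z) (gradX φ z η'))|

/-- `a` is a smooth amplitude supported in `|z| ≤ ρ`, `|η₁| ≤ r η₂`, `r⁻¹ ≤ |η| ≤ r`,
with derivatives of order `k` bounded by `B k`. -/
structure IsControlledAmplitude (ρ r : ℝ) (B : ℕ → ℝ) (a : E3 → E2 → ℂ) : Prop where
  smooth : ContDiff ℝ ∞ (fun p : E3 × E2 => a p.1 p.2)
  support : ∀ z η, a z η ≠ 0 → ‖z‖ ≤ ρ ∧ |η 0| ≤ r * η 1 ∧ r⁻¹ ≤ ‖η‖ ∧ ‖η‖ ≤ r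
  bound : ∀ (k : ℕ) (p : E3 × E2),
    ‖iteratedFDeriv ℝ k (fun p : E3 × E2 => a p.1 p.2) p‖ ≤ B k

/-! ### The two estimates -/

/-- The bilinear square function estimate, for all pairs of angularly separated families of
sectors. The constant `K` depends on `ε`, `N` and on the constants that control the phase,
the amplitude, the sectors and their separation, and on nothing else. -/
def BilinearSquareFunctionEstimate : Prop :=
  ∀ (c₀ ρ r M : ℝ) (A B C : ℕ → ℝ), 0 < c₀ → 0 < ρ → 0 < r → 0 < M →
  ∀ ε : ℝ, 0 < ε → ∀ N : ℕ, ∃ K : ℝ,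
  ∀ (φ q : E3 → E2 → ℝ) (a : E3 → E2 → ℂ),
    IsControlledPhase c₀ (2 * ρ) (2 * r) A φ q → IsControlledAmplitude ρ r B a →
  ∀ lam : ℝ, 1 ≤ lam → ∀ D : SectorDecomposition lam M C, D.IsPartition a →
  ∀ Ω Ω' : Finset (Fin D.n), D.Separated c₀ Ω Ω' → D.Transversal c₀ φ q a Ω Ω' →
  ∀ g h : E2 → ℂ, MemLp g (10 / 3) volume → MemLp h (10 / 3) volume →
    eLpNorm (fun z => (∑ ν ∈ Ω, osc φ (D.amp a ν) lam g z) *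
        (∑ ν' ∈ Ω', osc φ (D.amp a ν') lam h z)) (5 / 3) volume
      ≤ ENNReal.ofReal (K * lam ^ (1 / 10 + ε : ℝ)) *
          eLpNorm (D.square φ a Ω g) (10 / 3) volume *
          eLpNorm (D.square φ a Ω' h) (10 / 3) volume
        + ENNReal.ofReal (K * lam ^ (-(N : ℝ))) *
          eLpNorm g (10 / 3) volume * eLpNorm h (10 / 3) volume

/-- The linear square function estimate for the phase `φ` and the amplitude `a`, uniform in
`lam ≥ 1`, in the sector decomposition (with fixed constants `M`, `C`) and in `f`. -/
def SquareFunctionEstimate (φ : E3 → E2 → ℝ) (a : E3 → E2 → ℂ) : Prop :=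
  ∀ (M : ℝ) (C : ℕ → ℝ), 0 < M → ∀ ε : ℝ, 0 < ε → ∀ N : ℕ, ∃ K : ℝ,
  ∀ lam : ℝ, 1 ≤ lam → ∀ D : SectorDecomposition lam M C, D.IsPartition a →
  ∀ f : E2 → ℂ, MemLp f (10 / 3) volume →
    eLpNorm (osc φ a lam f) (10 / 3) volume
      ≤ ENNReal.ofReal (K * lam ^ (1 / 20 + ε : ℝ)) *
          eLpNorm (D.square φ a Finset.univ f) (10 / 3) volume
        + ENNReal.ofReal (K * lam ^ (-(N : ℝ))) * eLpNorm f (10 / 3) volume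

end SqFn

end

/-! In the slope `m = η₁/η₂` a phase reads `φ = η₂ P(z, m)`. Condition `H₂` says that the triple
product of `∂_m ∂_z P`, `∂_z P`, `∂_m² ∂_z P` does not vanish. Hence, for each slope `σ` near `0`,
the functions `w = (∂_m P, P, ∂_m² P)(z, σ)` are coordinates near `z = 0`
(`exists_normal_coordinates`).

Parabolic rescaling. Put `w = w₀ + (δ v₁, δ² v₂, v₃)` and replace the slope by `σ + δ m`. Taylor's
formula at `σ` gives `P` as a part that does not involve `v`, plus `δ²` times a new slope form `v₁ m
+ v₂ + m² ∫ (1 - s) ∂_m² P ds`. The first part is a unimodular factor and goes into `f`; the second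
is a phase of the same kind with large parameter `λ δ²`. The new slope form is smooth up to `δ = 0`,
where it becomes `v₁ m + v₂ + (m²/2)(c + v₃)`. For this model `∂_ξ q = (m, -m²/2)`, so it is
nondegenerate, curved, and transversal for separated slopes. By compactness the same holds with
uniform constants for all small `δ` (`exists_controlled_resc`).

With `δ = L λ^{-1/2}` a block of `L` consecutive sectors becomes a family of bounded total aperture,
decomposed at scale `L² = λ δ²` (`exists_rescale`). The bilinear hypothesis then applies to two
separated parts of the block, with constants independent of the block and of `L`. Averaging over the
centre `w₀` returns to the original variables (`exists_bilinear_block`).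

From bilinear to linear. Cut a block into `K` sub-blocks. At each point, either one sub-block and
its neighbours dominate the sum, or two non-adjacent sub-blocks do. This bounds the `10/3`-th power
of the sum by `256` times the sum of the `10/3`-th powers of the pieces, plus a power of `K` times
products over non-adjacent pairs (`sum_rpow_le_broad_narrow`). Integrate, sum over the blocks and
iterate, from blocks of about `λ^{ε'}` sectors to blocks of about `d λ^{1/2}` sectors. Since `256`
does not depend on `K`, a large fixed `K` makes the accumulated loss `256^T` at most `λ^{ε'}`.

At the smallest scale Cauchy–Schwarz costs only `λ^{O(ε')}`. The bilinear terms contribute `λ^{(1/10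
+ ε')(5/3)}` to the `10/3`-th power, which is where the exponent `1/20` comes from. Their errors
`L^{-2N'}` are negligible because `L ≥ λ^{ε'}` at every scale. The square functions of the blocks
recombine because `∑ x^{5/3} ≤ (∑ x)^{5/3}`. -/

noncomputable section

namespace SqFn

/-! ### Calculus: smooth parametric integrals, Taylor's formula, uniform derivative bounds -/

section Calculus

variable {E F G : Type} [NormedAddCommGroup E] [NormedSpace ℝ E]
  [NormedAddCommGroup F] [NormedSpace ℝ F] [NormedAddCommGroup G] [NormedSpace ℝ G]

/-- The derivative of `f` in the direction `w`. -/
def dirDeriv (w : E) (f : E → F) : E → F := fun x => fderiv ℝ f x w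

theorem contDiff_dirDeriv {f : E → F} (hf : ContDiff ℝ ∞ f) (w : E) :
    ContDiff ℝ ∞ (dirDeriv w f) :=
  (hf.fderiv_right (m := ∞) (by simp)).clm_apply contDiff_const

theorem dirDeriv_congr {f g : E → F} {x : E} (h : f =ᶠ[nhds x] g) (w : E) :
    dirDeriv w f x = dirDeriv w g x := by
  unfold dirDeriv; rw [h.fderiv_eq]

theorem dirDeriv_eventuallyEq {f g : E → F} {x : E} (h : f =ᶠ[nhds x] g) (w : E) :
    dirDeriv w f =ᶠ[nhds x] dirDeriv w g := by
  filter_upwards [h.eventuallyEq_nhds] with y hy using dirDeriv_congr hy w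

/-- This reads derivatives at frozen parameters as derivatives of one jointly smooth function, so
that they depend continuously on the parameters. -/
theorem dirDeriv_slice {f : E × F → G} (hf : ContDiff ℝ ∞ f) (w : F) (e : E) :
    dirDeriv w (fun x => f (e, x)) = fun x => dirDeriv (0, w) f (e, x) := by
  ext x
  have h1 : HasFDerivAt f (fderiv ℝ f (e, x)) (e, x) :=
    (hf.differentiable (by simp) _).hasFDerivAt
  have h2 : HasFDerivAt (fun x : F => (e, x)) (ContinuousLinearMap.inr ℝ E F) x :=
    hasFDerivAt_prodMk_right e x
  have := (h1.comp x h2).fderiv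
  unfold dirDeriv
  change fderiv ℝ (f ∘ fun x => (e, x)) x w = _
  rw [this]; simp

theorem hasFDerivAt_intervalIntegral {f : E × ℝ → F} (hf : ContDiff ℝ 1 f) (a b : ℝ) (x₀ : E) :
    HasFDerivAt (fun x => ∫ s in a..b, f (x, s))
      (∫ s in a..b, (fderiv ℝ f (x₀, s)).comp (ContinuousLinearMap.inl ℝ E ℝ)) x₀ := by
  have hc : Continuous fun p : E × ℝ => (fderiv ℝ f p).comp (ContinuousLinearMap.inl ℝ E ℝ) :=
    ((hf.continuous_fderiv (by simp)).clm_comp continuous_const)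
  obtain ⟨B, hB⟩ := (isCompact_uIcc (a := a) (b := b)).exists_bound_of_continuousOn
    (f := fun s => (fderiv ℝ f (x₀, s)).comp (ContinuousLinearMap.inl ℝ E ℝ))
    (hc.comp (by fun_prop)).continuousOn
  -- Compactness of the interval makes the bound on the derivative uniform in `s` near `x₀`; the
  -- constant `B + 1` then dominates.
  have hev : ∀ᶠ x in nhds x₀, ∀ s ∈ uIcc a b,
      ‖(fderiv ℝ f (x, s)).comp (ContinuousLinearMap.inl ℝ E ℝ)‖ < B + 1 := by
    apply isCompact_uIcc.eventually_forall_of_forall_eventually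
    intro s hs
    have : Continuous fun z : E × ℝ =>
        ‖(fderiv ℝ f (z.1, z.2)).comp (ContinuousLinearMap.inl ℝ E ℝ)‖ := hc.norm
    exact this.continuousAt.eventually_lt continuousAt_const (by
      have := hB s hs
      simp only
      linarith)
  refine intervalIntegral.hasFDerivAt_integral_of_dominated_of_fderiv_le
    (F := fun x s => f (x, s))
    (F' := fun x s => (fderiv ℝ f (x, s)).comp (ContinuousLinearMap.inl ℝ E ℝ))
    (bound := fun _ => B + 1) hev ?_ ?_ ?_ ?_ ?_ ?_
  · exact Filter.Eventually.of_forall fun x =>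
      (hf.continuous.comp (by fun_prop)).aestronglyMeasurable
  · exact (hf.continuous.comp (by fun_prop)).intervalIntegrable _ _
  · exact (hc.comp (by fun_prop : Continuous fun s : ℝ => (x₀, s))).aestronglyMeasurable
  · exact Filter.Eventually.of_forall fun t ht x hx => (hx t (uIoc_subset_uIcc ht)).le
  · exact intervalIntegrable_const
  · refine Filter.Eventually.of_forall fun t ht x hx => ?_
    exact ((hf.differentiable (by simp) _).hasFDerivAt).comp x (hasFDerivAt_prodMk_left x t)

/-- The derivative of the integral is again such an integral, with values in a space of linear maps
and an integrand one derivative poorer. The induction therefore runs over all pairs of spaces. -/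
theorem contDiff_intervalIntegral_nat (n : ℕ) : ∀ {E F : Type} [NormedAddCommGroup E]
    [NormedSpace ℝ E] [NormedAddCommGroup F] [NormedSpace ℝ F] {f : E × ℝ → F},
    ContDiff ℝ (n + 1 : ℕ) f → ∀ a b : ℝ, ContDiff ℝ n (fun x => ∫ s in a..b, f (x, s)) := by
  induction n with
  | zero =>
    intro E F _ _ _ _ f hf a b
    simp only [Nat.cast_zero, contDiff_zero]
    exact continuous_iff_continuousAt.2 fun x =>
      (hasFDerivAt_intervalIntegral (by simpa using hf) a b x).continuousAt
  | succ n ih =>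
    intro E F _ _ _ _ f hf a b
    have h1 : ContDiff ℝ 1 f := hf.of_le (by norm_cast; omega)
    rw [show ((n + 1 : ℕ) : WithTop ℕ∞) = (n : WithTop ℕ∞) + 1 by norm_cast]
    rw [contDiff_succ_iff_hasFDerivAt]
    · refine ⟨_, ?_, fun x => hasFDerivAt_intervalIntegral h1 a b x⟩
      apply ih (f := fun p : E × ℝ =>
        (fderiv ℝ f p).comp (ContinuousLinearMap.inl ℝ E ℝ))
      refine ContDiff.clm_comp ?_ contDiff_const
      exact hf.fderiv_right (by norm_cast)

theorem contDiff_intervalIntegral {f : E × ℝ → F} (hf : ContDiff ℝ ∞ f) (a b : ℝ) :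
    ContDiff ℝ ∞ (fun x => ∫ s in a..b, f (x, s)) := by
  rw [contDiff_infty]
  exact fun n => contDiff_intervalIntegral_nat n (hf.of_le (by exact_mod_cast le_top)) a b

/-- Taylor's formula of order two in the last variable. -/
theorem taylor_two_last {P : E × ℝ → ℝ} (hP : ContDiff ℝ ∞ P) (z : E) (m h : ℝ) :
    P (z, m + h) = P (z, m) + h * dirDeriv (0, 1) P (z, m)
      + h ^ 2 * ∫ s in (0 : ℝ)..1,
          (1 - s) * dirDeriv (0, 1) (dirDeriv (0, 1) P) (z, m + s * h) := by
  have hD := contDiff_dirDeriv hP ((0, 1) : E × ℝ)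
  have hDD := contDiff_dirDeriv hD ((0, 1) : E × ℝ)
  have key : ∀ {Q : E × ℝ → ℝ}, ContDiff ℝ ∞ Q → ∀ s : ℝ,
      HasDerivAt (fun s => Q (z, m + s * h)) (h * dirDeriv (0, 1) Q (z, m + s * h)) s := by
    intro Q hQ s
    have h1 := (hQ.differentiable (by simp) (z, m + s * h)).hasFDerivAt
    have h2 : HasDerivAt (fun s : ℝ => (z, m + s * h)) ((0 : E), h) s :=
      (hasDerivAt_const s z).prodMk (by simpa using ((hasDerivAt_id s).mul_const h).const_add m)
    have h3 := h1.comp_hasDerivAt s h2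
    have : ((0 : E), h) = h • ((0 : E), (1 : ℝ)) := by simp
    rw [this, map_smul] at h3
    exact h3
  -- A primitive of the remainder: the two terms `h ∂P` cancel on differentiation.
  have hd : ∀ s ∈ uIcc (0 : ℝ) 1, HasDerivAt
      (fun s => (1 - s) * (h * dirDeriv (0, 1) P (z, m + s * h)) + P (z, m + s * h))
      (h ^ 2 * ((1 - s) * dirDeriv (0, 1) (dirDeriv (0, 1) P) (z, m + s * h))) s := by
    intro s _
    have := (((hasDerivAt_id s).const_sub 1).mul ((key hD s).const_mul h)).add (key hP s)
    refine this.congr_deriv ?_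
    simp only [id]
    ring
  have hi := intervalIntegral.integral_eq_sub_of_hasDerivAt hd (by
    apply Continuous.intervalIntegrable
    have := hDD.continuous
    fun_prop)
  rw [intervalIntegral.integral_const_mul] at hi
  rw [hi]; simp; ring

/-- A function which is smooth near a point agrees near that point with a smooth function. -/
theorem exists_contDiff_eqOn_ball [FiniteDimensional ℝ E] {f : E → F} {x₀ : E} {R : ℝ} (hR : 0 < R)
    (hf : ContDiffOn ℝ ∞ f (Metric.ball x₀ R)) :
    ∃ g : E → F, ContDiff ℝ ∞ g ∧ EqOn g f (Metric.ball x₀ (R / 4)) := by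
  let b : ContDiffBump x₀ := ⟨R / 4, R / 2, by positivity, by linarith⟩
  refine ⟨fun x => b x • f x, ?_, ?_⟩
  · refine contDiff_of_contDiffOn_union_of_isOpen (s := Metric.ball x₀ R)
      (t := (Metric.closedBall x₀ (R / 2))ᶜ) ?_ ?_ ?_ Metric.isOpen_ball
      Metric.isClosed_closedBall.isOpen_compl
    · exact b.contDiff.contDiffOn.smul hf
    · refine contDiffOn_const (c := (0 : F)) |>.congr fun x hx => ?_
      have : b x = 0 := b.zero_of_le_dist (by
        simp only [mem_compl_iff, Metric.mem_closedBall, not_le] at hx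
        exact hx.le)
      simp [this]
    · rw [eq_univ_iff_forall]
      intro x
      by_cases hx : dist x x₀ < R
      · exact Or.inl hx
      · exact Or.inr (by simp only [mem_compl_iff, Metric.mem_closedBall]; linarith)
  · intro x hx
    have : b x = 1 := b.one_of_mem_closedBall (Metric.ball_subset_closedBall hx)
    simp [this]

/-- A slice is `f` composed with a translation and the inclusion `inr`, whose norm is at most one.
-/
theorem norm_iteratedFDeriv_slice_le {f : E × F → G} {U : Set (E × F)} (hU : IsOpen U)
    (hf : ContDiffOn ℝ ∞ f U) {e : E} {x : F} (hx : (e, x) ∈ U) (k : ℕ) :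
    ‖iteratedFDeriv ℝ k (fun y => f (e, y)) x‖ ≤ ‖iteratedFDeriv ℝ k f (e, x)‖ := by
  let g : E × F → G := fun p => f ((e, 0) + p)
  let V : Set (E × F) := (fun p => (e, 0) + p) ⁻¹' U
  have hV : IsOpen V := hU.preimage (by fun_prop)
  have hg : ContDiffOn ℝ ∞ g V := hf.comp (by fun_prop) fun p hp => hp
  let L : F →L[ℝ] E × F := ContinuousLinearMap.inr ℝ E F
  have hV' : IsOpen (L ⁻¹' V) := hV.preimage L.continuous
  have hxV : L x ∈ V := by simpa [V, L] using hx
  have h1 := L.iteratedFDerivWithin_comp_right hg hV.uniqueDiffOn hV'.uniqueDiffOn hxV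
    (i := k) (by exact_mod_cast le_top)
  rw [iteratedFDerivWithin_of_isOpen k hV' hxV, iteratedFDerivWithin_of_isOpen k hV hxV] at h1
  have h2 : (g ∘ L) = fun y => f (e, y) := by ext y; simp [g, L]
  have h3 : iteratedFDeriv ℝ k g (L x) = iteratedFDeriv ℝ k f (e, x) := by
    simp only [g]; rw [iteratedFDeriv_comp_add_left]; simp [L]
  rw [h2, h3] at h1
  rw [h1]
  refine (ContinuousMultilinearMap.norm_compContinuousLinearMap_le _ _).trans ?_
  refine mul_le_of_le_one_right (norm_nonneg _) ?_
  exact Finset.prod_le_one (fun _ _ => norm_nonneg _)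
    fun _ _ => ContinuousLinearMap.norm_inr_le_one ℝ E F

/-- A smooth family of functions has uniformly bounded derivatives on compact sets. -/
theorem exists_bound_iteratedFDeriv_slice {f : E × F → G} {U K : Set (E × F)} (hU : IsOpen U)
    (hf : ContDiffOn ℝ ∞ f U) (hK : IsCompact K) (hKU : K ⊆ U) :
    ∃ A : ℕ → ℝ, ∀ k e x, (e, x) ∈ K → ‖iteratedFDeriv ℝ k (fun y => f (e, y)) x‖ ≤ A k := by
  have : ∀ k : ℕ, ∃ A : ℝ, ∀ p ∈ K, ‖iteratedFDeriv ℝ k f p‖ ≤ A := by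
    intro k
    apply hK.exists_bound_of_continuousOn
    have h := hf.continuousOn_iteratedFDerivWithin (m := k) (by exact_mod_cast le_top)
      hU.uniqueDiffOn
    exact (h.congr fun p hp => (iteratedFDerivWithin_of_isOpen k hU hp).symm).mono hKU
  choose A hA using this
  exact ⟨A, fun k e x h => (norm_iteratedFDeriv_slice_le hU hf (hKU h) k).trans (hA k _ h)⟩

end Calculus

/-- A strict inequality at parameter `0`, uniformly over a compact set, persists for small
parameters. -/
theorem exists_forall_lt_of_compact {Y : Type*} [TopologicalSpace Y] {K : Set Y} (hK : IsCompact K)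
    {f g : ℝ × Y → ℝ} (hf : ∀ y ∈ K, ContinuousAt f (0, y)) (hg : ∀ y ∈ K, ContinuousAt g (0, y))
    (h : ∀ y ∈ K, f (0, y) < g (0, y)) :
    ∃ d > 0, ∀ t : ℝ, |t| ≤ d → ∀ y ∈ K, f (t, y) < g (t, y) := by
  have hev : ∀ᶠ t in nhds (0 : ℝ), ∀ y ∈ K, f (t, y) < g (t, y) := by
    apply hK.eventually_forall_of_forall_eventually
    intro y hy
    exact (hf y hy).eventually_lt (hg y hy) (h y hy)
  obtain ⟨d, hd, hd'⟩ := Metric.eventually_nhds_iff.1 hev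
  exact ⟨d / 2, by positivity, fun t ht => hd' (by rw [Real.dist_eq, sub_zero]; linarith)⟩

end SqFn

end

noncomputable section

namespace SqFn

/-! ### Phases in slope form -/

/-- The partial derivative in `z_i` of a function of `(z, m)`. -/
def pz (i : Fin 3) (P : E3 × ℝ → ℝ) : E3 × ℝ → ℝ := dirDeriv (EuclideanSpace.single i 1, 0) P

/-- The partial derivative in the slope `m` of a function of `(z, m)`. -/
def pm (P : E3 × ℝ → ℝ) : E3 × ℝ → ℝ := dirDeriv (0, 1) P

/-- The function homogeneous of degree one in `η` with slope form `P`. -/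
def persp (P : E3 × ℝ → ℝ) : E3 → E2 → ℝ := fun z η => η 1 * P (z, η 0 / η 1)

theorem contDiff_pz {P : E3 × ℝ → ℝ} (hP : ContDiff ℝ ∞ P) (i : Fin 3) : ContDiff ℝ ∞ (pz i P) :=
  contDiff_dirDeriv hP _

theorem contDiff_pm {P : E3 × ℝ → ℝ} (hP : ContDiff ℝ ∞ P) : ContDiff ℝ ∞ (pm P) :=
  contDiff_dirDeriv hP _

theorem hasFDerivAt_slope {η : E2} (h : η 1 ≠ 0) :
    HasFDerivAt (fun w : E2 => w 0 / w 1)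
      ((η 1)⁻¹ • (EuclideanSpace.proj 0 : E2 →L[ℝ] ℝ) - (η 0 / η 1 ^ 2) •
        (EuclideanSpace.proj 1 : E2 →L[ℝ] ℝ)) η := by
  have h0 : HasFDerivAt (fun w : E2 => w 0) (EuclideanSpace.proj 0 : E2 →L[ℝ] ℝ) η :=
    (EuclideanSpace.proj 0 : E2 →L[ℝ] ℝ).hasFDerivAt
  have h1 : HasFDerivAt (fun w : E2 => w 1) (EuclideanSpace.proj 1 : E2 →L[ℝ] ℝ) η :=
    (EuclideanSpace.proj 1 : E2 →L[ℝ] ℝ).hasFDerivAt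
  have := h0.mul ((hasDerivAt_inv h).comp_hasFDerivAt η h1)
  simp only [Function.comp_def] at this
  simp only [div_eq_mul_inv]
  refine HasFDerivAt.congr_fderiv this ?_
  ext w
  simp
  ring

theorem hasDerivAt_pm {Q : E3 × ℝ → ℝ} (hQ : ContDiff ℝ ∞ Q) (z : E3) (m : ℝ) :
    HasDerivAt (fun m => Q (z, m)) (pm Q (z, m)) m := by
  have h1 := (hQ.differentiable (by simp) (z, m)).hasFDerivAt
  have h2 : HasDerivAt (fun s : ℝ => (z, s)) ((0 : E3), (1 : ℝ)) m :=
    (hasDerivAt_const m z).prodMk (hasDerivAt_id m)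
  exact h1.comp_hasDerivAt m h2

theorem hasFDerivAt_comp_slope {u : ℝ → ℝ} {u' : ℝ} {η : E2} (h : η 1 ≠ 0)
    (hu : HasDerivAt u u' (η 0 / η 1)) :
    HasFDerivAt (fun w : E2 => u (w 0 / w 1))
      (u' • ((η 1)⁻¹ • (EuclideanSpace.proj 0 : E2 →L[ℝ] ℝ) - (η 0 / η 1 ^ 2) •
        (EuclideanSpace.proj 1 : E2 →L[ℝ] ℝ))) η :=
  hu.comp_hasFDerivAt η (hasFDerivAt_slope h)

theorem hasFDerivAt_mul_comp_slope {u : ℝ → ℝ} {u' : ℝ} {η : E2} (h : η 1 ≠ 0)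
    (hu : HasDerivAt u u' (η 0 / η 1)) :
    HasFDerivAt (fun w : E2 => w 1 * u (w 0 / w 1))
      (u' • (EuclideanSpace.proj 0 : E2 →L[ℝ] ℝ) + (u (η 0 / η 1) - η 0 / η 1 * u') •
        (EuclideanSpace.proj 1 : E2 →L[ℝ] ℝ)) η := by
  have h1 : HasFDerivAt (fun w : E2 => w 1) (EuclideanSpace.proj 1 : E2 →L[ℝ] ℝ) η :=
    (EuclideanSpace.proj 1 : E2 →L[ℝ] ℝ).hasFDerivAt
  have := h1.mul (hasFDerivAt_comp_slope h hu)
  refine HasFDerivAt.congr_fderiv this ?_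
  ext w
  simp
  field_simp
  ring

theorem dη_of_eventuallyEq {ψ : E3 → E2 → ℝ} {z : E3} {η : E2} (h : η 1 ≠ 0) {Q : E3 × ℝ → ℝ}
    (hQ : ContDiff ℝ ∞ Q) (he : ψ z =ᶠ[nhds η] fun w => Q (z, w 0 / w 1)) :
    dη 0 ψ z η = pm Q (z, η 0 / η 1) / η 1 ∧
      dη 1 ψ z η = -(η 0 / η 1) * pm Q (z, η 0 / η 1) / η 1 := by
  have := (hasFDerivAt_comp_slope h (hasDerivAt_pm hQ z _)).congr_of_eventuallyEq he
  unfold dη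
  constructor
  · change fderiv ℝ (ψ z) η _ = _
    rw [this.fderiv]; simp; field_simp
  · change fderiv ℝ (ψ z) η _ = _
    rw [this.fderiv]; simp; field_simp

theorem dη_of_eventuallyEq_persp {ψ : E3 → E2 → ℝ} {z : E3} {η : E2} (h : η 1 ≠ 0)
    {Q : E3 × ℝ → ℝ} (hQ : ContDiff ℝ ∞ Q) (he : ψ z =ᶠ[nhds η] persp Q z) :
    dη 0 ψ z η = pm Q (z, η 0 / η 1) ∧
      dη 1 ψ z η = Q (z, η 0 / η 1) - η 0 / η 1 * pm Q (z, η 0 / η 1) := by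
  have := (hasFDerivAt_mul_comp_slope h (hasDerivAt_pm hQ z _)).congr_of_eventuallyEq he
  unfold dη
  constructor
  · change fderiv ℝ (ψ z) η _ = _
    rw [this.fderiv]; simp
  · change fderiv ℝ (ψ z) η _ = _
    rw [this.fderiv]; simp

/-- On `V × Γ` the function `φ` is homogeneous of degree one with slope form `P`. -/
structure HasSlopeForm (φ : E3 → E2 → ℝ) (V : Set E3) (Γ : Set E2) (P : E3 × ℝ → ℝ) : Prop where
  isOpen_left : IsOpen V
  isOpen_right : IsOpen Γ
  pos : ∀ η ∈ Γ, 0 < η 1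
  smooth : ContDiff ℝ ∞ P
  eq : ∀ z ∈ V, ∀ η ∈ Γ, φ z η = persp P z η

/-- `∂_z P`. -/
def vA (P : E3 × ℝ → ℝ) (x : E3 × ℝ) : Fin 3 → ℝ := fun i => pz i P x

/-- `∂_m ∂_z P`. -/
def vB (P : E3 × ℝ → ℝ) (x : E3 × ℝ) : Fin 3 → ℝ := fun i => pm (pz i P) x

/-- `∂_m² ∂_z P`. -/
def vC (P : E3 × ℝ → ℝ) (x : E3 × ℝ) : Fin 3 → ℝ := fun i => pm (pm (pz i P)) x

/-- `det ∂²_{xη} φ` in slope form. -/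
def detX (P : E3 × ℝ → ℝ) (x : E3 × ℝ) : ℝ := vB P x 0 * vA P x 1 - vB P x 1 * vA P x 0

/-- The normal `∂_m ∂_z P × ∂_z P`. -/
def normal (P : E3 × ℝ → ℝ) (x : E3 × ℝ) : E3 := WithLp.toLp 2 (crossProduct (vB P x) (vA P x))

/-- The triple product which measures the curvature of the cone. -/
def triple (P : E3 × ℝ → ℝ) (x : E3 × ℝ) : ℝ := ∑ i, vC P x i * normal P x i

namespace HasSlopeForm

variable {φ : E3 → E2 → ℝ} {V : Set E3} {Γ : Set E2} {P : E3 × ℝ → ℝ} {z : E3} {η : E2}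

theorem dz_eq (h : HasSlopeForm φ V Γ P) (hz : z ∈ V) (hη : η ∈ Γ) (i : Fin 3) :
    dz i φ z η = persp (pz i P) z η := by
  have he : (fun w => φ w η) =ᶠ[nhds z] fun w => η 1 * P (w, η 0 / η 1) := by
    filter_upwards [h.isOpen_left.mem_nhds hz] with w hw using h.eq w hw η hη
  have h1 := (h.smooth.differentiable (by simp) (z, η 0 / η 1)).hasFDerivAt
  have h0 : HasFDerivAt (fun e : E3 => (e, (η 0 / η 1 : ℝ))) (ContinuousLinearMap.inl ℝ E3 ℝ) z :=
    hasFDerivAt_prodMk_left (𝕜 := ℝ) z (η 0 / η 1 : ℝ)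
  have h2 := ((h1.comp z h0).const_mul (η 1)).fderiv
  unfold dz persp pz dirDeriv
  rw [he.fderiv_eq]
  change fderiv ℝ (fun y => η 1 * (P ∘ fun e => (e, η 0 / η 1)) y) z _ = _
  rw [h2]; simp

theorem eventually_mem (h : HasSlopeForm φ V Γ P) (hη : η ∈ Γ) : ∀ᶠ w in nhds η, w ∈ Γ :=
  h.isOpen_right.mem_nhds hη

theorem gradX_eq (h : HasSlopeForm φ V Γ P) (hz : z ∈ V) (hη : η ∈ Γ) :
    gradX φ z η = !₂[η 1 * vA P (z, η 0 / η 1) 0, η 1 * vA P (z, η 0 / η 1) 1] := by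
  simp only [gradX, h.dz_eq hz hη, persp, vA]

theorem hessZη_zero (h : HasSlopeForm φ V Γ P) (hz : z ∈ V) (hη : η ∈ Γ) (i : Fin 3) :
    hessZη φ z η i 0 = vB P (z, η 0 / η 1) i :=
  (dη_of_eventuallyEq_persp (h.pos η hη).ne' (contDiff_pz h.smooth i)
    (by filter_upwards [h.eventually_mem hη] with w hw using h.dz_eq hz hw i)).1

theorem hessZη_one (h : HasSlopeForm φ V Γ P) (hz : z ∈ V) (hη : η ∈ Γ) (i : Fin 3) :
    hessZη φ z η i 1 = vA P (z, η 0 / η 1) i - η 0 / η 1 * vB P (z, η 0 / η 1) i :=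
  (dη_of_eventuallyEq_persp (h.pos η hη).ne' (contDiff_pz h.smooth i)
    (by filter_upwards [h.eventually_mem hη] with w hw using h.dz_eq hz hw i)).2

theorem det_hessXη (h : HasSlopeForm φ V Γ P) (hz : z ∈ V) (hη : η ∈ Γ) :
    (hessXη φ z η).det = detX P (z, η 0 / η 1) := by
  have e : ∀ i j, hessXη φ z η i j = hessZη φ z η i.castSucc j := fun i j => rfl
  rw [Matrix.det_fin_two]
  simp only [e, h.hessZη_zero hz hη, h.hessZη_one hz hη, detX]
  simp
  ring

/-- With `B = ∂_m ∂_z P` and `A = ∂_z P`, the columns of `hessZη` are `B` and `A - m B`; the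
multiple of `B` drops out of the cross product. -/
theorem gauss₀_eq (h : HasSlopeForm φ V Γ P) (hz : z ∈ V) (hη : η ∈ Γ) :
    gauss₀ φ z η = normal P (z, η 0 / η 1) := by
  unfold gauss₀ normal
  simp only [h.hessZη_zero hz hη, h.hessZη_one hz hη]
  congr 1
  simp only [cross_apply]
  ext i; fin_cases i <;> simp <;> ring

/-- The Hessian of `η₂ Q(η₁/η₂)` is `Q''/η₂` times the square of the covector `(1, -m)`; the radial
direction is its kernel. This is where the triple product enters, as the only obstruction to `H₂`.
-/
theorem curvature_eq (h : HasSlopeForm φ V Γ P) (hz : z ∈ V) (hη : η ∈ Γ) :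
    curvature φ z η = Matrix.vecMulVec
      ((triple P (z, η 0 / η 1) * ‖normal P (z, η 0 / η 1)‖⁻¹ / η 1) • ![1, -(η 0 / η 1)])
      ![1, -(η 0 / η 1)] := by
  set G := gauss φ z η with hG
  have hGe : ∀ i, G i = ‖normal P (z, η 0 / η 1)‖⁻¹ * normal P (z, η 0 / η 1) i := by
    intro i
    rw [hG, gauss, h.gauss₀_eq hz hη]; simp
  -- `G` is frozen at the base point, so contracting with it commutes with the derivatives in `η`,
  -- and a single scalar slope form remains.
  let Q : E3 × ℝ → ℝ := fun x => ∑ i, pz i P x * G i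
  have hQ : ContDiff ℝ ∞ Q :=
    ContDiff.sum fun i _ => (contDiff_pz h.smooth i).mul contDiff_const
  let Φ : E3 → E2 → ℝ := fun w η => ∑ i, dz i φ w η * G i
  have hΦ : ∀ w ∈ Γ, Φ z w = persp Q z w := by
    intro w hw
    simp only [Φ, Q, persp, h.dz_eq hz hw, Finset.mul_sum, mul_assoc]
  have hQm : ∀ x, pm Q x = ∑ i, pm (pz i P) x * G i := by
    rintro ⟨w, m⟩
    refine (hasDerivAt_pm hQ w m).unique ?_
    exact HasDerivAt.fun_sum fun i _ => (hasDerivAt_pm (contDiff_pz h.smooth i) w m).mul_const _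
  have hQmm : ∀ x, pm (pm Q) x = ∑ i, pm (pm (pz i P)) x * G i := by
    rintro ⟨w, m⟩
    refine (hasDerivAt_pm (contDiff_pm hQ) w m).unique ?_
    have := HasDerivAt.fun_sum (u := Finset.univ) fun i _ =>
      (hasDerivAt_pm (contDiff_pm (contDiff_pz h.smooth i)) w m).mul_const (G i)
    simpa only [hQm] using this
  have ht : pm (pm Q) (z, η 0 / η 1) =
      triple P (z, η 0 / η 1) * ‖normal P (z, η 0 / η 1)‖⁻¹ := by
    rw [hQmm, triple, Finset.sum_mul]
    refine Finset.sum_congr rfl fun i _ => ?_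
    rw [hGe i, vC]; ring
  have hpos := h.pos η hη
  have hΦΓ : ∀ w ∈ Γ, dη 0 Φ z w = pm Q (z, w 0 / w 1) ∧
      dη 1 Φ z w = Q (z, w 0 / w 1) - w 0 / w 1 * pm Q (z, w 0 / w 1) := fun w hw =>
    dη_of_eventuallyEq_persp (h.pos w hw).ne' hQ
      (by filter_upwards [h.eventually_mem hw] with y hy using hΦ y hy)
  have h0 := dη_of_eventuallyEq (ψ := dη 0 Φ) (z := z) hpos.ne' (contDiff_pm hQ)
    (by filter_upwards [h.eventually_mem hη] with y hy using (hΦΓ y hy).1)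
  let Q₁ : E3 × ℝ → ℝ := fun x => Q x - x.2 * pm Q x
  have hQ₁ : ContDiff ℝ ∞ Q₁ := hQ.sub (contDiff_snd.mul (contDiff_pm hQ))
  have hQ₁m : ∀ x, pm Q₁ x = - x.2 * pm (pm Q) x := by
    rintro ⟨w, m⟩
    refine (hasDerivAt_pm hQ₁ w m).unique ?_
    have := (hasDerivAt_pm hQ w m).sub ((hasDerivAt_id m).mul (hasDerivAt_pm (contDiff_pm hQ) w m))
    refine this.congr_deriv ?_
    simp only [id]; ring
  have h1 := dη_of_eventuallyEq (ψ := dη 1 Φ) (z := z) hpos.ne' hQ₁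
    (by filter_upwards [h.eventually_mem hη] with y hy using (hΦΓ y hy).2)
  have e : ∀ j k, curvature φ z η j k = dη j (dη k Φ) z η := fun j k => rfl
  ext j k
  rw [e]
  fin_cases k
  · fin_cases j
    · simp [h0.1, ht, Matrix.vecMulVec_apply]
    · simp only [Fin.zero_eta, Fin.mk_one]
      rw [h0.2, ht]; simp [Matrix.vecMulVec_apply]; ring
  · fin_cases j
    · simp only [Fin.zero_eta, Fin.mk_one]
      rw [h1.1, hQ₁m, ht]; simp [Matrix.vecMulVec_apply]; ring
    · simp only [Fin.mk_one]
      rw [h1.2, hQ₁m, ht]; simp [Matrix.vecMulVec_apply]; ring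

theorem trace_curvature (h : HasSlopeForm φ V Γ P) (hz : z ∈ V) (hη : η ∈ Γ) :
    (curvature φ z η).trace = triple P (z, η 0 / η 1) * ‖normal P (z, η 0 / η 1)‖⁻¹ / η 1 *
      (1 + (η 0 / η 1) ^ 2) := by
  rw [h.curvature_eq hz hη, Matrix.trace_fin_two]
  simp [Matrix.vecMulVec_apply]; ring

theorem triple_ne_zero_of_H2 (h : HasSlopeForm φ V Γ P) (hz : z ∈ V) (hη : η ∈ Γ)
    (h2 : H2 φ z η) : triple P (z, η 0 / η 1) ≠ 0 := by
  intro h0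
  have : curvature φ z η = 0 := by
    rw [h.curvature_eq hz hη, h0]; simp
  unfold H2 at h2
  rw [this, Matrix.rank_zero] at h2
  exact one_ne_zero h2.symm

theorem H2_of_trace_ne_zero (h : HasSlopeForm φ V Γ P) (hz : z ∈ V) (hη : η ∈ Γ)
    (ht : (curvature φ z η).trace ≠ 0) : H2 φ z η := by
  refine le_antisymm ?_ ?_
  · rw [h.curvature_eq hz hη]; exact Matrix.rank_vecMulVec_le _ _
  · rw [Nat.one_le_iff_ne_zero]
    intro h0
    apply ht
    have : curvature φ z η = 0 := by
      unfold Matrix.rank at h0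
      have := Submodule.finrank_eq_zero.1 h0
      rw [LinearMap.range_eq_bot] at this
      have h3 : Matrix.toLin' (curvature φ z η) = 0 := by
        rw [Matrix.toLin'_apply']; exact this
      simpa using h3
    rw [this]; simp

theorem H1_of_det_ne_zero (h : (hessXη φ z η).det ≠ 0) : H1 φ z η := by
  refine le_antisymm ?_ ?_
  · simpa using (hessZη φ z η).rank_le_width
  · have e : hessXη φ z η = (hessZη φ z η).submatrix Fin.castSucc id := rfl
    have h1 := Matrix.rank_of_det_ne_zero h
    have h2 := Matrix.rank_submatrix_le (hessZη φ z η) (Fin.castSucc : Fin 2 → Fin 3) id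
    rw [← e, h1] at h2
    simpa using h2

end HasSlopeForm

/-! ### The symbol `q` -/

/-- The ratio `∂_{x₁} P / ∂_{x₂} P`. -/
def ratio (P : E3 × ℝ → ℝ) (z : E3) (m : ℝ) : ℝ := pz 0 P (z, m) / pz 1 P (z, m)

/-- The function `q` with `∂_t φ = q(z, ∂_x φ)` for a phase with slope form `P`. -/
def symbolOf (P : E3 × ℝ → ℝ) (r : ℝ) (z : E3) (ξ : E2) : ℝ :=
  ξ 1 * (pz 2 P (z, Function.invFunOn (ratio P z) (Ioo (-r) r) (ξ 0 / ξ 1)) /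
    pz 1 P (z, Function.invFunOn (ratio P z) (Ioo (-r) r) (ξ 0 / ξ 1)))

/-- The first component of `∂_ξ q` in slope form. -/
def gradQ₀ (P : E3 × ℝ → ℝ) (x : E3 × ℝ) : ℝ :=
  (vB P x 2 * vA P x 1 - vA P x 2 * vB P x 1) / detX P x

/-- The second component of `∂_ξ q` in slope form. -/
def gradQ₁ (P : E3 × ℝ → ℝ) (x : E3 × ℝ) : ℝ :=
  vA P x 2 / vA P x 1 - vA P x 0 / vA P x 1 * gradQ₀ P x

section Symbol

variable {P : E3 × ℝ → ℝ} {r : ℝ} {z : E3} {m : ℝ}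

theorem hasDerivAt_ratio (hP : ContDiff ℝ ∞ P) (h1 : vA P (z, m) 1 ≠ 0) :
    HasDerivAt (ratio P z) (detX P (z, m) / vA P (z, m) 1 ^ 2) m := by
  have := (hasDerivAt_pm (contDiff_pz hP 0) z m).div (hasDerivAt_pm (contDiff_pz hP 1) z m) h1
  refine this.congr_deriv ?_
  simp only [detX, vA, vB]; ring

theorem injOn_ratio (hP : ContDiff ℝ ∞ P) (h1 : ∀ m ∈ Ioo (-r) r, 0 < vA P (z, m) 1)
    (hJ : ∀ m ∈ Ioo (-r) r, 0 < detX P (z, m)) : InjOn (ratio P z) (Ioo (-r) r) := by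
  apply StrictMonoOn.injOn
  apply strictMonoOn_of_deriv_pos (convex_Ioo _ _)
  · exact fun m hm => (hasDerivAt_ratio hP (h1 m hm).ne').continuousAt.continuousWithinAt
  · intro m hm
    rw [interior_Ioo] at hm
    rw [(hasDerivAt_ratio hP (h1 m hm).ne').deriv]
    exact div_pos (hJ m hm) (pow_pos (h1 m hm) 2)

/-- `q` is `ξ₂` times a function of the ratio `ξ₁/ξ₂`. Since `m ↦ ∂_{x₁}P / ∂_{x₂}P` is strictly
increasing, `m` can be recovered from this ratio, and the derivative of `∂_t P / ∂_{x₂} P` with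
respect to it is a quotient of two `m`-derivatives, namely `gradQ₀`. -/
theorem hasGradientAt_symbolOf (hP : ContDiff ℝ ∞ P)
    (h1 : ∀ m ∈ Ioo (-r) r, 0 < vA P (z, m) 1) (hJ : ∀ m ∈ Ioo (-r) r, 0 < detX P (z, m))
    (hm : m ∈ Ioo (-r) r) {c : ℝ} (hc : 0 < c) :
    HasGradientAt (symbolOf P r z) !₂[gradQ₀ P (z, m), gradQ₁ P (z, m)]
        !₂[c * vA P (z, m) 0, c * vA P (z, m) 1] ∧
      symbolOf P r z !₂[c * vA P (z, m) 0, c * vA P (z, m) 1] = c * vA P (z, m) 2 := by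
  set inv := Function.invFunOn (ratio P z) (Ioo (-r) r) with hinv
  have hA := h1 m hm
  have hinv_apply : ∀ m ∈ Ioo (-r) r, inv (ratio P z m) = m := fun m hm =>
    (injOn_ratio hP h1 hJ).leftInvOn_invFunOn hm
  have hs : (c * vA P (z, m) 0) / (c * vA P (z, m) 1) = ratio P z m := by
    rw [mul_div_mul_left _ _ hc.ne']; rfl
  have hcd : ContDiffAt ℝ 1 (ratio P z) m :=
    ContDiffAt.div (((contDiff_pz hP 0).comp (by fun_prop)).contDiffAt.of_le (by simp))
      (((contDiff_pz hP 1).comp (by fun_prop)).contDiffAt.of_le (by simp)) hA.ne'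
  have hsd : HasStrictDerivAt (ratio P z) (detX P (z, m) / vA P (z, m) 1 ^ 2) m := by
    have := hcd.hasStrictDerivAt (by simp)
    rwa [(hasDerivAt_ratio hP hA.ne').deriv] at this
  -- Strict differentiability gives the derivative of any local left inverse, so continuity of
  -- `Function.invFunOn` needs no separate proof.
  have hid := (hsd.to_local_left_inverse (g := inv) (div_pos (hJ m hm) (pow_pos hA 2)).ne'
    (by filter_upwards [isOpen_Ioo.mem_nhds hm] with y hy using hinv_apply y hy)).hasDerivAt
  have hτ : HasDerivAt (fun m => pz 2 P (z, m) / pz 1 P (z, m))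
      ((vB P (z, m) 2 * vA P (z, m) 1 - vA P (z, m) 2 * vB P (z, m) 1) / vA P (z, m) 1 ^ 2)
      (inv (ratio P z m)) := by
    rw [hinv_apply m hm]
    exact (hasDerivAt_pm (contDiff_pz hP 2) z m).div (hasDerivAt_pm (contDiff_pz hP 1) z m) hA.ne'
  have hQ := hτ.comp _ hid
  set ξ : E2 := !₂[c * vA P (z, m) 0, c * vA P (z, m) 1] with hξ
  have hξ0 : ξ 0 = c * vA P (z, m) 0 := rfl
  have hξ1 : ξ 1 = c * vA P (z, m) 1 := rfl
  have hξr : ξ 0 / ξ 1 = ratio P z m := hs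
  rw [← hξr] at hQ
  have hne : ξ 1 ≠ 0 := by rw [hξ1]; positivity
  have hJm := hJ m hm
  constructor
  · rw [hasGradientAt_iff_hasFDerivAt]
    have := hasFDerivAt_mul_comp_slope hne hQ
    refine HasFDerivAt.congr_fderiv this ?_
    ext w
    simp only [Function.comp, hξr, hinv_apply m hm]
    simp [gradQ₀, gradQ₁, PiLp.inner_apply, Fin.sum_univ_two]
    simp only [ratio, vA] at *
    field_simp
  · simp only [symbolOf]
    rw [← hinv, hξr, hinv_apply m hm, hξ1]
    simp only [vA] at *
    field_simp

end Symbol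

/-! ### Controlled phases from slope forms on a cone -/

theorem isOpen_cone (r : ℝ) : IsOpen (cone r) :=
  isOpen_lt (by fun_prop) (by fun_prop)

theorem pos_of_mem_cone {r : ℝ} (hr : 0 < r) {η : E2} (h : η ∈ cone r) : 0 < η 1 := by
  have : 0 < r * η 1 := (abs_nonneg _).trans_lt h
  exact pos_of_mul_pos_right this hr.le

theorem slope_mem_Ioo {r : ℝ} (hr : 0 < r) {η : E2} (h : η ∈ cone r) :
    η 0 / η 1 ∈ Ioo (-r) r := by
  have h1 := pos_of_mem_cone hr h
  have h2 := abs_lt.1 (show |η 0| < r * η 1 from h)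
  constructor
  · rw [lt_div_iff₀ h1]; linarith
  · rw [div_lt_iff₀ h1]; linarith

theorem hasSlopeForm_persp {P : E3 × ℝ → ℝ} (hP : ContDiff ℝ ∞ P) (ρ : ℝ) {r : ℝ} (hr : 0 < r) :
    HasSlopeForm (persp P) (Metric.ball 0 ρ) (cone r) P where
  isOpen_left := Metric.isOpen_ball
  isOpen_right := isOpen_cone r
  pos _ h := pos_of_mem_cone hr h
  smooth := hP
  eq _ _ _ _ := rfl

theorem contDiffOn_persp {P : E3 × ℝ → ℝ} (hP : ContDiff ℝ ∞ P) :
    ContDiffOn ℝ ∞ (fun p : E3 × E2 => persp P p.1 p.2) {p | p.2 1 ≠ 0} := by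
  unfold persp
  have h0 : ContDiff ℝ ∞ fun p : E3 × E2 => p.2 0 := by fun_prop
  have h1 : ContDiff ℝ ∞ fun p : E3 × E2 => p.2 1 := by fun_prop
  refine h1.contDiffOn.mul (hP.comp_contDiffOn (contDiff_fst.contDiffOn.prodMk ?_))
  exact h0.contDiffOn.div h1.contDiffOn fun p hp => hp

/-- `detX` is the last coordinate of `normal`; a lower bound for it therefore also keeps the normal
away from zero. -/
theorem detX_le_norm_normal (P : E3 × ℝ → ℝ) (x : E3 × ℝ) : |detX P x| ≤ ‖normal P x‖ := by
  have := PiLp.norm_apply_le (normal P x) 2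
  simpa [normal, cross_apply, detX] using this

/-- Quantitative nondegeneracy in slope form gives a controlled phase. -/
theorem isControlledPhase_persp {P : E3 × ℝ → ℝ} (hP : ContDiff ℝ ∞ P) {c₀ ρ r : ℝ} {A : ℕ → ℝ}
    (hc : 0 < c₀) (hr : 0 < r)
    (hb : ∀ k : ℕ, ∀ z ∈ Metric.ball (0 : E3) ρ, ∀ η ∈ cone r, ‖η‖ = 1 →
      ‖iteratedFDeriv ℝ k (fun p : E3 × E2 => persp P p.1 p.2) (z, η)‖ ≤ A k)
    (h1 : ∀ z ∈ Metric.ball (0 : E3) ρ, ∀ m ∈ Ioo (-r) r, 0 < vA P (z, m) 1)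
    (hJ : ∀ z ∈ Metric.ball (0 : E3) ρ, ∀ m ∈ Ioo (-r) r, c₀ ≤ detX P (z, m))
    (ht : ∀ z ∈ Metric.ball (0 : E3) ρ, ∀ m ∈ Ioo (-r) r,
      c₀ * ‖normal P (z, m)‖ ≤ triple P (z, m)) :
    IsControlledPhase c₀ ρ r A (persp P) (symbolOf P r) := by
  have hS := hasSlopeForm_persp hP ρ hr
  have hN : ∀ z ∈ Metric.ball (0 : E3) ρ, ∀ m ∈ Ioo (-r) r, 0 < ‖normal P (z, m)‖ :=
    fun z hz m hm => (hc.trans_le (hJ z hz m hm)).trans_le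
      ((le_abs_self _).trans (detX_le_norm_normal P _))
  have htr : ∀ z ∈ Metric.ball (0 : E3) ρ, ∀ η ∈ cone r,
      c₀ / η 1 ≤ (curvature (persp P) z η).trace := by
    intro z hz η hη
    have hm := slope_mem_Ioo hr hη
    have hη1 := pos_of_mem_cone hr hη
    rw [hS.trace_curvature hz hη]
    have h3 : c₀ ≤ triple P (z, η 0 / η 1) * ‖normal P (z, η 0 / η 1)‖⁻¹ := by
      rw [← div_eq_mul_inv, le_div_iff₀ (hN z hz _ hm)]; exact ht z hz _ hm
    have h4 : c₀ / η 1 ≤ triple P (z, η 0 / η 1) * ‖normal P (z, η 0 / η 1)‖⁻¹ / η 1 := by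
      gcongr
    have h5 : 0 < c₀ / η 1 := by positivity
    -- The trace carries the additional factor `1 + m² ≥ 1`, which is dropped.
    nlinarith [sq_nonneg (η 0 / η 1)]
  refine
    { smooth := (contDiffOn_persp hP).mono fun p hp => (pos_of_mem_cone hr hp.2).ne'
      homogeneous := ?_
      h1 := ?_
      h2 := ?_
      bound := hb
      nondegenerate := ?_
      curved := ?_
      q_differentiable := ?_
      q_eq := ?_ }
  · intro z _ η hη s hs
    simp only [persp, PiLp.smul_apply, smul_eq_mul, mul_div_mul_left _ _ hs.ne']
    ring
  · intro z hz η hη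
    apply HasSlopeForm.H1_of_det_ne_zero
    rw [hS.det_hessXη hz hη]
    exact (hc.trans_le (hJ z hz _ (slope_mem_Ioo hr hη))).ne'
  · intro z hz η hη
    refine hS.H2_of_trace_ne_zero hz hη ?_
    exact ((div_pos hc (pos_of_mem_cone hr hη)).trans_le (htr z hz η hη)).ne'
  · intro z hz η hη _
    rw [hS.det_hessXη hz hη]
    exact (hJ z hz _ (slope_mem_Ioo hr hη)).trans (le_abs_self _)
  · intro z hz η hη hn
    refine le_trans ?_ ((htr z hz η hη).trans (le_abs_self _))
    -- On the unit circle, division by `η 1` only improves the bound `c₀ / η 1`.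
    have h1 : η 1 ≤ 1 := by
      have := PiLp.norm_apply_le η 1
      rw [hn] at this
      exact (le_abs_self _).trans this
    rw [le_div_iff₀ (pos_of_mem_cone hr hη)]
    nlinarith
  · intro z hz η hη
    rw [hS.gradX_eq hz hη]
    exact (hasGradientAt_symbolOf hP (h1 z hz) (fun m hm => hc.trans_le (hJ z hz m hm))
      (slope_mem_Ioo hr hη) (pos_of_mem_cone hr hη)).1.differentiableAt
  · intro z hz η hη
    rw [hS.gradX_eq hz hη, hS.dz_eq hz hη]
    exact (hasGradientAt_symbolOf hP (h1 z hz) (fun m hm => hc.trans_le (hJ z hz m hm))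
      (slope_mem_Ioo hr hη) (pos_of_mem_cone hr hη)).2.symm

/-- The transversality quantity of a phase in slope form, before normalisation. -/
def transv (P : E3 × ℝ → ℝ) (z : E3) (m n m' : ℝ) : ℝ :=
  vA P (z, n) 0 * (gradQ₀ P (z, m) - gradQ₀ P (z, m')) +
    vA P (z, n) 1 * (gradQ₁ P (z, m) - gradQ₁ P (z, m'))

/-- The normalisation cancels the factor `ζ 1` of `∂_x φ`, and `∂_ξ q` is homogeneous of degree
zero. Transversality is thus a condition on slopes, which range over a compact set. -/
theorem inner_gradX_gradient {P : E3 × ℝ → ℝ} (hP : ContDiff ℝ ∞ P) {ρ r : ℝ} (hr : 0 < r)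
    (h1 : ∀ z ∈ Metric.ball (0 : E3) ρ, ∀ m ∈ Ioo (-r) r, 0 < vA P (z, m) 1)
    (hJ : ∀ z ∈ Metric.ball (0 : E3) ρ, ∀ m ∈ Ioo (-r) r, 0 < detX P (z, m))
    {z : E3} (hz : z ∈ Metric.ball (0 : E3) ρ) {η η' ζ : E2} (hη : η ∈ cone r) (hη' : η' ∈ cone r)
    (hζ : ζ ∈ cone r) :
    inner ℝ (‖gradX (persp P) z ζ‖⁻¹ • gradX (persp P) z ζ)
      (gradient (symbolOf P r z) (gradX (persp P) z η) -
        gradient (symbolOf P r z) (gradX (persp P) z η')) =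
    transv P z (η 0 / η 1) (ζ 0 / ζ 1) (η' 0 / η' 1) /
      √(vA P (z, ζ 0 / ζ 1) 0 ^ 2 + vA P (z, ζ 0 / ζ 1) 1 ^ 2) := by
  have hS := hasSlopeForm_persp hP ρ hr
  have g : ∀ {η : E2}, η ∈ cone r → gradient (symbolOf P r z) (gradX (persp P) z η) =
      !₂[gradQ₀ P (z, η 0 / η 1), gradQ₁ P (z, η 0 / η 1)] := by
    intro η hη
    rw [hS.gradX_eq hz hη]
    exact (hasGradientAt_symbolOf hP (h1 z hz) (hJ z hz) (slope_mem_Ioo hr hη)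
      (pos_of_mem_cone hr hη)).1.gradient
  have hζ1 := pos_of_mem_cone hr hζ
  have hn : ‖gradX (persp P) z ζ‖ =
      ζ 1 * √(vA P (z, ζ 0 / ζ 1) 0 ^ 2 + vA P (z, ζ 0 / ζ 1) 1 ^ 2) := by
    rw [hS.gradX_eq hz hζ, EuclideanSpace.norm_eq]
    simp only [Fin.sum_univ_two, Real.norm_eq_abs, sq_abs]
    simp only [Matrix.cons_val_zero, Matrix.cons_val_one]
    rw [mul_pow, mul_pow, ← mul_add, Real.sqrt_mul (sq_nonneg _), Real.sqrt_sq hζ1.le]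
  rw [g hη, g hη', inner_smul_left, hn, hS.gradX_eq hz hζ]
  simp only [PiLp.inner_apply, Fin.sum_univ_two]
  simp [transv]
  field_simp

end SqFn

end

noncomputable section

namespace SqFn

/-! ### Normal coordinates -/

theorem dirDeriv_comm {E F : Type} [NormedAddCommGroup E] [NormedSpace ℝ E]
    [NormedAddCommGroup F] [NormedSpace ℝ F] {f : E → F} (hf : ContDiff ℝ ∞ f) (v w : E) :
    dirDeriv v (dirDeriv w f) = dirDeriv w (dirDeriv v f) := by
  ext x
  have hs : IsSymmSndFDerivAt ℝ f x := hf.contDiffAt.isSymmSndFDerivAt (by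
    simp only [minSmoothness_of_isRCLikeNormedField]
    exact WithTop.coe_le_coe.2 (le_top : (2 : ℕ∞) ≤ ⊤))
  have hd : DifferentiableAt ℝ (fderiv ℝ f) x :=
    (hf.fderiv_right (m := ∞) (by simp)).differentiable (by simp) x
  have key : ∀ u : E, fderiv ℝ (fun y => fderiv ℝ f y u) x =
      (fderiv ℝ (fderiv ℝ f) x).flip u := by
    intro u
    have := hd.hasFDerivAt.clm_apply (hasFDerivAt_const u x)
    rw [this.fderiv]; ext; simp
  unfold dirDeriv
  rw [key, key]
  exact hs.eq v w

/-- A phase has a smooth slope form near `(0, e₂)`, with nonvanishing curvature. -/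
theorem IsPhase.exists_slopeForm {r : ℝ} (hr : 0 < r) {φ : E3 → E2 → ℝ} (hφ : IsPhase r r φ) :
    ∃ P : E3 × ℝ → ℝ, ∃ r₀ > 0, HasSlopeForm φ (Metric.ball 0 r₀) (cone r₀) P ∧
      triple P (0, 0) ≠ 0 := by
  let p : E3 × ℝ → ℝ := fun x => φ x.1 !₂[x.2, 1]
  have hp : ContDiffOn ℝ ∞ p (Metric.ball 0 r) := by
    have hg : ContDiff ℝ ∞ fun x : E3 × ℝ => (x.1, (!₂[x.2, 1] : E2)) := by
      refine contDiff_fst.prodMk ?_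
      rw [contDiff_euclidean]
      intro i; fin_cases i
      · exact contDiff_snd
      · exact contDiff_const
    refine hφ.smooth.comp hg.contDiffOn ?_
    rintro ⟨z, m⟩ hx
    have hx' : ‖z‖ < r ∧ |m| < r := by simpa [Prod.norm_def] using hx
    exact ⟨by simpa using hx'.1, by simpa [cone] using hx'.2⟩
  obtain ⟨P, hP, hPp⟩ := exists_contDiff_eqOn_ball hr hp
  have hr4 : 0 < r / 4 := by positivity
  have hS : HasSlopeForm φ (Metric.ball 0 (r / 4)) (cone (r / 4)) P := by
    refine ⟨Metric.isOpen_ball, isOpen_cone _, fun η h => pos_of_mem_cone hr4 h, hP, ?_⟩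
    intro z hz η hη
    have h1 := pos_of_mem_cone hr4 hη
    have h2 := slope_mem_Ioo hr4 hη
    have hmem : (z, η 0 / η 1) ∈ Metric.ball (0 : E3 × ℝ) (r / 4) := by
      simp only [mem_ball_zero_iff, Prod.norm_def, max_lt_iff] at hz ⊢
      exact ⟨hz, abs_lt.2 h2⟩
    -- Homogeneity reduces `φ` to its values on the line `η₂ = 1`.
    have h3 : η = η 1 • (!₂[η 0 / η 1, 1] : E2) := by
      ext i; fin_cases i
      · simp; field_simp
      · simp
    rw [persp, hPp hmem]
    conv_lhs => rw [h3]
    refine hφ.homogeneous z ?_ _ ?_ _ h1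
    · exact Metric.ball_subset_ball (by linarith) hz
    · have : |η 0 / η 1| < r / 4 := abs_lt.2 h2
      simp only [cone, mem_ofPred_eq]
      simp
      linarith
  refine ⟨P, r / 4, hr4, hS, ?_⟩
  have he : e₂ ∈ cone (r / 4) := by simp [cone, e₂]; positivity
  have he' : e₂ ∈ cone r := by simp [cone, e₂]; positivity
  have := hS.triple_ne_zero_of_H2 (z := 0) (Metric.mem_ball_self hr4) he
    (hφ.h2 0 (Metric.mem_ball_self hr) e₂ he')
  simpa [e₂] using this

/-- The coordinates `(∂_m P, P, ∂_m² P)` at slope `σ`. -/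
def coords (P : E3 × ℝ → ℝ) (x : ℝ × E3) : E3 :=
  !₂[pm P (x.2, x.1), P (x.2, x.1), pm (pm P) (x.2, x.1)]

theorem contDiff_coords {P : E3 × ℝ → ℝ} (hP : ContDiff ℝ ∞ P) : ContDiff ℝ ∞ (coords P) := by
  have hs : ContDiff ℝ ∞ fun x : ℝ × E3 => (x.2, x.1) := contDiff_snd.prodMk contDiff_fst
  rw [contDiff_euclidean]
  intro i; fin_cases i
  · exact (contDiff_pm hP).comp hs
  · exact hP.comp hs
  · exact (contDiff_pm (contDiff_pm hP)).comp hs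

/-- The spatial derivative of `coords`. -/
def coordsDeriv (P : E3 × ℝ → ℝ) (x : ℝ × E3) : E3 →L[ℝ] E3 :=
  (fderiv ℝ (coords P) x).comp (ContinuousLinearMap.inr ℝ ℝ E3)

theorem hasFDerivAt_coords_slice {P : E3 × ℝ → ℝ} (hP : ContDiff ℝ ∞ P) (σ : ℝ) (z : E3) :
    HasFDerivAt (fun z => coords P (σ, z)) (coordsDeriv P (σ, z)) z :=
  (((contDiff_coords hP).differentiable (by simp) (σ, z)).hasFDerivAt).comp z
    (hasFDerivAt_prodMk_right σ z)

theorem continuous_det_coordsDeriv {P : E3 × ℝ → ℝ} (hP : ContDiff ℝ ∞ P) :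
    Continuous fun x => (coordsDeriv P x).det :=
  ContinuousLinearMap.continuous_det.comp
    (((contDiff_coords hP).continuous_fderiv (by simp)).clm_comp continuous_const)

/-- After interchanging derivatives, the rows of the Jacobian at the origin are `∂_m ∂_z P`, `∂_z P`
and `∂_m² ∂_z P`, whose determinant is `triple`. -/
theorem det_coordsDeriv_ne_zero {P : E3 × ℝ → ℝ} (hP : ContDiff ℝ ∞ P)
    (h : triple P (0, 0) ≠ 0) : (coordsDeriv P (0, 0)).det ≠ 0 := by
  intro h0
  obtain ⟨u, hu, hu0⟩ := (Submodule.ne_bot_iff _).1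
    (bot_lt_iff_ne_bot.1 (LinearMap.bot_lt_ker_of_det_eq_zero h0))
  apply hu0
  have hu' : coordsDeriv P (0, 0) u = 0 := hu
  have comp : ∀ {Q : E3 × ℝ → ℝ} (_ : ContDiff ℝ ∞ Q) (i : Fin 3)
      (_ : ∀ z, coords P (0, z) i = Q (z, 0)), ∑ j, pz j Q (0, 0) * u j = 0 := by
    intro Q hQ i hi
    have h1 : HasFDerivAt (fun z => coords P (0, z) i)
        ((EuclideanSpace.proj i : E3 →L[ℝ] ℝ).comp (coordsDeriv P (0, 0))) 0 :=
      (EuclideanSpace.proj i : E3 →L[ℝ] ℝ).hasFDerivAt.comp 0 (hasFDerivAt_coords_slice hP 0 0)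
    simp only [hi] at h1
    have h2 : HasFDerivAt (fun z : E3 => Q (z, 0))
        ((fderiv ℝ Q (0, 0)).comp (ContinuousLinearMap.inl ℝ E3 ℝ)) 0 :=
      ((hQ.differentiable (by simp) ((0 : E3), (0 : ℝ))).hasFDerivAt).comp (0 : E3)
        (hasFDerivAt_prodMk_left (0 : E3) (0 : ℝ))
    have h3 := congrArg (fun L => L u) (h1.unique h2)
    simp only [ContinuousLinearMap.comp_apply, hu', map_zero] at h3
    have hsum : u = ∑ j, u j • (EuclideanSpace.single j (1 : ℝ) : E3) := by
      ext k; simp [Finset.sum_apply, Pi.single_apply]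
    rw [hsum, map_sum, map_sum] at h3
    refine Eq.trans ?_ h3.symm
    refine Finset.sum_congr rfl fun j _ => ?_
    rw [map_smul, map_smul, smul_eq_mul, mul_comm]
    rfl
  have hA := comp hP 1 (fun z => rfl)
  have hB := comp (contDiff_pm hP) 0 (fun z => rfl)
  have hC := comp (contDiff_pm (contDiff_pm hP)) 2 (fun z => rfl)
  have cB : ∀ j, pz j (pm P) = pm (pz j P) := fun j => dirDeriv_comm hP _ _
  have cC : ∀ j, pz j (pm (pm P)) = pm (pm (pz j P)) := fun j => by
    rw [← cB]; exact dirDeriv_comm (contDiff_pm hP) _ _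
  simp only [cB, cC] at hA hB hC
  let N : Matrix (Fin 3) (Fin 3) ℝ := ![vB P (0, 0), vA P (0, 0), vC P (0, 0)]
  have hN : N.det ≠ 0 := by
    convert h using 1
    rw [Matrix.det_fin_three]
    simp [triple, normal, cross_apply, Fin.sum_univ_three, N]
    ring
  have hv := Matrix.eq_zero_of_mulVec_eq_zero hN (v := fun j => u j) (by
    ext i; fin_cases i
    · exact hB
    · exact hA
    · exact hC)
  ext j
  exact congrFun hv j

/-- Smooth local inverses of the coordinates, jointly in the slope. -/
theorem exists_normal_coordinates {P : E3 × ℝ → ℝ} (hP : ContDiff ℝ ∞ P)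
    (h : triple P (0, 0) ≠ 0) :
    ∃ Z : ℝ × E3 → E3, ContDiff ℝ ∞ Z ∧ ∃ r₁ > 0, ∃ κ > 0,
      (∀ σ z, |σ| ≤ r₁ → ‖z‖ ≤ r₁ → Z (σ, coords P (σ, z)) = z) ∧
      (∀ σ w, |σ| ≤ r₁ → ‖w - coords P (0, 0)‖ < r₁ → coords P (σ, Z (σ, w)) = w) ∧
      (∀ σ z, |σ| ≤ r₁ → ‖z‖ ≤ r₁ →
        κ⁻¹ ≤ |(coordsDeriv P (σ, z)).det| ∧ |(coordsDeriv P (σ, z)).det| ≤ κ) := by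
  have hF := contDiff_coords hP
  -- Keeping `σ` as a component makes the local inverse smooth jointly in `σ`, as the compactness
  -- arguments in the parameters require.
  let Θ : ℝ × E3 → ℝ × E3 := fun x => (x.1, coords P x)
  have hΘ : ContDiff ℝ ∞ Θ := contDiff_fst.prodMk hF
  have hequiv : ∀ x, (coordsDeriv P x).det ≠ 0 →
      ∃ L : (ℝ × E3) ≃L[ℝ] (ℝ × E3), HasFDerivAt Θ (L : (ℝ × E3) →L[ℝ] (ℝ × E3)) x := by
    intro x hx
    let L₀ : (ℝ × E3) →L[ℝ] (ℝ × E3) :=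
      (ContinuousLinearMap.fst ℝ ℝ E3).prod (fderiv ℝ (coords P) x)
    have hL₀ : HasFDerivAt Θ L₀ x :=
      hasFDerivAt_fst.prodMk (hF.differentiable (by simp) x).hasFDerivAt
    have hinj : Function.Injective (L₀ : (ℝ × E3) →ₗ[ℝ] (ℝ × E3)) := by
      rw [← LinearMap.ker_eq_bot, Submodule.eq_bot_iff]
      rintro ⟨s, u⟩ hsu
      have hsu' : (s, fderiv ℝ (coords P) x (s, u)) = (0, 0) := hsu
      simp only [Prod.mk.injEq] at hsu'
      obtain ⟨rfl, h2⟩ := hsu'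
      have h3 : coordsDeriv P x u = 0 := by simpa [coordsDeriv] using h2
      have hk : LinearMap.ker (coordsDeriv P x : E3 →ₗ[ℝ] E3) = ⊥ := by
        by_contra hne
        exact hne (LinearEquiv.ker (LinearMap.equivOfDetNeZero _ hx))
      have : u ∈ LinearMap.ker (coordsDeriv P x : E3 →ₗ[ℝ] E3) := h3
      rw [hk] at this
      simp only [Submodule.mem_bot] at this
      simp [this]
    refine ⟨(LinearEquiv.ofInjectiveEndo _ hinj).toContinuousLinearEquiv, ?_⟩
    convert hL₀
    ext <;> rfl
  have hdet := det_coordsDeriv_ne_zero hP h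
  obtain ⟨L, hL⟩ := hequiv (0, 0) hdet
  let e := (hΘ.contDiffAt (x := (0, 0))).toOpenPartialHomeomorph Θ hL (by simp)
  have he : ∀ x, e x = Θ x := fun x => rfl
  have hes : ((0 : ℝ), (0 : E3)) ∈ e.source :=
    (hΘ.contDiffAt (x := (0, 0))).mem_toOpenPartialHomeomorph_source hL (by simp)
  -- Smoothness of the inverse is needed on a whole ball, so the derivative must be invertible at
  -- the preimage of each of its points and not only at the centre.
  let W : Set (ℝ × E3) := {x | (coordsDeriv P x).det ≠ 0}
  have hW : IsOpen W := isOpen_ne_fun (continuous_det_coordsDeriv hP) continuous_const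
  have hS : IsOpen (e.target ∩ e.symm ⁻¹' W) := e.isOpen_inter_preimage_symm hW
  have hmem : Θ (0, 0) ∈ e.target ∩ e.symm ⁻¹' W := by
    refine ⟨e.map_source hes, ?_⟩
    change e.symm (e (0, 0)) ∈ W
    rw [e.left_inv hes]; exact hdet
  obtain ⟨R, hR, hRS⟩ := Metric.isOpen_iff.1 hS _ hmem
  have hsm : ContDiffOn ℝ ∞ (fun y => (e.symm y).2) (Metric.ball (Θ (0, 0)) R) := by
    intro y hy
    obtain ⟨hy1, hy2⟩ := hRS hy
    obtain ⟨L', hL'⟩ := hequiv (e.symm y) hy2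
    exact (contDiffAt_snd.comp y
      (e.contDiffAt_symm hy1 hL' hΘ.contDiffAt)).contDiffWithinAt
  -- Passing to a globally smooth `Z` makes the rescaled slope forms smooth for all parameters, at
  -- the price of inverting the coordinates only locally.
  obtain ⟨Z, hZ, hZe⟩ := exists_contDiff_eqOn_ball hR hsm
  set d := |(coordsDeriv P (0, 0)).det| with hd
  have hdpos : 0 < d := abs_pos.2 hdet
  have ev1 : ∀ᶠ x in nhds ((0 : ℝ), (0 : E3)), x ∈ e.source := e.open_source.mem_nhds hes
  have ev2 : ∀ᶠ x in nhds ((0 : ℝ), (0 : E3)), Θ x ∈ Metric.ball (Θ (0, 0)) (R / 4) :=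
    hΘ.continuous.continuousAt (Metric.ball_mem_nhds _ (by positivity))
  have ev3 : ∀ᶠ x in nhds ((0 : ℝ), (0 : E3)), d / 2 < |(coordsDeriv P x).det| :=
    continuousAt_const.eventually_lt (continuous_det_coordsDeriv hP).abs.continuousAt
      (by simp only [← hd]; linarith)
  have ev4 : ∀ᶠ x in nhds ((0 : ℝ), (0 : E3)), |(coordsDeriv P x).det| < 2 * d :=
    (continuous_det_coordsDeriv hP).abs.continuousAt.eventually_lt continuousAt_const
      (by simp only [← hd]; linarith)
  obtain ⟨r', hr', hball⟩ := Metric.eventually_nhds_iff.1 (ev1.and (ev2.and (ev3.and ev4)))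
  set r₁ := min (r' / 2) (R / 8) with hr₁
  have hr₁pos : 0 < r₁ := by positivity
  have hin : ∀ σ : ℝ, ∀ z : E3, |σ| ≤ r₁ → ‖z‖ ≤ r₁ → dist (σ, z) ((0 : ℝ), (0 : E3)) < r' := by
    intro σ z hσ hz
    have : r₁ ≤ r' / 2 := min_le_left _ _
    simp only [Prod.dist_eq, dist_zero_right, Real.norm_eq_abs, max_lt_iff]
    constructor <;> linarith
  refine ⟨Z, hZ, r₁, hr₁pos, max (2 * d) (d / 2)⁻¹, by positivity, ?_, ?_, ?_⟩
  · intro σ z hσ hz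
    obtain ⟨h1, h2, -, -⟩ := hball (hin σ z hσ hz)
    have : Z (Θ (σ, z)) = (e.symm (e (σ, z))).2 := hZe h2
    rw [e.left_inv h1] at this
    exact this
  · intro σ w hσ hw
    have hb : (σ, w) ∈ Metric.ball (Θ (0, 0)) (R / 4) := by
      have : r₁ ≤ R / 8 := min_le_right _ _
      rw [Metric.mem_ball, Prod.dist_eq, max_lt_iff]
      simp only [Θ, Real.norm_eq_abs, dist_eq_norm]
      constructor
      · simp; linarith
      · linarith
    have ht := (hRS (Metric.ball_subset_ball (by linarith) hb)).1
    have h1 : Z (σ, w) = (e.symm (σ, w)).2 := hZe hb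
    have h2 : Θ (e.symm (σ, w)) = (σ, w) := e.right_inv ht
    have h3 : (e.symm (σ, w)).1 = σ := congrArg Prod.fst h2
    have h4 : coords P (e.symm (σ, w)) = w := congrArg Prod.snd h2
    rw [h1]
    nth_rewrite 1 [← h3]
    exact h4
  · intro σ z hσ hz
    obtain ⟨-, -, h3, h4⟩ := hball (hin σ z hσ hz)
    refine ⟨?_, h4.le.trans (le_max_left _ _)⟩
    refine le_trans ?_ h3.le
    rw [inv_le_comm₀ (by positivity) (by positivity)]
    exact le_max_right _ _

end SqFn

end

noncomputable section

namespace SqFn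

/-! ### The rescaled phases -/

/-- The anisotropic dilation `(δ v₁, δ² v₂, v₃)`. -/
def aniso (δ : ℝ) (v : E3) : E3 := !₂[δ * v 0, δ ^ 2 * v 1, v 2]

/-- The parameters `(δ, σ, w₀)` of a rescaling: angular width, slope, and spatial centre. -/
abbrev Par := ℝ × ℝ × E3

/-- The point with rescaled coordinates `v`. -/
def place (Z : ℝ × E3 → E3) (π : Par) (v : E3) : E3 := Z (π.2.1, π.2.2 + aniso π.1 v)

/-- The slope form of the rescaled phases, as a function of the parameters and of `(v, m)`. -/
def resc (P : E3 × ℝ → ℝ) (Z : ℝ × E3 → E3) (x : Par × (E3 × ℝ)) : ℝ :=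
  x.2.1 0 * x.2.2 + x.2.1 1 + x.2.2 ^ 2 * ∫ s in (0 : ℝ)..1,
    (1 - s) * pm (pm P) (place Z x.1 x.2.1, x.1.2.1 + s * (x.1.1 * x.2.2))

theorem norm_aniso_le {δ : ℝ} (h : |δ| ≤ 1) (v : E3) : ‖aniso δ v‖ ≤ ‖v‖ := by
  rw [EuclideanSpace.norm_eq, EuclideanSpace.norm_eq]
  apply Real.sqrt_le_sqrt
  simp only [Fin.sum_univ_three, aniso, Real.norm_eq_abs, sq_abs]
  simp only [Matrix.cons_val_zero, Matrix.cons_val_one, Matrix.cons_val]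
  have h2 : δ ^ 2 ≤ 1 := by rw [← sq_abs]; nlinarith [abs_nonneg δ]
  have h4 : (δ ^ 2) ^ 2 ≤ 1 := by nlinarith [sq_nonneg δ]
  nlinarith [sq_nonneg (v 0), sq_nonneg (v 1)]

theorem contDiff_aniso : ContDiff ℝ ∞ fun x : ℝ × E3 => aniso x.1 x.2 := by
  rw [contDiff_euclidean]
  intro i; fin_cases i
  · exact contDiff_fst.mul (by fun_prop)
  · exact (contDiff_fst.pow 2).mul (by fun_prop)
  · change ContDiff ℝ ∞ fun x : ℝ × E3 => x.2 2
    fun_prop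

theorem contDiff_place {Z : ℝ × E3 → E3} (hZ : ContDiff ℝ ∞ Z) :
    ContDiff ℝ ∞ fun x : Par × E3 => place Z x.1 x.2 := by
  refine hZ.comp (ContDiff.prodMk (by fun_prop) (ContDiff.add (by fun_prop) ?_))
  exact contDiff_aniso.comp (ContDiff.prodMk (by fun_prop) (by fun_prop))

/-- The integral remainder involves no division by `δ²`; smoothness through `δ = 0` is what permits
comparison with the model. -/
theorem contDiff_resc {P : E3 × ℝ → ℝ} {Z : ℝ × E3 → E3} (hP : ContDiff ℝ ∞ P)
    (hZ : ContDiff ℝ ∞ Z) : ContDiff ℝ ∞ (resc P Z) := by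
  have h0 : ContDiff ℝ ∞ fun x : Par × (E3 × ℝ) => x.2.1 0 := by fun_prop
  have h1 : ContDiff ℝ ∞ fun x : Par × (E3 × ℝ) => x.2.1 1 := by fun_prop
  have h2 : ContDiff ℝ ∞ fun x : Par × (E3 × ℝ) => x.2.2 := by fun_prop
  refine ((h0.mul h2).add h1).add ((h2.pow 2).mul ?_)
  have hinteg : ContDiff ℝ ∞ fun p : (Par × (E3 × ℝ)) × ℝ =>
      (1 - p.2) * pm (pm P) (place Z p.1.1 p.1.2.1, p.1.1.2.1 + p.2 * (p.1.1.1 * p.1.2.2)) := by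
    refine ContDiff.mul (by fun_prop) ((contDiff_pm (contDiff_pm hP)).comp
      (ContDiff.prodMk ?_ (by fun_prop)))
    exact (contDiff_place hZ).comp (g := fun x : Par × E3 => place Z x.1 x.2)
      (f := fun p : (Par × (E3 × ℝ)) × ℝ => (p.1.1, p.1.2.1)) (by fun_prop)
  exact contDiff_intervalIntegral hinteg 0 1

/-- The phase in terms of the rescaled phase. -/
theorem slopeForm_eq_resc {P : E3 × ℝ → ℝ} {Z : ℝ × E3 → E3} (hP : ContDiff ℝ ∞ P) {π : Par}
    {v : E3} (hZ : coords P (π.2.1, place Z π v) = π.2.2 + aniso π.1 v) (m : ℝ) :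
    P (place Z π v, π.2.1 + π.1 * m) =
      π.2.2 1 + π.1 * m * π.2.2 0 + π.1 ^ 2 * resc P Z (π, v, m) := by
  have h0 : pm P (place Z π v, π.2.1) = π.2.2 0 + π.1 * v 0 := by
    simpa [aniso, coords] using congrArg (fun w : E3 => w 0) hZ
  have h1 : P (place Z π v, π.2.1) = π.2.2 1 + π.1 ^ 2 * v 1 := by
    simpa [aniso, coords] using congrArg (fun w : E3 => w 1) hZ
  -- In normal coordinates the Taylor coefficients of order zero and one at `σ` are themselves
  -- coordinates, hence affine in `v`. The anisotropic dilation is chosen so that their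
  -- `v`-dependent parts carry the factor `δ²`.
  rw [taylor_two_last hP]
  change P (place Z π v, π.2.1) + π.1 * m * pm P (place Z π v, π.2.1) + _ = _
  rw [h0, h1, resc]
  simp only [pm]
  ring

/-- The model slope form `v₁ m + v₂ + (m²/2) (c + v₃)`. -/
def model (c : ℝ) (x : E3 × ℝ) : ℝ := x.1 0 * x.2 + x.1 1 + x.2 ^ 2 / 2 * (c + x.1 2)

theorem contDiff_model (c : ℝ) : ContDiff ℝ ∞ (model c) := by
  unfold model
  have h0 : ContDiff ℝ ∞ fun x : E3 × ℝ => x.1 0 := by fun_prop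
  have h1 : ContDiff ℝ ∞ fun x : E3 × ℝ => x.1 1 := by fun_prop
  have h2 : ContDiff ℝ ∞ fun x : E3 × ℝ => x.1 2 := by fun_prop
  fun_prop

theorem hasDerivAt_pz {Q : E3 × ℝ → ℝ} (hQ : ContDiff ℝ ∞ Q) (i : Fin 3) (x : E3 × ℝ) :
    HasDerivAt (fun s : ℝ => Q (x.1 + s • EuclideanSpace.single i 1, x.2)) (pz i Q x) 0 := by
  have h2 : HasDerivAt (fun s : ℝ => (x.1 + s • (EuclideanSpace.single i 1 : E3), x.2))
      (EuclideanSpace.single i 1, 0) 0 := by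
    refine HasDerivAt.prodMk ?_ (hasDerivAt_const _ _)
    simpa using ((hasDerivAt_id (0 : ℝ)).smul_const (EuclideanSpace.single i 1 : E3)).const_add x.1
  have h1 : HasFDerivAt Q (fderiv ℝ Q x) (x.1 + (0 : ℝ) • (EuclideanSpace.single i 1 : E3), x.2) := by
    simpa using (hQ.differentiable (by simp) x).hasFDerivAt
  exact h1.comp_hasDerivAt (0 : ℝ) h2

theorem pz_model (c : ℝ) (x : E3 × ℝ) :
    pz 0 (model c) x = x.2 ∧ pz 1 (model c) x = 1 ∧ pz 2 (model c) x = x.2 ^ 2 / 2 := by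
  have lin : ∀ a b : ℝ, HasDerivAt (fun s : ℝ => b + s * a) a 0 := fun a b => by
    simpa using ((hasDerivAt_id (0 : ℝ)).mul_const a).const_add b
  refine ⟨(hasDerivAt_pz (contDiff_model c) 0 x).unique ?_,
    (hasDerivAt_pz (contDiff_model c) 1 x).unique ?_,
    (hasDerivAt_pz (contDiff_model c) 2 x).unique ?_⟩
  · refine (lin x.2 (model c x)).congr_of_eventuallyEq (.of_forall fun s => ?_)
    simp [model]; ring
  · refine (lin 1 (model c x)).congr_of_eventuallyEq (.of_forall fun s => ?_)
    simp [model]; ring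
  · refine (lin (x.2 ^ 2 / 2) (model c x)).congr_of_eventuallyEq (.of_forall fun s => ?_)
    simp [model]; ring

theorem vA_model (c : ℝ) (x : E3 × ℝ) : vA (model c) x = ![x.2, 1, x.2 ^ 2 / 2] := by
  obtain ⟨h0, h1, h2⟩ := pz_model c x
  ext i; fin_cases i
  exacts [h0, h1, h2]

theorem pm_pz_model (c : ℝ) (x : E3 × ℝ) :
    pm (pz 0 (model c)) x = 1 ∧ pm (pz 1 (model c)) x = 0 ∧ pm (pz 2 (model c)) x = x.2 := by
  obtain ⟨z, m⟩ := x
  refine ⟨(hasDerivAt_pm (contDiff_pz (contDiff_model c) 0) z m).unique ?_,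
    (hasDerivAt_pm (contDiff_pz (contDiff_model c) 1) z m).unique ?_,
    (hasDerivAt_pm (contDiff_pz (contDiff_model c) 2) z m).unique ?_⟩
  · simp only [(pz_model c _).1]; exact hasDerivAt_id m
  · simp only [(pz_model c _).2.1]; exact hasDerivAt_const m 1
  · simp only [(pz_model c _).2.2]
    refine (((hasDerivAt_id m).pow 2).div_const 2).congr_deriv ?_
    simp

theorem vB_model (c : ℝ) (x : E3 × ℝ) : vB (model c) x = ![1, 0, x.2] := by
  obtain ⟨h0, h1, h2⟩ := pm_pz_model c x
  ext i; fin_cases i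
  exacts [h0, h1, h2]

theorem vC_model (c : ℝ) (x : E3 × ℝ) : vC (model c) x = ![0, 0, 1] := by
  obtain ⟨z, m⟩ := x
  ext i; fin_cases i
  · refine (hasDerivAt_pm (contDiff_pm (contDiff_pz (contDiff_model c) 0)) z m).unique ?_
    simp only [(pm_pz_model c _).1]; exact hasDerivAt_const m 1
  · refine (hasDerivAt_pm (contDiff_pm (contDiff_pz (contDiff_model c) 1)) z m).unique ?_
    simp only [(pm_pz_model c _).2.1]; exact hasDerivAt_const m 0
  · refine (hasDerivAt_pm (contDiff_pm (contDiff_pz (contDiff_model c) 2)) z m).unique ?_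
    simp only [(pm_pz_model c _).2.2]; exact hasDerivAt_id m

/-! ### Continuity of the slope data in the parameters -/

section Joint

variable {P : E3 × ℝ → ℝ} {Z : ℝ × E3 → E3}

theorem continuous_vA_resc (hP : ContDiff ℝ ∞ P) (hZ : ContDiff ℝ ∞ Z) (i : Fin 3) :
    Continuous fun p : Par × (E3 × ℝ) => vA (fun x => resc P Z (p.1, x)) p.2 i := by
  simp only [vA, pz, dirDeriv_slice (contDiff_resc hP hZ)]
  exact (contDiff_dirDeriv (contDiff_resc hP hZ) _).continuous

theorem continuous_vB_resc (hP : ContDiff ℝ ∞ P) (hZ : ContDiff ℝ ∞ Z) (i : Fin 3) :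
    Continuous fun p : Par × (E3 × ℝ) => vB (fun x => resc P Z (p.1, x)) p.2 i := by
  have h1 := contDiff_dirDeriv (contDiff_resc hP hZ) (0, (EuclideanSpace.single i 1, 0))
  simp only [vB, pm, pz, dirDeriv_slice (contDiff_resc hP hZ), dirDeriv_slice h1]
  exact (contDiff_dirDeriv h1 _).continuous

theorem continuous_vC_resc (hP : ContDiff ℝ ∞ P) (hZ : ContDiff ℝ ∞ Z) (i : Fin 3) :
    Continuous fun p : Par × (E3 × ℝ) => vC (fun x => resc P Z (p.1, x)) p.2 i := by
  have h1 := contDiff_dirDeriv (contDiff_resc hP hZ) (0, (EuclideanSpace.single i 1, 0))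
  have h2 := contDiff_dirDeriv h1 (0, (0, 1))
  simp only [vC, pm, pz, dirDeriv_slice (contDiff_resc hP hZ), dirDeriv_slice h1,
    dirDeriv_slice h2]
  exact (contDiff_dirDeriv h2 _).continuous

theorem continuous_detX_resc (hP : ContDiff ℝ ∞ P) (hZ : ContDiff ℝ ∞ Z) :
    Continuous fun p : Par × (E3 × ℝ) => detX (fun x => resc P Z (p.1, x)) p.2 := by
  have hA := continuous_vA_resc hP hZ
  have hB := continuous_vB_resc hP hZ
  exact ((hB 0).mul (hA 1)).sub ((hB 1).mul (hA 0))

theorem continuous_normal_resc (hP : ContDiff ℝ ∞ P) (hZ : ContDiff ℝ ∞ Z) :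
    Continuous fun p : Par × (E3 × ℝ) => normal (fun x => resc P Z (p.1, x)) p.2 := by
  have hA := continuous_vA_resc hP hZ
  have hB := continuous_vB_resc hP hZ
  simp only [normal, cross_apply]
  refine (PiLp.continuous_toLp 2 _).comp (continuous_pi fun i => ?_)
  fin_cases i
  · exact ((hB 1).mul (hA 2)).sub ((hB 2).mul (hA 1))
  · exact ((hB 2).mul (hA 0)).sub ((hB 0).mul (hA 2))
  · exact ((hB 0).mul (hA 1)).sub ((hB 1).mul (hA 0))

theorem continuous_triple_resc (hP : ContDiff ℝ ∞ P) (hZ : ContDiff ℝ ∞ Z) :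
    Continuous fun p : Par × (E3 × ℝ) => triple (fun x => resc P Z (p.1, x)) p.2 := by
  refine continuous_finsetSum _ fun i _ => (continuous_vC_resc hP hZ i).mul ?_
  exact (EuclideanSpace.proj i : E3 →L[ℝ] ℝ).continuous.comp (continuous_normal_resc hP hZ)

theorem continuousAt_gradQ₀_resc (hP : ContDiff ℝ ∞ P) (hZ : ContDiff ℝ ∞ Z) {p : Par × (E3 × ℝ)}
    (h : detX (fun x => resc P Z (p.1, x)) p.2 ≠ 0) :
    ContinuousAt (fun p : Par × (E3 × ℝ) => gradQ₀ (fun x => resc P Z (p.1, x)) p.2) p := by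
  have hA := fun i => (continuous_vA_resc hP hZ i).continuousAt (x := p)
  have hB := fun i => (continuous_vB_resc hP hZ i).continuousAt (x := p)
  exact (((hB 2).mul (hA 1)).sub ((hA 2).mul (hB 1))).div
    (continuous_detX_resc hP hZ).continuousAt h

theorem continuousAt_gradQ₁_resc (hP : ContDiff ℝ ∞ P) (hZ : ContDiff ℝ ∞ Z) {p : Par × (E3 × ℝ)}
    (h : detX (fun x => resc P Z (p.1, x)) p.2 ≠ 0)
    (h1 : vA (fun x => resc P Z (p.1, x)) p.2 1 ≠ 0) :
    ContinuousAt (fun p : Par × (E3 × ℝ) => gradQ₁ (fun x => resc P Z (p.1, x)) p.2) p := by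
  have hA := fun i => (continuous_vA_resc hP hZ i).continuousAt (x := p)
  exact ((hA 2).div (hA 1) h1).sub
    (((hA 0).div (hA 1) h1).mul (continuousAt_gradQ₀_resc hP hZ h))

end Joint

/-- Near `(v, m)`, at `δ = 0`, the rescaled phase is the model phase. -/
theorem resc_zero_eventuallyEq {P : E3 × ℝ → ℝ} {Z : ℝ × E3 → E3} {r₁ : ℝ} {w₁ : E3}
    (hb : ∀ σ w, |σ| ≤ r₁ → ‖w - w₁‖ < r₁ → coords P (σ, Z (σ, w)) = w)
    {σ : ℝ} (hσ : |σ| ≤ r₁) {w₀ v : E3} (hv : ‖w₀ - w₁‖ + ‖v‖ < r₁) (m : ℝ) :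
    (fun x => resc P Z ((0, σ, w₀), x)) =ᶠ[nhds (v, m)] model (w₀ 2) := by
  have hopen : ∀ᶠ x : E3 × ℝ in nhds (v, m), ‖w₀ - w₁‖ + ‖x.1‖ < r₁ := by
    have : Continuous fun x : E3 × ℝ => ‖w₀ - w₁‖ + ‖x.1‖ := by fun_prop
    exact this.continuousAt.eventually_lt continuousAt_const hv
  filter_upwards [hopen] with x hx
  have hw : ‖w₀ + aniso 0 x.1 - w₁‖ < r₁ := by
    have h1 := norm_aniso_le (δ := 0) (by simp) x.1
    have h2 : w₀ + aniso 0 x.1 - w₁ = (w₀ - w₁) + aniso 0 x.1 := by abel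
    rw [h2]
    exact (norm_add_le _ _).trans_lt (by linarith)
  -- At `δ = 0` the dilation keeps only the third coordinate, which is `∂_m² P`, and the slope stays
  -- at `σ`. The integrand is then a constant times `1 - s`.
  have h2 : pm (pm P) (place Z (0, σ, w₀) x.1, σ) = w₀ 2 + x.1 2 := by
    have := congrArg (fun w : E3 => w 2) (hb σ _ hσ hw)
    simpa [coords, aniso, place] using this
  simp only [resc, model, zero_mul, mul_zero, add_zero, h2]
  rw [intervalIntegral.integral_mul_const]
  have : ∫ s in (0 : ℝ)..1, (1 - s) = 1 / 2 := by
    rw [intervalIntegral.integral_sub (by simp) (by simp)]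
    simp; norm_num
  rw [this]; ring

/-- These derivatives depend only on the germ in `(v, m)`, so they are the derivatives of the model.
-/
theorem slope_data_resc_zero {P : E3 × ℝ → ℝ} {Z : ℝ × E3 → E3} {r₁ : ℝ} {w₁ : E3}
    (hb : ∀ σ w, |σ| ≤ r₁ → ‖w - w₁‖ < r₁ → coords P (σ, Z (σ, w)) = w)
    {σ : ℝ} (hσ : |σ| ≤ r₁) {w₀ v : E3} (hv : ‖w₀ - w₁‖ + ‖v‖ < r₁) (m : ℝ) :
    vA (fun x => resc P Z ((0, σ, w₀), x)) (v, m) = ![m, 1, m ^ 2 / 2] ∧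
      vB (fun x => resc P Z ((0, σ, w₀), x)) (v, m) = ![1, 0, m] ∧
      vC (fun x => resc P Z ((0, σ, w₀), x)) (v, m) = ![0, 0, 1] := by
  have he := resc_zero_eventuallyEq hb hσ hv m
  refine ⟨?_, ?_, ?_⟩
  · rw [← vA_model (w₀ 2) (v, m)]
    ext i
    exact dirDeriv_congr he _
  · rw [← vB_model (w₀ 2) (v, m)]
    ext i
    exact dirDeriv_congr (dirDeriv_eventuallyEq he _) _
  · rw [← vC_model (w₀ 2) (v, m)]
    ext i
    exact dirDeriv_congr (dirDeriv_eventuallyEq (dirDeriv_eventuallyEq he _) _) _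

/-! ### Uniform control of the rescaled phases by compactness -/

theorem isCompact_cone_sphere (r : ℝ) : IsCompact {η : E2 | ‖η‖ = 1 ∧ |η 0| ≤ r * η 1} := by
  refine (isCompact_sphere (0 : E2) 1).of_isClosed_subset ?_ fun η hη => by simpa using hη.1
  have h1 : IsClosed {η : E2 | ‖η‖ = 1} := isClosed_eq (by fun_prop) (by fun_prop)
  have h2 : IsClosed {η : E2 | |η 0| ≤ r * η 1} := isClosed_le (by fun_prop) (by fun_prop)
  exact h1.inter h2

/-- Uniform control of the derivatives of the rescaled phases. -/
theorem exists_bound_resc {P : E3 × ℝ → ℝ} {Z : ℝ × E3 → E3} (hP : ContDiff ℝ ∞ P)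
    (hZ : ContDiff ℝ ∞ Z) (K : Set Par) (hK : IsCompact K) (ρ r : ℝ) :
    ∃ A : ℕ → ℝ, ∀ π ∈ K, ∀ k : ℕ, ∀ z ∈ Metric.ball (0 : E3) ρ, ∀ η ∈ cone r, ‖η‖ = 1 →
      ‖iteratedFDeriv ℝ k (fun p : E3 × E2 => persp (fun x => resc P Z (π, x)) p.1 p.2) (z, η)‖
        ≤ A k := by
  let F : Par × (E3 × E2) → ℝ := fun x => x.2.2 1 * resc P Z (x.1, x.2.1, x.2.2 0 / x.2.2 1)
  have hU : IsOpen {x : Par × (E3 × E2) | x.2.2 1 ≠ 0} :=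
    isOpen_ne_fun (by fun_prop) continuous_const
  have h0 : ContDiff ℝ ∞ fun x : Par × (E3 × E2) => x.2.2 0 := by fun_prop
  have h1 : ContDiff ℝ ∞ fun x : Par × (E3 × E2) => x.2.2 1 := by fun_prop
  have hF : ContDiffOn ℝ ∞ F {x | x.2.2 1 ≠ 0} := by
    refine h1.contDiffOn.mul ((contDiff_resc hP hZ).comp_contDiffOn
      (ContDiffOn.prodMk (by fun_prop) (ContDiffOn.prodMk (by fun_prop) ?_)))
    exact h0.contDiffOn.div h1.contDiffOn fun x hx => hx
  obtain ⟨A, hA⟩ := exists_bound_iteratedFDeriv_slice hU hF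
    (hK.prod ((isCompact_closedBall (0 : E3) ρ).prod (isCompact_cone_sphere r))) (by
      rintro ⟨π, v, η⟩ ⟨-, -, hη1, hη2⟩
      simp only [mem_ofPred_eq]
      intro h0
      have h2 : η 0 = 0 := by rw [h0, mul_zero] at hη2; exact abs_nonpos_iff.1 hη2
      have : η = 0 := by ext i; fin_cases i <;> simp [h0, h2]
      rw [this, norm_zero] at hη1
      exact zero_ne_one hη1)
  refine ⟨A, fun π hπ k z hz η hη hn => ?_⟩
  exact hA k π (z, η) ⟨hπ, Metric.ball_subset_closedBall hz, hn, le_of_lt hη⟩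

set_option maxHeartbeats 1000000 in
/-- For small `δ` the rescaled phases are uniformly controlled, and transversal on pairs of
directions with separated slopes. -/
theorem exists_controlled_resc {P : E3 × ℝ → ℝ} {Z : ℝ × E3 → E3} (hP : ContDiff ℝ ∞ P)
    (hZ : ContDiff ℝ ∞ Z) {r₁ : ℝ} (hr₁ : 0 < r₁) {w₁ : E3}
    (hb : ∀ σ w, |σ| ≤ r₁ → ‖w - w₁‖ < r₁ → coords P (σ, Z (σ, w)) = w)
    {r s c : ℝ} (hr : 0 < r) (hs : 0 < s) (hc : 0 < c) :
    ∃ d > 0, ∃ c₀ > 0, ∃ A : ℕ → ℝ, c₀ ≤ c ∧ ∀ δ σ : ℝ, ∀ w₀ : E3, |δ| ≤ d → |σ| ≤ r₁ →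
      ‖w₀ - w₁‖ ≤ r₁ / 2 →
      IsControlledPhase c₀ (r₁ / 4) r A (persp fun x => resc P Z ((δ, σ, w₀), x))
        (symbolOf (fun x => resc P Z ((δ, σ, w₀), x)) r) ∧
      ∀ v ∈ Metric.ball (0 : E3) (r₁ / 4), ∀ η ∈ cone r, ∀ η' ∈ cone r,
        s ≤ |η 0 / η 1 - η' 0 / η' 1| → ∀ ζ : E2, ζ = η ∨ ζ = η' →
        c₀ ≤ |inner ℝ (‖gradX (persp fun x => resc P Z ((δ, σ, w₀), x)) v ζ‖⁻¹ •
            gradX (persp fun x => resc P Z ((δ, σ, w₀), x)) v ζ)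
          (gradient (symbolOf (fun x => resc P Z ((δ, σ, w₀), x)) r v)
              (gradX (persp fun x => resc P Z ((δ, σ, w₀), x)) v η) -
            gradient (symbolOf (fun x => resc P Z ((δ, σ, w₀), x)) r v)
              (gradX (persp fun x => resc P Z ((δ, σ, w₀), x)) v η'))| := by
  -- The values come from the model: there `triple = 1` and the normal has norm at most `1 + r +
  -- r²`; the transversality quantity is `(m - m')²/2 ≥ s²/2`, against `|∂_x φ|/η₂ ≤ 1 + r`. The
  -- spare factors of two make the inequalities strict. Including `c` lets the same constant serve
  -- for the separation of angles.
  set c₀ := min c (min (1 / (2 * (1 + r + r ^ 2))) (s ^ 2 / (4 * (1 + r)))) with hc₀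
  have hc₀pos : 0 < c₀ := by positivity
  have hc₀1 : c₀ * (1 + r + r ^ 2) ≤ 1 / 2 := by
    have : c₀ ≤ 1 / (2 * (1 + r + r ^ 2)) := (min_le_right _ _).trans (min_le_left _ _)
    rw [le_div_iff₀ (by positivity)] at this
    linarith
  have hc₀2 : c₀ * (1 + r) ≤ s ^ 2 / 4 := by
    have : c₀ ≤ s ^ 2 / (4 * (1 + r)) := (min_le_right _ _).trans (min_le_right _ _)
    rw [le_div_iff₀ (by positivity)] at this
    linarith
  have hc₀3 : c₀ < 1 := by nlinarith
  -- the compact sets of parameters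
  let Y₁ : Set (ℝ × E3) := Icc (-r₁) r₁ ×ˢ Metric.closedBall w₁ (r₁ / 2)
  let Y₂ : Set ((ℝ × E3) × (E3 × ℝ)) := Y₁ ×ˢ (Metric.closedBall 0 (r₁ / 4) ×ˢ Icc (-r) r)
  -- Transversality degenerates on the diagonal, so the pairs of slopes are kept at distance `s`.
  let Y₃ : Set ((ℝ × E3) × (E3 × (ℝ × ℝ))) := Y₁ ×ˢ (Metric.closedBall 0 (r₁ / 4) ×ˢ
    {m : ℝ × ℝ | m ∈ Icc (-r) r ×ˢ Icc (-r) r ∧ s ≤ |m.1 - m.2|})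
  have hY₁ : IsCompact Y₁ := isCompact_Icc.prod (isCompact_closedBall _ _)
  have hY₂ : IsCompact Y₂ := hY₁.prod ((isCompact_closedBall _ _).prod isCompact_Icc)
  have hY₃ : IsCompact Y₃ := hY₁.prod ((isCompact_closedBall _ _).prod
    ((isCompact_Icc.prod isCompact_Icc).inter_right
      (isClosed_le continuous_const (by fun_prop) : IsClosed {m : ℝ × ℝ | s ≤ |m.1 - m.2|})))
  have data : ∀ σ w₀ v, |σ| ≤ r₁ → ‖w₀ - w₁‖ ≤ r₁ / 2 → ‖v‖ ≤ r₁ / 4 → ∀ m : ℝ, _ :=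
    fun σ w₀ v h1 h2 h3 m => slope_data_resc_zero hb h1 (w₀ := w₀) (v := v) (by linarith) m
  have hd0 : ∀ σ w₀ v, |σ| ≤ r₁ → ‖w₀ - w₁‖ ≤ r₁ / 2 → ‖v‖ ≤ r₁ / 4 → ∀ m : ℝ,
      detX (fun x => resc P Z ((0, σ, w₀), x)) (v, m) = 1 := by
    intro σ w₀ v h1 h2 h3 m
    obtain ⟨a, b, -⟩ := data σ w₀ v h1 h2 h3 m
    rw [detX, a, b]; simp
  have hn0 : ∀ σ w₀ v, |σ| ≤ r₁ → ‖w₀ - w₁‖ ≤ r₁ / 2 → ‖v‖ ≤ r₁ / 4 → ∀ m : ℝ,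
      normal (fun x => resc P Z ((0, σ, w₀), x)) (v, m) = !₂[-m, m ^ 2 / 2, 1] := by
    intro σ w₀ v h1 h2 h3 m
    obtain ⟨a, b, -⟩ := data σ w₀ v h1 h2 h3 m
    rw [normal, a, b]
    congr 1
    simp only [cross_apply]
    ext i; fin_cases i <;> simp <;> ring
  have ht0 : ∀ σ w₀ v, |σ| ≤ r₁ → ‖w₀ - w₁‖ ≤ r₁ / 2 → ‖v‖ ≤ r₁ / 4 → ∀ m : ℝ,
      triple (fun x => resc P Z ((0, σ, w₀), x)) (v, m) = 1 := by
    intro σ w₀ v h1 h2 h3 m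
    obtain ⟨a, b, c⟩ := data σ w₀ v h1 h2 h3 m
    rw [triple, hn0 σ w₀ v h1 h2 h3 m, c]; simp [Fin.sum_univ_three]
  have mem₁ : ∀ {σ : ℝ} {w₀ : E3}, (σ, w₀) ∈ Y₁ ↔ |σ| ≤ r₁ ∧ ‖w₀ - w₁‖ ≤ r₁ / 2 := by
    intro σ w₀
    simp only [Y₁, mem_prod, mem_Icc, abs_le, Metric.mem_closedBall, dist_eq_norm]
  -- reordering of the variables
  let τ : ℝ × ((ℝ × E3) × (E3 × ℝ)) → Par × (E3 × ℝ) := fun y => ((y.1, y.2.1), y.2.2)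
  have hτ : Continuous τ := by fun_prop
  obtain ⟨d₁, hd₁, H₁⟩ := exists_forall_lt_of_compact hY₂
    (f := fun _ => 0) (g := fun y => vA (fun x => resc P Z ((τ y).1, x)) (τ y).2 1)
    (fun _ _ => continuousAt_const)
    (fun _ _ => ((continuous_vA_resc hP hZ 1).comp hτ).continuousAt) (by
      rintro ⟨⟨σ, w₀⟩, v, m⟩ ⟨hy1, hy2, -⟩
      obtain ⟨a, -, -⟩ := data σ w₀ v (mem₁.1 hy1).1 (mem₁.1 hy1).2 (by simpa using hy2) m
      simp only [τ]
      rw [a]; simp)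
  obtain ⟨d₂, hd₂, H₂⟩ := exists_forall_lt_of_compact hY₂
    (f := fun _ => c₀) (g := fun y => detX (fun x => resc P Z ((τ y).1, x)) (τ y).2)
    (fun _ _ => continuousAt_const)
    (fun _ _ => ((continuous_detX_resc hP hZ).comp hτ).continuousAt) (by
      rintro ⟨⟨σ, w₀⟩, v, m⟩ ⟨hy1, hy2, -⟩
      simp only [τ]
      rw [hd0 σ w₀ v (mem₁.1 hy1).1 (mem₁.1 hy1).2 (by simpa using hy2) m]
      exact hc₀3)
  obtain ⟨d₃, hd₃, H₃⟩ := exists_forall_lt_of_compact hY₂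
    (f := fun y => c₀ * ‖normal (fun x => resc P Z ((τ y).1, x)) (τ y).2‖)
    (g := fun y => triple (fun x => resc P Z ((τ y).1, x)) (τ y).2)
    (fun _ _ => (continuous_const.mul ((continuous_normal_resc hP hZ).comp hτ).norm).continuousAt)
    (fun _ _ => ((continuous_triple_resc hP hZ).comp hτ).continuousAt) (by
      rintro ⟨⟨σ, w₀⟩, v, m⟩ ⟨hy1, hy2, hm⟩
      simp only [τ]
      rw [ht0 σ w₀ v (mem₁.1 hy1).1 (mem₁.1 hy1).2 (by simpa using hy2) m,
        hn0 σ w₀ v (mem₁.1 hy1).1 (mem₁.1 hy1).2 (by simpa using hy2) m]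
      have hm2 : m ^ 2 ≤ r ^ 2 := sq_le_sq' hm.1 hm.2
      have : ‖(!₂[-m, m ^ 2 / 2, 1] : E3)‖ ≤ 1 + r + r ^ 2 := by
        rw [EuclideanSpace.norm_eq]
        apply Real.sqrt_le_iff.2 ⟨by positivity, ?_⟩
        simp [Fin.sum_univ_three]
        nlinarith [sq_nonneg m, mul_self_le_mul_self (sq_nonneg m) hm2, pow_pos hr 3]
      calc _ ≤ c₀ * (1 + r + r ^ 2) := by gcongr
        _ < 1 := by linarith)
  -- transversality
  let τ₃ : ℝ × ((ℝ × E3) × (E3 × (ℝ × ℝ))) → Fin 2 → Par × (E3 × ℝ) := fun y i =>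
    ((y.1, y.2.1), y.2.2.1, ![y.2.2.2.1, y.2.2.2.2] i)
  have hτ₃ : ∀ i, Continuous fun y => τ₃ y i := by
    intro i; fin_cases i <;> simp only [τ₃] <;> fun_prop
  -- The index `k` decides whether the test direction `ζ` belongs to the first or to the second
  -- slope.
  have H₄ : ∀ k : Fin 2, ∃ d > 0, ∀ t : ℝ, |t| ≤ d → ∀ y ∈ Y₃,
      c₀ * √(vA (fun x => resc P Z ((t, y.1), x)) (y.2.1, ![y.2.2.1, y.2.2.2] k) 0 ^ 2 +
        vA (fun x => resc P Z ((t, y.1), x)) (y.2.1, ![y.2.2.1, y.2.2.2] k) 1 ^ 2) <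
      |transv (fun x => resc P Z ((t, y.1), x)) y.2.1 y.2.2.1 (![y.2.2.1, y.2.2.2] k) y.2.2.2| := by
    intro k
    have hA := fun i => (continuous_vA_resc hP hZ i).comp (hτ₃ k)
    refine exists_forall_lt_of_compact hY₃
      (f := fun y => c₀ * √(vA (fun x => resc P Z ((y.1, y.2.1), x))
        (y.2.2.1, ![y.2.2.2.1, y.2.2.2.2] k) 0 ^ 2 +
        vA (fun x => resc P Z ((y.1, y.2.1), x)) (y.2.2.1, ![y.2.2.2.1, y.2.2.2.2] k) 1 ^ 2))
      (g := fun y => |transv (fun x => resc P Z ((y.1, y.2.1), x)) y.2.2.1 y.2.2.2.1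
        (![y.2.2.2.1, y.2.2.2.2] k) y.2.2.2.2|) ?_ ?_ ?_
    · exact fun _ _ => (continuous_const.mul
        (((hA 0).pow 2).add ((hA 1).pow 2)).sqrt).continuousAt
    · rintro ⟨⟨σ, w₀⟩, v, m, m'⟩ ⟨hy1, hy2, hm⟩
      have hne := fun m : ℝ => hd0 σ w₀ v (mem₁.1 hy1).1 (mem₁.1 hy1).2 (by simpa using hy2) m
      have hne1 : ∀ m : ℝ, vA (fun x => resc P Z ((0, σ, w₀), x)) (v, m) 1 ≠ 0 := by
        intro m
        obtain ⟨a, -, -⟩ := data σ w₀ v (mem₁.1 hy1).1 (mem₁.1 hy1).2 (by simpa using hy2) m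
        rw [a]; simp
      have g0 := fun i => ContinuousAt.comp
        (x := ((0 : ℝ), (((σ, w₀), v, m, m') : (ℝ × E3) × (E3 × (ℝ × ℝ)))))
        (f := fun y => τ₃ y i)
        (continuousAt_gradQ₀_resc hP hZ (by
          change detX (fun x => resc P Z ((0, σ, w₀), x)) (v, ![m, m'] i) ≠ 0
          rw [hne]; exact one_ne_zero))
        (hτ₃ i).continuousAt
      have g1 := fun i => ContinuousAt.comp
        (x := ((0 : ℝ), (((σ, w₀), v, m, m') : (ℝ × E3) × (E3 × (ℝ × ℝ)))))
        (f := fun y => τ₃ y i)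
        (continuousAt_gradQ₁_resc hP hZ (by
          change detX (fun x => resc P Z ((0, σ, w₀), x)) (v, ![m, m'] i) ≠ 0
          rw [hne]; exact one_ne_zero) (hne1 _))
        (hτ₃ i).continuousAt
      exact (((hA 0).continuousAt.mul ((g0 0).sub (g0 1))).add
        ((hA 1).continuousAt.mul ((g1 0).sub (g1 1)))).abs
    · rintro ⟨⟨σ, w₀⟩, v, m, m'⟩ ⟨hy1, hy2, ⟨hm, hm'⟩, hmm⟩
      have hdat := data σ w₀ v (mem₁.1 hy1).1 (mem₁.1 hy1).2 (by simpa using hy2)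
      have hdet := hd0 σ w₀ v (mem₁.1 hy1).1 (mem₁.1 hy1).2 (by simpa using hy2)
      -- For the model `∂_ξ q = (m, -m²/2)`. Pairing the difference at `m, m'` with `(m, 1)` or
      -- `(m', 1)` gives `±(m - m')²/2`.
      have hg0 : ∀ m, gradQ₀ (fun x => resc P Z ((0, σ, w₀), x)) (v, m) = m := by
        intro m
        rw [gradQ₀, hdet, (hdat m).1, (hdat m).2.1]; simp
      have hg1 : ∀ m, gradQ₁ (fun x => resc P Z ((0, σ, w₀), x)) (v, m) = -m ^ 2 / 2 := by
        intro m
        rw [gradQ₁, hg0, (hdat m).1]; simp; ring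
      have hmm' : s ≤ |m - m'| := hmm
      have habs : ∀ n, n = m ∨ n = m' →
          |transv (fun x => resc P Z ((0, σ, w₀), x)) v m n m'| = (m - m') ^ 2 / 2 := by
        intro n hn
        rw [transv, hg0, hg0, hg1, hg1, (hdat n).1]
        simp only [Matrix.cons_val_zero, Matrix.cons_val_one]
        rcases hn with rfl | rfl
        · rw [show n * (n - m') + 1 * (-n ^ 2 / 2 - -m' ^ 2 / 2) = (n - m') ^ 2 / 2 by ring]
          exact abs_of_nonneg (by positivity)
        · rw [show n * (m - n) + 1 * (-m ^ 2 / 2 - -n ^ 2 / 2) = -((m - n) ^ 2 / 2) by ring,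
            abs_neg]
          exact abs_of_nonneg (by positivity)
      have hsq : s ^ 2 ≤ (m - m') ^ 2 := by
        rw [← sq_abs (m - m')]; gcongr
      have hk : ∀ n, n ∈ Icc (-r) r → c₀ * √(n ^ 2 + 1 ^ 2) < (m - m') ^ 2 / 2 := by
        intro n hn
        have : √(n ^ 2 + 1 ^ 2) ≤ 1 + r := by
          apply Real.sqrt_le_iff.2 ⟨by positivity, ?_⟩
          nlinarith [sq_le_sq' hn.1 hn.2]
        calc _ ≤ c₀ * (1 + r) := by gcongr
          _ < _ := by nlinarith [pow_pos hs 2]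
      simp only
      rw [(hdat _).1]
      fin_cases k
      · simp only [Fin.zero_eta, Matrix.cons_val_zero, Matrix.cons_val_one]
        rw [habs m (Or.inl rfl)]
        exact hk m hm
      · simp only [Fin.mk_one, Matrix.cons_val_zero, Matrix.cons_val_one]
        rw [habs m' (Or.inr rfl)]
        exact hk m' hm'
  obtain ⟨d₄, hd₄, H₄'⟩ := H₄ 0
  obtain ⟨d₅, hd₅, H₅'⟩ := H₄ 1
  obtain ⟨A, hA⟩ := exists_bound_resc hP hZ (Icc (-1) 1 ×ˢ Y₁) (isCompact_Icc.prod hY₁)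
    (r₁ / 4) r
  set d := min 1 (min d₁ (min d₂ (min d₃ (min d₄ d₅)))) with hd
  have hdle : d ≤ 1 ∧ d ≤ d₁ ∧ d ≤ d₂ ∧ d ≤ d₃ ∧ d ≤ d₄ ∧ d ≤ d₅ := by
    simp only [← le_min_iff]; exact le_of_eq hd
  refine ⟨d, by positivity, c₀, hc₀pos, A, min_le_left _ _, ?_⟩
  intro δ σ w₀ hδ hσ hw₀
  have hy1 : (σ, w₀) ∈ Y₁ := mem₁.2 ⟨hσ, hw₀⟩
  set Q : E3 × ℝ → ℝ := fun x => resc P Z ((δ, σ, w₀), x) with hQdef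
  have hQ : ContDiff ℝ ∞ Q := (contDiff_resc hP hZ).comp (contDiff_prodMk_right _)
  have hmemY : ∀ z ∈ Metric.ball (0 : E3) (r₁ / 4), ∀ m ∈ Ioo (-r) r, ((σ, w₀), (z, m)) ∈ Y₂ :=
    fun z hz m hm => ⟨hy1, Metric.ball_subset_closedBall hz, Ioo_subset_Icc_self hm⟩
  have k1 : ∀ z ∈ Metric.ball (0 : E3) (r₁ / 4), ∀ m ∈ Ioo (-r) r, 0 < vA Q (z, m) 1 :=
    fun z hz m hm => H₁ δ (hδ.trans hdle.2.1) _ (hmemY z hz m hm)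
  have k2 : ∀ z ∈ Metric.ball (0 : E3) (r₁ / 4), ∀ m ∈ Ioo (-r) r, c₀ ≤ detX Q (z, m) :=
    fun z hz m hm => (H₂ δ (hδ.trans hdle.2.2.1) _ (hmemY z hz m hm)).le
  have k3 : ∀ z ∈ Metric.ball (0 : E3) (r₁ / 4), ∀ m ∈ Ioo (-r) r,
      c₀ * ‖normal Q (z, m)‖ ≤ triple Q (z, m) :=
    fun z hz m hm => (H₃ δ (hδ.trans hdle.2.2.2.1) _ (hmemY z hz m hm)).le
  refine ⟨isControlledPhase_persp hQ hc₀pos hr (fun k z hz η hη hn => ?_) k1 k2 k3, ?_⟩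
  · exact hA (δ, σ, w₀) ⟨abs_le.1 (hδ.trans hdle.1), hy1⟩ k z hz η hη hn
  · intro v hv η hη η' hη' hsep ζ hζ
    have hζc : ζ ∈ cone r := by rcases hζ with rfl | rfl <;> assumption
    rw [inner_gradX_gradient hQ hr k1 (fun z hz m hm => hc₀pos.trans_le (k2 z hz m hm)) hv hη hη'
      hζc, abs_div, abs_of_nonneg (Real.sqrt_nonneg _)]
    have hy : ((σ, w₀), (v, (η 0 / η 1, η' 0 / η' 1))) ∈ Y₃ :=
      ⟨hy1, Metric.ball_subset_closedBall hv, ⟨Ioo_subset_Icc_self (slope_mem_Ioo hr hη),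
        Ioo_subset_Icc_self (slope_mem_Ioo hr hη')⟩, hsep⟩
    have hpos : 0 < √(vA Q (v, ζ 0 / ζ 1) 0 ^ 2 + vA Q (v, ζ 0 / ζ 1) 1 ^ 2) := by
      have := k1 v hv _ (slope_mem_Ioo hr hζc)
      positivity
    rw [le_div_iff₀ hpos]
    rcases hζ with rfl | rfl
    · exact (H₄' δ (hδ.trans hdle.2.2.2.2.1) _ hy).le
    · exact (H₅' δ (hδ.trans hdle.2.2.2.2.2) _ hy).le

end SqFn

end

noncomputable section

namespace SqFn

/-! ### Angles and slopes -/

theorem half_le_cos {s : ℝ} (h : |s| ≤ 1) : 1 / 2 ≤ Real.cos s := by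
  have h1 := Real.one_sub_sq_div_two_le_cos (x := s)
  have : s ^ 2 ≤ 1 := by rw [← sq_abs]; nlinarith [abs_nonneg s]
  linarith

/-- On `[-1, 1]` the cosine is at least `1/2`, so the derivative of the tangent lies between `1` and
`4`. -/
theorem tan_sub_tan_bounds {a b : ℝ} (ha : |a| ≤ 1) (hb : |b| ≤ 1) (hab : a ≤ b) :
    b - a ≤ Real.tan b - Real.tan a ∧ Real.tan b - Real.tan a ≤ 4 * (b - a) := by
  have hcos : ∀ x ∈ Icc (-1 : ℝ) 1, 1 / 2 ≤ Real.cos x := fun x hx => half_le_cos (abs_le.2 hx)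
  have hdiff : ∀ x ∈ Icc (-1 : ℝ) 1, HasDerivAt Real.tan (1 / Real.cos x ^ 2) x := fun x hx =>
    Real.hasDerivAt_tan (by linarith [hcos x hx])
  have hc : ContinuousOn Real.tan (Icc (-1) 1) :=
    fun x hx => (hdiff x hx).continuousAt.continuousWithinAt
  have hd : DifferentiableOn ℝ Real.tan (interior (Icc (-1) 1)) :=
    fun x hx => (hdiff x (interior_subset hx)).differentiableAt.differentiableWithinAt
  have h1 : ∀ x ∈ interior (Icc (-1 : ℝ) 1), 1 ≤ deriv Real.tan x := by
    intro x hx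
    have := hcos x (interior_subset hx)
    rw [(hdiff x (interior_subset hx)).deriv, le_div_iff₀ (by positivity)]
    nlinarith [Real.cos_le_one x]
  have h2 : ∀ x ∈ interior (Icc (-1 : ℝ) 1), deriv Real.tan x ≤ 4 := by
    intro x hx
    have := hcos x (interior_subset hx)
    rw [(hdiff x (interior_subset hx)).deriv, div_le_iff₀ (by positivity)]
    nlinarith
  have m1 := (convex_Icc (-1 : ℝ) 1).mul_sub_le_image_sub_of_le_deriv hc hd h1 a (abs_le.1 ha) b
    (abs_le.1 hb) hab
  have m2 := (convex_Icc (-1 : ℝ) 1).image_sub_le_mul_sub_of_deriv_le hc hd h2 a (abs_le.1 ha) b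
    (abs_le.1 hb) hab
  exact ⟨by linarith, m2⟩

theorem abs_tan_sub_tan_le {a b : ℝ} (ha : |a| ≤ 1) (hb : |b| ≤ 1) :
    |Real.tan b - Real.tan a| ≤ 4 * |b - a| := by
  rcases le_total a b with h | h
  · obtain ⟨h1, h2⟩ := tan_sub_tan_bounds ha hb h
    rw [abs_of_nonneg (by linarith), abs_of_nonneg (by linarith)]
    exact h2
  · obtain ⟨h1, h2⟩ := tan_sub_tan_bounds hb ha h
    rw [abs_sub_comm, abs_sub_comm b, abs_of_nonneg (by linarith), abs_of_nonneg (by linarith)]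
    exact h2

theorem arctan_sub_arctan_bounds {a b X : ℝ} (ha : |a| ≤ X) (hb : |b| ≤ X) (hab : a ≤ b) :
    (b - a) / (1 + X ^ 2) ≤ Real.arctan b - Real.arctan a ∧
      Real.arctan b - Real.arctan a ≤ b - a := by
  have hc : ContinuousOn Real.arctan (Icc (-X) X) := Real.continuous_arctan.continuousOn
  have hd : DifferentiableOn ℝ Real.arctan (interior (Icc (-X) X)) :=
    Real.differentiable_arctan.differentiableOn
  have h1 : ∀ x ∈ interior (Icc (-X) X), 1 / (1 + X ^ 2) ≤ deriv Real.arctan x := by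
    intro x hx
    have := interior_subset hx
    rw [Real.deriv_arctan]
    have : x ^ 2 ≤ X ^ 2 := sq_le_sq' this.1 this.2
    exact one_div_le_one_div_of_le (by positivity) (by linarith)
  have h2 : ∀ x ∈ interior (Icc (-X) X), deriv Real.arctan x ≤ 1 := by
    intro x hx
    rw [Real.deriv_arctan, div_le_one (by positivity)]
    nlinarith [sq_nonneg x]
  have m1 := (convex_Icc (-X) X).mul_sub_le_image_sub_of_le_deriv hc hd h1 a (abs_le.1 ha) b
    (abs_le.1 hb) hab
  have m2 := (convex_Icc (-X) X).image_sub_le_mul_sub_of_deriv_le hc hd h2 a (abs_le.1 ha) b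
    (abs_le.1 hb) hab
  exact ⟨by rw [div_mul_eq_mul_div, one_mul] at m1; exact m1, by linarith⟩

/-- The angle of the direction at angle `s` after rescaling around the slope `σ`. -/
def angMap (σ δ s : ℝ) : ℝ := Real.arctan ((Real.tan s - σ) / δ)

/-- Angles pass through the tangent, a dilation by `1/δ` and the arctangent. The last of these
contracts by at most `1 + X²` as long as the rescaled slopes stay below `X`, so `angMap` stretches
by a factor comparable to `1/δ`. -/
theorem angMap_bounds {σ δ a b X : ℝ} (hδ : 0 < δ) (ha : |a| ≤ 1) (hb : |b| ≤ 1) (hab : a ≤ b)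
    (hXa : |Real.tan a - σ| ≤ X * δ) (hXb : |Real.tan b - σ| ≤ X * δ) :
    (b - a) / (δ * (1 + X ^ 2)) ≤ angMap σ δ b - angMap σ δ a ∧
      angMap σ δ b - angMap σ δ a ≤ 4 * (b - a) / δ := by
  obtain ⟨t1, t2⟩ := tan_sub_tan_bounds ha hb hab
  have h : ∀ {x : ℝ}, |x| ≤ X * δ → |x / δ| ≤ X := by
    intro x hx
    rw [abs_div, abs_of_pos hδ, div_le_iff₀ hδ]; exact hx
  have hle : (Real.tan a - σ) / δ ≤ (Real.tan b - σ) / δ := by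
    gcongr; linarith
  obtain ⟨m1, m2⟩ := arctan_sub_arctan_bounds (h hXa) (h hXb) hle
  have e : (Real.tan b - σ) / δ - (Real.tan a - σ) / δ = (Real.tan b - Real.tan a) / δ := by ring
  rw [e] at m1 m2
  constructor
  · refine le_trans ?_ m1
    rw [div_div]
    gcongr
  · refine m2.trans ?_
    gcongr

theorem dir_apply (s : ℝ) : dir s 0 = Real.sin s ∧ dir s 1 = Real.cos s := ⟨rfl, rfl⟩

theorem slope_of_eq_smul_dir {y : E2} (hy : y ≠ 0) {s : ℝ} (hs : 0 < Real.cos s)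
    (h : y = ‖y‖ • dir s) : 0 < y 1 ∧ y 0 / y 1 = Real.tan s := by
  have hn : 0 < ‖y‖ := norm_pos_iff.2 hy
  have h0 : y 0 = ‖y‖ * Real.sin s := congrArg (fun v : E2 => v 0) h
  have h1 : y 1 = ‖y‖ * Real.cos s := congrArg (fun v : E2 => v 1) h
  refine ⟨by rw [h1]; positivity, ?_⟩
  rw [h0, h1, mul_div_mul_left _ _ hn.ne', Real.tan_eq_sin_div_cos]

theorem eq_smul_dir_arctan {y : E2} (hy : 0 < y 1) : y = ‖y‖ • dir (Real.arctan (y 0 / y 1)) := by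
  have hn : ‖y‖ = y 1 * √(1 + (y 0 / y 1) ^ 2) := by
    rw [EuclideanSpace.norm_eq, Fin.sum_univ_two]
    simp only [Real.norm_eq_abs, sq_abs]
    rw [show y 0 ^ 2 + y 1 ^ 2 = y 1 ^ 2 * (1 + (y 0 / y 1) ^ 2) by field_simp; ring,
      Real.sqrt_mul (sq_nonneg _), Real.sqrt_sq hy.le]
  have hs : 0 < √(1 + (y 0 / y 1) ^ 2) := by positivity
  ext i
  fin_cases i
  · simp only [Fin.zero_eta, PiLp.smul_apply, (dir_apply _).1, smul_eq_mul, Real.sin_arctan, hn]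
    field_simp
  · simp only [Fin.mk_one, PiLp.smul_apply, (dir_apply _).2, smul_eq_mul, Real.cos_arctan, hn]
    field_simp

theorem angle_dir {s t : ℝ} (h : |s - t| ≤ Real.pi) :
    InnerProductGeometry.angle (dir s) (dir t) = |s - t| := by
  have hn : ∀ s, ‖dir s‖ = 1 := by
    intro s
    rw [EuclideanSpace.norm_eq, Fin.sum_univ_two]
    simp [dir]
  rw [InnerProductGeometry.angle, hn, hn]
  have : inner ℝ (dir s) (dir t) = Real.cos |s - t| := by
    rw [Real.cos_abs, Real.cos_sub]
    simp [dir, PiLp.inner_apply, Fin.sum_univ_two]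
    ring
  rw [this, mul_one, div_one, Real.arccos_cos (abs_nonneg _) h]

/-- The linear map `η ↦ (σ η₂ + δ η₁, η₂)`. -/
def shear (σ δ : ℝ) (η : E2) : E2 := !₂[σ * η 1 + δ * η 0, η 1]

theorem shear_slope {σ δ : ℝ} {η : E2} (h : η 1 ≠ 0) :
    shear σ δ η 0 / shear σ δ η 1 = σ + δ * (η 0 / η 1) := by
  simp only [shear, PiLp.toLp_apply, Matrix.cons_val_zero, Matrix.cons_val_one]
  field_simp

theorem shear_smul (σ δ c : ℝ) (η : E2) : shear σ δ (c • η) = c • shear σ δ η := by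
  ext i; fin_cases i
  · simp [shear]; ring
  · simp [shear]

theorem shear_ne_zero {σ δ : ℝ} (hδ : δ ≠ 0) {η : E2} (h : η ≠ 0) : shear σ δ η ≠ 0 := by
  intro h0
  apply h
  have h1 : η 1 = 0 := by simpa [shear] using congrArg (fun v : E2 => v 1) h0
  have h2 : η 0 = 0 := by
    have := congrArg (fun v : E2 => v 0) h0
    simpa [shear, h1, hδ] using this
  ext i; fin_cases i <;> simp [h1, h2]

theorem contDiff_shear (σ δ : ℝ) : ContDiff ℝ ∞ (shear σ δ) := by
  rw [contDiff_euclidean]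
  intro i; fin_cases i
  · change ContDiff ℝ ∞ fun x : E2 => σ * x 1 + δ * x 0
    fun_prop
  · change ContDiff ℝ ∞ fun x : E2 => x 1
    fun_prop

/-! ### Derivatives of homogeneous cutoffs -/

theorem norm_iteratedFDeriv_comp_smul_le {f : E2 → ℝ} {c : ℝ} (hc : c ≠ 0) (x : E2) (k : ℕ) :
    ‖iteratedFDeriv ℝ k (fun y => f (c • y)) x‖ ≤ |c| ^ k * ‖iteratedFDeriv ℝ k f (c • x)‖ := by
  let g : E2 ≃L[ℝ] E2 := ContinuousLinearEquiv.smulLeft (Units.mk0 c hc)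
  have h := g.iteratedFDerivWithin_comp_right f (s := univ) uniqueDiffOn_univ (x := x)
    (mem_univ _) k
  simp only [preimage_univ, iteratedFDerivWithin_univ] at h
  have e : f ∘ g = fun y => f (c • y) := rfl
  have e' : g x = c • x := rfl
  rw [e, e'] at h
  rw [h]
  refine (ContinuousMultilinearMap.norm_compContinuousLinearMap_le _ _).trans ?_
  rw [Finset.prod_const, Finset.card_univ, Fintype.card_fin, mul_comm]
  gcongr
  refine ContinuousLinearMap.opNorm_le_bound _ (abs_nonneg c) fun y => ?_
  change ‖c • y‖ ≤ _
  rw [norm_smul, Real.norm_eq_abs]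

/-- Derivative bounds on the unit circle extend to the exterior of the unit disc for functions
which are homogeneous of degree zero. -/
theorem norm_iteratedFDeriv_le_of_homogeneous {f : E2 → ℝ} {k : ℕ} {B : ℝ}
    (hf : ∀ η : E2, η ≠ 0 → ∀ s : ℝ, 0 < s → f (s • η) = f η)
    (hb : ∀ η : E2, ‖η‖ = 1 → ‖iteratedFDeriv ℝ k f η‖ ≤ B) {y : E2} (hy : 1 ≤ ‖y‖) :
    ‖iteratedFDeriv ℝ k f y‖ ≤ B := by
  have hy0 : 0 < ‖y‖ := by linarith
  -- By homogeneity `f` equals its dilate near `y`; the chain rule then yields the factor `‖y‖^{-k}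
  -- ≤ 1`.
  have he : f =ᶠ[nhds y] fun w => f (‖y‖⁻¹ • w) := by
    filter_upwards [isOpen_ne.mem_nhds (norm_pos_iff.1 hy0)] with w hw
    exact (hf w hw _ (by positivity)).symm
  rw [(he.iteratedFDeriv ℝ k).eq_of_nhds]
  refine (norm_iteratedFDeriv_comp_smul_le (by positivity) y k).trans ?_
  have h1 : ‖‖y‖⁻¹ • y‖ = 1 := by
    rw [norm_smul, norm_inv, norm_norm, inv_mul_cancel₀ hy0.ne']
  have h2 : |‖y‖⁻¹| ^ k ≤ 1 := by
    rw [abs_of_pos (by positivity)]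
    exact pow_le_one₀ (by positivity) (inv_le_one_of_one_le₀ hy)
  exact (mul_le_of_le_one_left (norm_nonneg _) h2).trans (hb _ h1)

/-- The derivatives of the slope are bounded on a cone. -/
theorem exists_bound_slope (X : ℝ) : ∃ E : ℕ → ℝ, ∀ k, ∀ η : E2, ‖η‖ = 1 → |η 0| ≤ X * η 1 →
    ‖iteratedFDeriv ℝ k (fun η : E2 => (!₂[η 0 / η 1, 0] : E2)) η‖ ≤ E k := by
  have hU : IsOpen {x : ℝ × E2 | x.2 1 ≠ 0} := isOpen_ne_fun (by fun_prop) continuous_const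
  have hF : ContDiffOn ℝ ∞ (fun x : ℝ × E2 => (!₂[x.2 0 / x.2 1, 0] : E2)) {x | x.2 1 ≠ 0} := by
    rw [contDiffOn_euclidean]
    have h0 : ContDiff ℝ ∞ fun x : ℝ × E2 => x.2 0 := by fun_prop
    have h1 : ContDiff ℝ ∞ fun x : ℝ × E2 => x.2 1 := by fun_prop
    intro i; fin_cases i
    · exact h0.contDiffOn.div h1.contDiffOn fun x hx => hx
    · exact contDiffOn_const
  obtain ⟨A, hA⟩ := exists_bound_iteratedFDeriv_slice hU hF
    ((isCompact_singleton (x := (0 : ℝ))).prod (isCompact_cone_sphere X)) (by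
      rintro ⟨t, η⟩ ⟨-, hη1, hη2⟩
      simp only [mem_ofPred_eq]
      intro h0
      have h2 : η 0 = 0 := by rw [h0, mul_zero] at hη2; exact abs_nonpos_iff.1 hη2
      have : η = 0 := by ext i; fin_cases i <;> simp [h0, h2]
      rw [this, norm_zero] at hη1
      exact zero_ne_one hη1)
  exact ⟨A, fun k η h1 h2 => hA k 0 η ⟨rfl, h1, h2⟩⟩

/-- Derivative bounds for rescaled cutoffs, at points of a cone. -/
theorem norm_iteratedFDeriv_comp_shear_le {f : E2 → ℝ} (hf : ContDiffOn ℝ ∞ f {0}ᶜ)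
    (hh : ∀ η : E2, η ≠ 0 → ∀ s : ℝ, 0 < s → f (s • η) = f η) {C E : ℕ → ℝ} {X lam σ δ L : ℝ}
    (hlam : 1 ≤ lam) (hL : 1 ≤ L) (hLδ : lam ^ (1 / 2 : ℝ) * δ = L)
    (hb : ∀ k : ℕ, ∀ η : E2, ‖η‖ = 1 → ‖iteratedFDeriv ℝ k f η‖ ≤ C k * lam ^ ((k : ℝ) / 2))
    (hE : ∀ k, ∀ η : E2, ‖η‖ = 1 → |η 0| ≤ X * η 1 →
      ‖iteratedFDeriv ℝ k (fun η : E2 => (!₂[η 0 / η 1, 0] : E2)) η‖ ≤ E k)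
    {η : E2} (hη : ‖η‖ = 1) (hη1 : 0 < η 1) (hX : |η 0| ≤ X * η 1) (k : ℕ) :
    ‖iteratedFDeriv ℝ k (fun y => f (shear σ δ y)) η‖ ≤
      k.factorial * (∑ i ∈ Finset.range (k + 1), |C i|) *
        (1 + ∑ i ∈ Finset.range (k + 1), |E i|) ^ k * L ^ k := by
  set μ := lam ^ (1 / 2 : ℝ) with hμ
  have hμpos : 0 < μ := by positivity
  set S : E2 → E2 := fun η => !₂[η 0 / η 1, 0] with hS
  set s : Set E2 := {w | 0 < w 1} with hs
  have hsopen : IsOpen s := isOpen_lt continuous_const (by fun_prop)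
  have hSs : ContDiffOn ℝ ∞ S s := by
    rw [contDiffOn_euclidean]
    have h0 : ContDiff ℝ ∞ fun x : E2 => x 0 := by fun_prop
    have h1 : ContDiff ℝ ∞ fun x : E2 => x 1 := by fun_prop
    intro i; fin_cases i
    · exact h0.contDiffOn.div h1.contDiffOn fun x (hx : 0 < x 1) => hx.ne'
    · exact contDiffOn_const
  -- By homogeneity `f (shear σ δ w) = f (μ⁻¹ • F w)` with `μ = λ^{1/2}`. The dilation absorbs the
  -- powers of `λ` in the bounds for `f`, and `F` depends on `w` only through `L` times the slope,
  -- so each derivative costs `L` instead of `λ^{1/2}`.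
  let F : E2 → E2 := fun w => μ • (!₂[σ, 1] : E2) + L • S w
  let g : E2 → ℝ := fun y => f (μ⁻¹ • y)
  have ht : IsOpen ({0}ᶜ : Set E2) := isOpen_compl_singleton
  have hg : ContDiffOn ℝ ∞ g {0}ᶜ := by
    refine hf.comp (by fun_prop) fun y hy => ?_
    simpa [hμpos.ne'] using hy
  have hF : ContDiffOn ℝ ∞ F s := contDiffOn_const.add (hSs.const_smul L)
  have hF1 : ∀ w, F w 1 = μ := fun w => by simp [F, S]
  have hst : MapsTo F s {0}ᶜ := by
    intro w _ h0
    have h0' : F w = 0 := h0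
    have := hF1 w
    rw [h0'] at this
    simp at this
    exact hμpos.ne this
  have hmem : η ∈ s := hη1
  have hgF : ∀ w ∈ s, g (F w) = f (shear σ δ w) := by
    intro w hw
    have hw' : 0 < w 1 := hw
    have e : shear σ δ w = w 1 • (μ⁻¹ • F w) := by
      have hδ : δ = μ⁻¹ * L := by rw [← hLδ]; field_simp
      ext i; fin_cases i
      · simp [shear, F, S, hδ]; field_simp
      · simp [shear, F, S]; field_simp
    rw [e, hh _ ?_ _ hw']
    exact smul_ne_zero (inv_ne_zero hμpos.ne') (hst hw)
  have heq : (fun y => f (shear σ δ y)) =ᶠ[nhds η] g ∘ F := by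
    filter_upwards [hsopen.mem_nhds hmem] with w hw using (hgF w hw).symm
  rw [(heq.iteratedFDeriv ℝ k).eq_of_nhds, ← iteratedFDerivWithin_of_isOpen k hsopen hmem]
  set CC := ∑ i ∈ Finset.range (k + 1), |C i| with hCC
  set EE := 1 + ∑ i ∈ Finset.range (k + 1), |E i| with hEE
  have hEE1 : 1 ≤ EE := by
    rw [hEE]; linarith [Finset.sum_nonneg (s := Finset.range (k + 1)) fun i _ => abs_nonneg (E i)]
  have key := norm_iteratedFDerivWithin_comp_le (n := k) (C := CC) (D := L * EE) hg hF
    (by exact_mod_cast le_top) ht.uniqueDiffOn hsopen.uniqueDiffOn hst hmem ?_ ?_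
  · rw [mul_pow] at key
    calc _ ≤ _ := key
      _ = _ := by ring
  · intro i hi
    rw [iteratedFDerivWithin_of_isOpen i ht (hst hmem)]
    refine (norm_iteratedFDeriv_comp_smul_le (inv_ne_zero hμpos.ne') _ i).trans ?_
    -- The second coordinate is exactly `1`, so the point lies outside the open unit disc, where the
    -- bounds on the unit circle persist.
    have h1 : 1 ≤ ‖μ⁻¹ • F η‖ := by
      have := PiLp.norm_apply_le (μ⁻¹ • F η) 1
      rw [PiLp.smul_apply, hF1, smul_eq_mul, inv_mul_cancel₀ hμpos.ne'] at this
      simpa using this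
    have h2 := norm_iteratedFDeriv_le_of_homogeneous hh (hb i) h1
    have h3 : lam ^ ((i : ℝ) / 2) = μ ^ i := by
      rw [hμ, ← Real.rpow_natCast, ← Real.rpow_mul (by linarith)]; congr 1; ring
    rw [h3] at h2
    calc |μ⁻¹| ^ i * ‖iteratedFDeriv ℝ i f (μ⁻¹ • F η)‖ ≤ |μ⁻¹| ^ i * (C i * μ ^ i) := by gcongr
      _ = C i := by rw [abs_of_pos (by positivity), inv_pow]; field_simp
      _ ≤ |C i| := le_abs_self _
      _ ≤ CC := Finset.single_le_sum (f := fun i => |C i|) (fun i _ => abs_nonneg _)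
          (Finset.mem_range.2 (by omega))
  · intro i h1 hi
    rw [iteratedFDerivWithin_of_isOpen i hsopen hmem]
    have hSat : ContDiffAt ℝ i S η :=
      (hSs.contDiffAt (hsopen.mem_nhds hmem)).of_le (by exact_mod_cast le_top)
    have hFe : F = (fun _ => μ • (!₂[σ, 1] : E2)) + L • S := rfl
    have hSL : ContDiffAt ℝ i (L • S) η := hSat.const_smul L
    rw [hFe, iteratedFDeriv_add_apply contDiffAt_const hSL,
      iteratedFDeriv_const_of_ne (by omega), iteratedFDeriv_const_smul_apply hSat]
    simp only [Pi.zero_apply, zero_add]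
    rw [norm_smul, Real.norm_eq_abs, abs_of_pos (by linarith)]
    have h5 : ‖iteratedFDeriv ℝ i S η‖ ≤ EE := by
      refine (hE i η hη hX).trans ((le_abs_self _).trans ?_)
      have := Finset.single_le_sum (f := fun i => |E i|) (fun i _ => abs_nonneg _)
          (Finset.mem_range.2 (by omega : i < k + 1))
      linarith
    calc L * ‖iteratedFDeriv ℝ i S η‖ ≤ L * EE := by gcongr
      _ ≤ (L * EE) ^ i := le_self_pow₀ (by nlinarith) (by omega)

end SqFn

end

noncomputable section

namespace SqFn

/-! ### Rescaling a sector decomposition -/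

namespace SectorDecomposition

variable {lam M : ℝ} {C : ℕ → ℝ}

theorem ang_sub_bounds (D : SectorDecomposition lam M C) (k j : ℕ) (h : k + j < D.n + 1) :
    M⁻¹ * lam ^ (-(1 / 2) : ℝ) * j ≤ D.ang ⟨k + j, h⟩ - D.ang ⟨k, by omega⟩ ∧
      D.ang ⟨k + j, h⟩ - D.ang ⟨k, by omega⟩ ≤ M * lam ^ (-(1 / 2) : ℝ) * j := by
  induction j with
  | zero => simp
  | succ j ih =>
    obtain ⟨h1, h2⟩ := ih (by omega)
    have g1 := D.le_aperture ⟨k + j, by omega⟩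
    have g2 := D.aperture_le ⟨k + j, by omega⟩
    have e1 : Fin.succ (⟨k + j, by omega⟩ : Fin D.n) = ⟨k + (j + 1), h⟩ := rfl
    have e2 : Fin.castSucc (⟨k + j, by omega⟩ : Fin D.n) = ⟨k + j, by omega⟩ := rfl
    rw [e1, e2] at g1 g2
    push_cast
    constructor <;> linarith

theorem ang_sub_bounds' (D : SectorDecomposition lam M C) {k j : Fin (D.n + 1)} (h : k ≤ j) :
    M⁻¹ * lam ^ (-(1 / 2) : ℝ) * ((j : ℝ) - k) ≤ D.ang j - D.ang k ∧
      D.ang j - D.ang k ≤ M * lam ^ (-(1 / 2) : ℝ) * ((j : ℝ) - k) := by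
  obtain ⟨d, hd⟩ := Nat.exists_eq_add_of_le (Fin.le_def.1 h)
  have := D.ang_sub_bounds k d (by omega)
  have e : (⟨k + d, by omega⟩ : Fin (D.n + 1)) = j := Fin.ext hd.symm
  rw [e] at this
  have e2 : ((j : ℕ) : ℝ) - k = d := by rw [hd]; push_cast; ring
  rw [e2]
  exact this

theorem abs_ang_sub_le (hM : 0 < M) (hlam : 0 < lam) (D : SectorDecomposition lam M C)
    (k j : Fin (D.n + 1)) :
    |D.ang j - D.ang k| ≤ M * lam ^ (-(1 / 2) : ℝ) * |(j : ℝ) - k| := by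
  have key : ∀ {k j : Fin (D.n + 1)}, k ≤ j →
      |D.ang j - D.ang k| ≤ M * lam ^ (-(1 / 2) : ℝ) * |(j : ℝ) - k| := by
    intro k j h
    have h' : (0 : ℝ) ≤ (j : ℝ) - k := by
      have : (k : ℕ) ≤ j := h
      rw [sub_nonneg]; exact_mod_cast this
    obtain ⟨h1, h2⟩ := D.ang_sub_bounds' h
    have h3 : 0 ≤ M⁻¹ * lam ^ (-(1 / 2) : ℝ) * ((j : ℝ) - k) := by positivity
    rw [abs_of_nonneg h', abs_of_nonneg (by linarith)]
    exact h2
  rcases le_total k j with h | h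
  · exact key h
  · rw [abs_sub_comm, abs_sub_comm (j : ℝ)]
    exact key h

set_option maxHeartbeats 1000000 in
/-- The sector decomposition seen from a block of `L` sectors: a linear map turns the sectors near
the block into a decomposition at scale `L²`. -/
theorem exists_rescale (hM : 0 < M) (C : ℕ → ℝ) (R : ℕ) :
    ∃ M' > 0, ∃ C' : ℕ → ℝ, ∀ lam : ℝ, 1 ≤ lam → ∀ (D : SectorDecomposition lam M C) (i : Fin D.n)
      (L : ℕ), 1 ≤ L → |D.ang i.castSucc| ≤ 1 / 4 →
      (R + 3) * M * (L * lam ^ (-(1 / 2) : ℝ)) ≤ 1 / 4 →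
      ∃ (D' : SectorDecomposition ((L : ℝ) ^ 2) M' C') (e : Fin D'.n ↪ Fin D.n),
        (∀ ν : Fin D.n, (i : ℕ) ≤ ν + R * L → (ν : ℕ) < i + L + R * L → ∃ k, e k = ν) ∧
        (∀ k, D'.ang k.castSucc = angMap (Real.tan (D.ang i.castSucc)) (L * lam ^ (-(1 / 2) : ℝ))
            (D.ang (e k).castSucc) ∧
          D'.ang k.succ = angMap (Real.tan (D.ang i.castSucc)) (L * lam ^ (-(1 / 2) : ℝ))
            (D.ang (e k).succ)) ∧
        ∀ k η, D'.χ k η = D.χ (e k)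
          (shear (Real.tan (D.ang i.castSucc)) (L * lam ^ (-(1 / 2) : ℝ)) η) := by
  -- The retained cutoffs live within the angle `(R + 2) M δ` of the base angle, and the tangent has
  -- Lipschitz constant `4` there.
  set X : ℝ := 4 * (R + 2) * M with hX
  have hXpos : 0 < X := by positivity
  obtain ⟨E, hE⟩ := exists_bound_slope X
  refine ⟨4 * M * (1 + X ^ 2), by positivity, fun k => k.factorial *
    (∑ i ∈ Finset.range (k + 1), |C i|) * (1 + ∑ i ∈ Finset.range (k + 1), |E i|) ^ k, ?_⟩
  intro lam hlam D i L hL hi hsmall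
  set h := lam ^ (-(1 / 2) : ℝ) with hh
  have hhpos : 0 < h := by positivity
  have hL1 : (1 : ℝ) ≤ L := by exact_mod_cast hL
  have hLpos : (0 : ℝ) < L := by linarith
  set δ := (L : ℝ) * h with hδ
  have hδpos : 0 < δ := by positivity
  have hhδ : h ≤ δ := by rw [hδ]; nlinarith
  set σ := Real.tan (D.ang i.castSucc) with hσ
  have hlam2 : ((L : ℝ) ^ 2) ^ (-(1 / 2) : ℝ) = (L : ℝ)⁻¹ := by
    rw [← Real.rpow_natCast, ← Real.rpow_mul hLpos.le]
    norm_num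
    exact Real.rpow_neg_one _
  have hLδ : lam ^ (1 / 2 : ℝ) * δ = L := by
    rw [hδ, hh, Real.rpow_neg (by linarith)]
    have : (0 : ℝ) < lam ^ (1 / 2 : ℝ) := by positivity
    field_simp
  have hhL : h / δ = (L : ℝ)⁻¹ := by rw [hδ]; field_simp
  -- angles close to the base angle
  have near : ∀ s, |s - D.ang i.castSucc| ≤ (R + 2) * M * δ →
      |s| ≤ 1 ∧ |Real.tan s - σ| ≤ X * δ := by
    intro s hs
    have h1 : |s| ≤ 1 := by
      have h2 : |s| ≤ |s - D.ang i.castSucc| + |D.ang i.castSucc| := by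
        have := abs_add_le (s - D.ang i.castSucc) (D.ang i.castSucc)
        simpa using this
      have h3 : (R + 2) * M * δ ≤ (R + 3) * M * δ := by gcongr; norm_num
      linarith
    refine ⟨h1, (abs_tan_sub_tan_le (by linarith) h1).trans ?_⟩
    rw [hX]; nlinarith
  -- Only the block and `R L` sectors on either side are kept: farther away the rescaled apertures
  -- are no longer comparable to `1/L`. Truncated subtraction and the minimum with `D.n` take care
  -- of the ends of the arc.
  set lo : ℕ := i - R * L with hlo
  set hi' : ℕ := min D.n (i + L + R * L) with hhi
  have hhin : hi' ≤ D.n := min_le_left _ _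
  have hhi2 : hi' ≤ i + L + R * L := min_le_right _ _
  have hin := i.2
  have hlohi : lo ≤ hi' := by
    rw [hhi, hlo]; exact le_min (by omega) (by omega)
  have close : ∀ (j : Fin (D.n + 1)), lo ≤ (j : ℕ) → (j : ℕ) ≤ hi' →
      |D.ang j - D.ang i.castSucc| ≤ (R + 1) * M * δ := by
    intro j h1 h2
    refine (D.abs_ang_sub_le hM (by linarith) _ _).trans ?_
    have h3 : |((j : ℕ) : ℝ) - ((i.castSucc : Fin (D.n + 1)) : ℕ)| ≤ (R + 1) * L := by
      rw [Fin.val_castSucc, abs_le]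
      have a1 : (i : ℕ) ≤ j + R * L := by omega
      have a2 : (j : ℕ) ≤ i + L + R * L := by omega
      have a1' : ((i : ℕ) : ℝ) ≤ (j : ℕ) + R * L := by exact_mod_cast a1
      have a2' : ((j : ℕ) : ℝ) ≤ (i : ℕ) + L + R * L := by exact_mod_cast a2
      constructor <;> nlinarith
    calc M * h * |((j : ℕ) : ℝ) - ((i.castSucc : Fin (D.n + 1)) : ℕ)|
        ≤ M * h * ((R + 1) * L) := by gcongr
      _ = (R + 1) * M * δ := by rw [hδ]; ring
  have close' : ∀ (j : Fin (D.n + 1)), lo ≤ (j : ℕ) → (j : ℕ) ≤ hi' →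
      |D.ang j| ≤ 1 ∧ |Real.tan (D.ang j) - σ| ≤ X * δ := by
    intro j h1 h2
    refine near _ ((close j h1 h2).trans ?_)
    gcongr; norm_num
  let idx : Fin (hi' - lo) → Fin D.n := fun k => ⟨lo + k, by omega⟩
  -- the support of the new cutoffs
  have supp : ∀ (k : Fin (hi' - lo)) (η : E2), η ≠ 0 → D.χ (idx k) (shear σ δ η) ≠ 0 →
      ∃ s ∈ Icc (D.ang (idx k).castSucc - M * h) (D.ang (idx k).succ + M * h),
        |s| ≤ 1 ∧ |Real.tan s - σ| ≤ X * δ ∧ 0 < η 1 ∧ η 0 / η 1 = (Real.tan s - σ) / δ := by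
    intro k η hη hχ
    have hs0 := shear_ne_zero (σ := σ) hδpos.ne' hη
    obtain ⟨s, hs, hse⟩ := D.χ_support (idx k) _ hs0 hχ
    have c1 := close (idx k).castSucc (by simp [idx]) (by simp [idx]; omega)
    have c2 := close (idx k).succ (by simp [idx]; omega) (by simp [idx]; omega)
    have hMh : M * h ≤ M * δ := by gcongr
    obtain ⟨n1, n2⟩ := near s (by
      rw [abs_le] at c1 c2 ⊢
      have e : (R + 2) * M * δ = (R + 1) * M * δ + M * δ := by ring
      rw [e]
      constructor
      · linarith [hs.1, c1.1]
      · linarith [hs.2, c2.2])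
    obtain ⟨p1, p2⟩ := slope_of_eq_smul_dir hs0 (by linarith [half_le_cos n1]) hse
    have hη1 : 0 < η 1 := p1
    refine ⟨s, hs, n1, n2, hη1, ?_⟩
    rw [shear_slope hη1.ne'] at p2
    rw [← p2]; field_simp; ring
  let D' : SectorDecomposition ((L : ℝ) ^ 2) (4 * M * (1 + X ^ 2)) (fun k => k.factorial *
      (∑ i ∈ Finset.range (k + 1), |C i|) * (1 + ∑ i ∈ Finset.range (k + 1), |E i|) ^ k) :=
    { n := hi' - lo
      ang := fun k => angMap σ δ (D.ang ⟨lo + k, by omega⟩)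
      χ := fun k η => D.χ (idx k) (shear σ δ η)
      ang_mem := fun k => Real.arctan_mem_Ioo _
      le_aperture := by
        intro k
        have c1 := close' (idx k).castSucc (by simp [idx]) (by simp [idx]; omega)
        have c2 := close' (idx k).succ (by simp [idx]; omega) (by simp [idx]; omega)
        have ap := D.le_aperture (idx k)
        have hle : D.ang (idx k).castSucc ≤ D.ang (idx k).succ := by
          have : 0 < M⁻¹ * h := by positivity
          linarith
        have b := (angMap_bounds hδpos c1.1 c2.1 hle c1.2 c2.2).1
        refine le_trans ?_ b
        rw [hlam2, ← hhL]
        calc (4 * M * (1 + X ^ 2))⁻¹ * (h / δ) ≤ (M * (1 + X ^ 2))⁻¹ * (h / δ) := by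
              gcongr; linarith
          _ = (M⁻¹ * h) / (δ * (1 + X ^ 2)) := by field_simp
          _ ≤ _ := by gcongr
      aperture_le := by
        intro k
        have c1 := close' (idx k).castSucc (by simp [idx]) (by simp [idx]; omega)
        have c2 := close' (idx k).succ (by simp [idx]; omega) (by simp [idx]; omega)
        have ap := D.le_aperture (idx k)
        have ap2 := D.aperture_le (idx k)
        have hle : D.ang (idx k).castSucc ≤ D.ang (idx k).succ := by
          have : 0 < M⁻¹ * h := by positivity
          linarith
        have b := (angMap_bounds hδpos c1.1 c2.1 hle c1.2 c2.2).2
        refine b.trans ?_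
        rw [hlam2, ← hhL]
        calc _ ≤ 4 * (M * h) / δ := by gcongr
          _ = (4 * M * 1) * (h / δ) := by ring
          _ ≤ _ := by gcongr; nlinarith [sq_nonneg X]
      χ_smooth := fun k => (D.χ_smooth (idx k)).comp (contDiff_shear σ δ).contDiffOn
        fun η hη => shear_ne_zero hδpos.ne' hη
      χ_homogeneous := by
        intro k η hη s hs
        rw [shear_smul]
        exact D.χ_homogeneous _ _ (shear_ne_zero hδpos.ne' hη) s hs
      χ_bound := by
        intro k j η hη
        have hη0 : η ≠ 0 := by rw [← norm_pos_iff, hη]; exact one_pos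
        have e : ((L : ℝ) ^ 2) ^ ((j : ℝ) / 2) = (L : ℝ) ^ j := by
          rw [← Real.rpow_natCast, ← Real.rpow_mul hLpos.le, ← Real.rpow_natCast]
          congr 1; push_cast; ring
        rw [e]
        -- Inside this cone the slope has bounded derivatives and the chain rule applies; outside it
        -- the rescaled cutoff vanishes near `η`.
        by_cases hc : |η 0| ≤ X * η 1
        · have hη1 : 0 < η 1 := by
            rcases (nonneg_of_mul_nonneg_right ((abs_nonneg _).trans hc) hXpos).lt_or_eq with h0 | h0
            · exact h0
            · exfalso
              rw [← h0, mul_zero] at hc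
              apply hη0
              ext i; fin_cases i
              · simpa using abs_nonpos_iff.1 hc
              · simpa using h0.symm
          exact norm_iteratedFDeriv_comp_shear_le (D.χ_smooth _) (D.χ_homogeneous _) hlam hL1 hLδ
            (D.χ_bound (idx k)) hE hη hη1 hc j
        · have hz : (fun y => D.χ (idx k) (shear σ δ y)) =ᶠ[nhds η] fun _ => 0 := by
            have o1 : IsOpen {w : E2 | X * w 1 < |w 0|} := isOpen_lt (by fun_prop) (by fun_prop)
            filter_upwards [o1.mem_nhds (not_le.1 hc), isOpen_ne.mem_nhds hη0] with w hw hw0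
            by_contra hne
            obtain ⟨s, -, -, s3, s4, s5⟩ := supp k w hw0 hne
            have : |w 0 / w 1| ≤ X := by
              rw [s5, abs_div, abs_of_pos hδpos, div_le_iff₀ hδpos]; exact s3
            rw [abs_div, abs_of_pos s4, div_le_iff₀ s4] at this
            exact absurd hw (not_lt.2 this)
          rw [(hz.iteratedFDeriv ℝ j).eq_of_nhds]
          have : iteratedFDeriv ℝ j (fun _ : E2 => (0 : ℝ)) η = 0 := by
            simp
          rw [this, norm_zero]
          positivity
      χ_support := by
        intro k η hη hχ
        obtain ⟨s, hs, s1, s2, s3, s4⟩ := supp k η hη hχ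
        have c1 := close' (idx k).castSucc (by simp [idx]) (by simp [idx]; omega)
        have c2 := close' (idx k).succ (by simp [idx]; omega) (by simp [idx]; omega)
        -- The enlargement `M h` of a sector is stretched by at most `4/δ`, and `h/δ = 1/L` is the
        -- unit of aperture at scale `L²`.
        have hext : 4 * (M * h) / δ ≤ 4 * M * (1 + X ^ 2) * ((L : ℝ) ^ 2) ^ (-(1 / 2) : ℝ) := by
          rw [hlam2, ← hhL]
          calc 4 * (M * h) / δ = (4 * M * 1) * (h / δ) := by ring
            _ ≤ _ := by gcongr; nlinarith [sq_nonneg X]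
        refine ⟨Real.arctan (η 0 / η 1), ?_, eq_smul_dir_arctan s3⟩
        rw [s4]
        change angMap σ δ s ∈ _
        constructor
        · change angMap σ δ (D.ang (idx k).castSucc) - _ ≤ _
          rcases le_total s (D.ang (idx k).castSucc) with hle | hle
          · have b := (angMap_bounds hδpos s1 c1.1 hle s2 c1.2).2
            have : 4 * (D.ang (idx k).castSucc - s) / δ ≤ 4 * (M * h) / δ := by
              gcongr; linarith [hs.1]
            linarith
          · have b := (angMap_bounds hδpos c1.1 s1 hle c1.2 s2).1
            have : 0 ≤ (s - D.ang (idx k).castSucc) / (δ * (1 + X ^ 2)) :=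
              div_nonneg (by linarith) (by positivity)
            have : 0 ≤ 4 * (M * h) / δ := by positivity
            linarith
        · change _ ≤ angMap σ δ (D.ang (idx k).succ) + _
          rcases le_total s (D.ang (idx k).succ) with hle | hle
          · have b := (angMap_bounds hδpos s1 c2.1 hle s2 c2.2).1
            have : 0 ≤ (D.ang (idx k).succ - s) / (δ * (1 + X ^ 2)) :=
              div_nonneg (by linarith) (by positivity)
            have : 0 ≤ 4 * (M * h) / δ := by positivity
            linarith
          · have b := (angMap_bounds hδpos c2.1 s1 hle c2.2 s2).2
            have : 4 * (s - D.ang (idx k).succ) / δ ≤ 4 * (M * h) / δ := by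
              gcongr; linarith [hs.2]
            linarith }
  refine ⟨D', ⟨idx, fun a b hab => ?_⟩, ?_, fun k => ⟨rfl, rfl⟩, fun k η => rfl⟩
  · have := congrArg Fin.val hab
    simp only [idx] at this
    exact Fin.ext (by omega)
  · intro ν h1 h2
    have hν := ν.2
    have hlt : (ν : ℕ) < hi' := lt_min hν h2
    have hge : lo ≤ (ν : ℕ) := by omega
    exact ⟨⟨ν - lo, by change (ν : ℕ) - lo < hi' - lo; omega⟩, Fin.ext (by
      change lo + ((ν : ℕ) - lo) = ν; omega)⟩

end SectorDecomposition

end SqFn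

end

noncomputable section

namespace SqFn

/-! ### The normalised setting -/

/-- A phase `φ` with slope form `P` near `(0, e₂)`, together with normal coordinates `Z`. -/
structure IsNormalized (φ : E3 → E2 → ℝ) (P : E3 × ℝ → ℝ) (Z : ℝ × E3 → E3)
    (r₁ σ₁ κ : ℝ) (w₁ : E3) : Prop where
  pos : 0 < σ₁
  le_one : σ₁ ≤ 1
  le_r : σ₁ ≤ r₁
  κ_pos : 0 < κ
  smoothP : ContDiff ℝ ∞ P
  smoothZ : ContDiff ℝ ∞ Z
  eq : ∀ z : E3, ‖z‖ < σ₁ → ∀ η : E2, 0 < η 1 → |η 0 / η 1| < σ₁ → φ z η = persp P z η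
  left : ∀ σ z, |σ| ≤ σ₁ → ‖z‖ < σ₁ → Z (σ, coords P (σ, z)) = z
  right : ∀ σ w, |σ| ≤ r₁ → ‖w - w₁‖ < r₁ → coords P (σ, Z (σ, w)) = w
  near : ∀ σ z, |σ| ≤ σ₁ → ‖z‖ < σ₁ → ‖coords P (σ, z) - w₁‖ < r₁ / 4
  det : ∀ σ z, |σ| ≤ σ₁ → ‖z‖ < σ₁ →
    κ⁻¹ ≤ |(coordsDeriv P (σ, z)).det| ∧ |(coordsDeriv P (σ, z)).det| ≤ κ

theorem IsPhase.exists_isNormalized {r : ℝ} (hr : 0 < r) {φ : E3 → E2 → ℝ} (hφ : IsPhase r r φ) :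
    ∃ P Z r₁ σ₁ κ w₁, IsNormalized φ P Z r₁ σ₁ κ w₁ := by
  obtain ⟨P, r₀, hr₀, hS, hT⟩ := hφ.exists_slopeForm hr
  obtain ⟨Z, hZ, r₁, hr₁, κ, hκ, hl, hrr, hdet⟩ := exists_normal_coordinates hS.smooth hT
  have hc : ∀ᶠ x in nhds ((0 : ℝ), (0 : E3)), ‖coords P x - coords P (0, 0)‖ < r₁ / 4 := by
    have : Continuous fun x => ‖coords P x - coords P (0, 0)‖ :=
      ((contDiff_coords hS.smooth).continuous.sub continuous_const).norm
    exact this.continuousAt.eventually_lt continuousAt_const (by simp; positivity)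
  obtain ⟨ε, hε, hball⟩ := Metric.eventually_nhds_iff.1 hc
  set σ₁ := min 1 (min r₀ (min r₁ (ε / 2))) with hσ₁
  have hle : σ₁ ≤ 1 ∧ σ₁ ≤ r₀ ∧ σ₁ ≤ r₁ ∧ σ₁ ≤ ε / 2 := by
    simp only [← le_min_iff]; exact le_of_eq hσ₁
  refine ⟨P, Z, r₁, σ₁, κ, coords P (0, 0), ?_⟩
  exact
    { pos := by positivity
      le_one := hle.1
      le_r := hle.2.2.1
      κ_pos := hκ
      smoothP := hS.smooth
      smoothZ := hZ
      eq := fun z hz η h1 h2 => hS.eq z (by simpa using hz.trans_le hle.2.1) η (by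
        rw [abs_div, abs_of_pos h1, div_lt_iff₀ h1] at h2
        exact h2.trans_le (by gcongr; exact hle.2.1))
      left := fun σ z h1 h2 => hl σ z (h1.trans hle.2.2.1) (h2.le.trans hle.2.2.1)
      right := hrr
      near := fun σ z h1 h2 => hball (by
        simp only [Prod.dist_eq, dist_zero_right, Real.norm_eq_abs, max_lt_iff]
        constructor <;> linarith [hle.2.2.2])
      det := fun σ z h1 h2 => hdet σ z (h1.trans hle.2.2.1) (h2.le.trans hle.2.2.1) }

/-- A smooth amplitude supported near `(0, e₂)`. -/
structure IsLocalAmplitude (ε₀ : ℝ) (a : E3 → E2 → ℂ) : Prop where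
  smooth : ContDiff ℝ ∞ (fun p : E3 × E2 => a p.1 p.2)
  support : ∀ z η, a z η ≠ 0 → ‖z‖ < ε₀ ∧ ‖η - e₂‖ < ε₀

theorem IsLocalAmplitude.freq {ε₀ : ℝ} {a : E3 → E2 → ℂ} (ha : IsLocalAmplitude ε₀ a)
    (h : ε₀ ≤ 1 / 2) {z : E3} {η : E2} (hne : a z η ≠ 0) :
    1 / 2 < η 1 ∧ η 1 < 3 / 2 ∧ |η 0 / η 1| < 2 * ε₀ := by
  have h2 := (ha.support z η hne).2
  have c0 := (PiLp.norm_apply_le (η - e₂) 0).trans_lt h2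
  have c1 := (PiLp.norm_apply_le (η - e₂) 1).trans_lt h2
  simp only [e₂, PiLp.sub_apply, Matrix.cons_val_zero, Matrix.cons_val_one,
    sub_zero, Real.norm_eq_abs] at c0 c1
  rw [abs_lt] at c1
  have hpos : 1 / 2 < η 1 := by linarith
  refine ⟨hpos, by linarith, ?_⟩
  rw [abs_div, abs_of_pos (by linarith : 0 < η 1), div_lt_iff₀ (by linarith)]
  have : 0 ≤ |η 0| := abs_nonneg _
  nlinarith

/-! ### Linear change of the frequency variable -/

/-- `shear` as a linear map. -/
def shearLin (σ δ : ℝ) : E2 →ₗ[ℝ] E2 where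
  toFun := shear σ δ
  map_add' x y := by
    ext i; fin_cases i
    · simp [shear]; ring
    · simp [shear]
  map_smul' c x := shear_smul σ δ c x

theorem det_shearLin (σ δ : ℝ) : LinearMap.det (shearLin σ δ) = δ := by
  rw [← LinearMap.det_toMatrix (EuclideanSpace.basisFun (Fin 2) ℝ).toBasis, Matrix.det_fin_two]
  simp [LinearMap.toMatrix_apply, shearLin, shear]

theorem measurableEmbedding_shear {σ δ : ℝ} (hδ : δ ≠ 0) : MeasurableEmbedding (shear σ δ) := by
  have hdet : LinearMap.det (shearLin σ δ) ≠ 0 := by rwa [det_shearLin]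
  exact ((shearLin σ δ).equivOfDetNeZero hdet).toContinuousLinearEquiv.toHomeomorph.measurableEmbedding

theorem map_shear {σ δ : ℝ} (hδ : 0 < δ) :
    Measure.map (shear σ δ) (volume : Measure E2) = ENNReal.ofReal δ⁻¹ • volume := by
  have hdet : LinearMap.det (shearLin σ δ) ≠ 0 := by rw [det_shearLin]; exact hδ.ne'
  have := Measure.map_linearMap_addHaar_eq_smul_addHaar (volume : Measure E2) hdet
  rw [det_shearLin, abs_of_pos (by positivity)] at this
  exact this

theorem integral_comp_shear {σ δ : ℝ} (hδ : 0 < δ) (g : E2 → ℂ) :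
    ∫ η, (δ : ℂ) * g (shear σ δ η) = ∫ η, g η := by
  rw [integral_const_mul, ← (measurableEmbedding_shear hδ.ne').integral_map, map_shear hδ,
    integral_smul_measure, ENNReal.toReal_ofReal (by positivity), Complex.real_smul]
  push_cast
  have : (δ : ℂ) ≠ 0 := by exact_mod_cast hδ.ne'
  field_simp

theorem lintegral_comp_shear {σ δ : ℝ} (hδ : 0 < δ) (g : E2 → ENNReal) :
    ∫⁻ η, g (shear σ δ η) = ENNReal.ofReal δ⁻¹ * ∫⁻ η, g η := by
  rw [← (measurableEmbedding_shear hδ.ne').lintegral_map, map_shear hδ, lintegral_smul_measure,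
    smul_eq_mul]

theorem eLpNorm_rpow_eq {α : Type*} [MeasurableSpace α] {F : Type*} [NormedAddCommGroup F]
    (μ : Measure α) (f : α → F) :
    eLpNorm f (10 / 3) μ ^ (10 / 3 : ℝ) = ∫⁻ x, ‖f x‖ₑ ^ (10 / 3 : ℝ) ∂μ := by
  rw [eLpNorm_eq_lintegral_rpow_enorm_toReal (by simp) (ENNReal.div_ne_top (by simp) (by simp))]
  have : (10 / 3 : ENNReal).toReal = 10 / 3 := by simp
  rw [this, ← ENNReal.rpow_mul]
  norm_num

theorem eLpNorm_rpow_eq' {α : Type*} [MeasurableSpace α] {F : Type*} [NormedAddCommGroup F]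
    (μ : Measure α) (f : α → F) :
    eLpNorm f (5 / 3) μ ^ (5 / 3 : ℝ) = ∫⁻ x, ‖f x‖ₑ ^ (5 / 3 : ℝ) ∂μ := by
  rw [eLpNorm_eq_lintegral_rpow_enorm_toReal (by simp) (ENNReal.div_ne_top (by simp) (by simp))]
  have : (5 / 3 : ENNReal).toReal = 5 / 3 := by simp
  rw [this, ← ENNReal.rpow_mul]
  norm_num

/-- The function `f` seen in rescaled frequency variables. -/
def rescaleFun (lam δ σ : ℝ) (w₀ : E3) (f : E2 → ℂ) (η : E2) : ℂ :=
  (δ : ℂ) * (Complex.exp (Complex.I * ((lam * (w₀ 1 * η 1 + δ * w₀ 0 * η 0) : ℝ) : ℂ)) *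
    f (shear σ δ η))

/-- The factor `δ` contributes `δ^{10/3}` and the change of variables `δ⁻¹`; their product is at
most one. -/
theorem eLpNorm_rescaleFun_le (lam : ℝ) {δ : ℝ} (σ : ℝ) (hδ : 0 < δ) (hδ1 : δ ≤ 1) (w₀ : E3)
    (f : E2 → ℂ) :
    eLpNorm (rescaleFun lam δ σ w₀ f) (10 / 3) volume ≤ eLpNorm f (10 / 3) volume := by
  rw [← ENNReal.rpow_le_rpow_iff (z := 10 / 3) (by norm_num), eLpNorm_rpow_eq, eLpNorm_rpow_eq]
  have h1 : ∀ η, ‖rescaleFun lam δ σ w₀ f η‖ₑ = ENNReal.ofReal δ * ‖f (shear σ δ η)‖ₑ := by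
    intro η
    rw [rescaleFun, enorm_mul, enorm_mul]
    have e1 : ‖Complex.exp (Complex.I * ((lam * (w₀ 1 * η 1 + δ * w₀ 0 * η 0) : ℝ) : ℂ))‖ₑ = 1 := by
      rw [← ofReal_norm, mul_comm, Complex.norm_exp_ofReal_mul_I, ENNReal.ofReal_one]
    have e2 : ‖(δ : ℂ)‖ₑ = ENNReal.ofReal δ := by
      rw [← ofReal_norm, Complex.norm_real, Real.norm_eq_abs, abs_of_pos hδ]
    rw [e1, e2, one_mul]
  simp only [h1]
  simp only [ENNReal.mul_rpow_of_nonneg _ _ (by norm_num : (0 : ℝ) ≤ 10 / 3)]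
  rw [lintegral_const_mul' _ _ (by
    exact ENNReal.rpow_ne_top_of_nonneg (by norm_num) ENNReal.ofReal_ne_top),
    lintegral_comp_shear hδ (fun y => ‖f y‖ₑ ^ (10 / 3 : ℝ)), ← mul_assoc]
  refine mul_le_of_le_one_left' ?_
  rw [ENNReal.ofReal_rpow_of_nonneg hδ.le (by norm_num), ← ENNReal.ofReal_mul (by positivity),
    ENNReal.ofReal_le_one]
  calc δ ^ (10 / 3 : ℝ) * δ⁻¹ ≤ δ ^ (1 : ℝ) * δ⁻¹ := by
        gcongr ?_ * _
        exact Real.rpow_le_rpow_of_exponent_ge hδ hδ1 (by norm_num)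
    _ = 1 := by rw [Real.rpow_one]; field_simp

theorem memLp_rescaleFun (lam : ℝ) {δ : ℝ} (σ : ℝ) (hδ : 0 < δ) (hδ1 : δ ≤ 1) (w₀ : E3)
    {f : E2 → ℂ} (hf : MemLp f (10 / 3) volume) :
    MemLp (rescaleFun lam δ σ w₀ f) (10 / 3) volume := by
  refine ⟨?_, (eLpNorm_rescaleFun_le lam σ hδ hδ1 w₀ f).trans_lt hf.2⟩
  have hq : Measure.QuasiMeasurePreserving (shear σ δ) (volume : Measure E2) volume := by
    refine ⟨(measurableEmbedding_shear hδ.ne').measurable, ?_⟩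
    rw [map_shear hδ]
    exact Measure.smul_absolutelyContinuous
  have h1 := hf.1.comp_quasiMeasurePreserving hq
  have h2 : Continuous fun η : E2 =>
      Complex.exp (Complex.I * ((lam * (w₀ 1 * η 1 + δ * w₀ 0 * η 0) : ℝ) : ℂ)) := by
    fun_prop
  exact (h2.aestronglyMeasurable.mul h1).const_mul (δ : ℂ)

/-! ### Supports of the cutoffs -/

namespace SectorDecomposition

variable {lam M : ℝ} {C : ℕ → ℝ}

/-- The block of `L` sectors starting at `i`. -/
def block (D : SectorDecomposition lam M C) (i L : ℕ) : Finset (Fin D.n) :=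
  Finset.univ.filter fun ν => i ≤ (ν : ℕ) ∧ (ν : ℕ) < i + L

theorem mem_block (D : SectorDecomposition lam M C) {i L : ℕ} {ν : Fin D.n} :
    ν ∈ D.block i L ↔ i ≤ (ν : ℕ) ∧ (ν : ℕ) < i + L := by simp [block]

theorem abs_ang_sub_le_of_mem_block (hM : 0 < M) (hlam : 1 ≤ lam) (D : SectorDecomposition lam M C)
    {i ν : Fin D.n} {L : ℕ} (hν : ν ∈ D.block i L) :
    |D.ang ν.castSucc - D.ang i.castSucc| ≤ M * (L * lam ^ (-(1 / 2) : ℝ)) ∧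
      |D.ang ν.succ - D.ang i.castSucc| ≤ M * (L * lam ^ (-(1 / 2) : ℝ)) := by
  obtain ⟨h1, h2⟩ := D.mem_block.1 hν
  have h1' : ((i : ℕ) : ℝ) ≤ (ν : ℕ) := by exact_mod_cast h1
  have h2' : ((ν : ℕ) : ℝ) + 1 ≤ (i : ℕ) + L := by exact_mod_cast h2
  have hh : 0 < lam ^ (-(1 / 2) : ℝ) := by positivity
  constructor
  · refine (D.abs_ang_sub_le hM (by linarith) _ _).trans ?_
    rw [Fin.val_castSucc, Fin.val_castSucc, abs_of_nonneg (by linarith), mul_assoc]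
    gcongr M * ?_
    rw [mul_comm]; gcongr; linarith
  · refine (D.abs_ang_sub_le hM (by linarith) _ _).trans ?_
    rw [Fin.val_castSucc, Fin.val_succ]
    push_cast
    rw [abs_of_nonneg (by linarith), mul_assoc]
    gcongr M * ?_
    rw [mul_comm]; gcongr; linarith

/-- The sectors of the block stay within `M δ` of the base angle, where `δ = L λ^{-1/2}`. The
enlargement of the cutoff adds at most `M δ` because `L ≥ 1`, and the tangent multiplies by at most
`4`. -/
theorem support_of_mem_block (hM : 0 < M) (hlam : 1 ≤ lam) (D : SectorDecomposition lam M C)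
    {i ν : Fin D.n} {L : ℕ} (hL : 1 ≤ L) (hν : ν ∈ D.block i L) (hi : |D.ang i.castSucc| ≤ 1 / 4)
    (hδ : 2 * M * (L * lam ^ (-(1 / 2) : ℝ)) ≤ 1 / 4) {y : E2} (hy : y ≠ 0) (hχ : D.χ ν y ≠ 0) :
    ∃ s ∈ Icc (D.ang ν.castSucc - M * lam ^ (-(1 / 2) : ℝ))
        (D.ang ν.succ + M * lam ^ (-(1 / 2) : ℝ)),
      |s| ≤ 1 ∧ 0 < y 1 ∧ y 0 / y 1 = Real.tan s ∧
      |s - D.ang i.castSucc| ≤ 2 * M * (L * lam ^ (-(1 / 2) : ℝ)) ∧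
      |Real.tan s - Real.tan (D.ang i.castSucc)| ≤ 8 * M * (L * lam ^ (-(1 / 2) : ℝ)) := by
  obtain ⟨s, hs, hse⟩ := D.χ_support ν y hy hχ
  obtain ⟨c1, c2⟩ := D.abs_ang_sub_le_of_mem_block hM hlam hν
  have hh : 0 < lam ^ (-(1 / 2) : ℝ) := by positivity
  have hL1 : (1 : ℝ) ≤ L := by exact_mod_cast hL
  have hMh : M * lam ^ (-(1 / 2) : ℝ) ≤ M * (L * lam ^ (-(1 / 2) : ℝ)) := by
    gcongr; nlinarith
  have hsi : |s - D.ang i.castSucc| ≤ 2 * M * (L * lam ^ (-(1 / 2) : ℝ)) := by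
    rw [abs_le] at c1 c2 ⊢
    constructor
    · linarith [hs.1, c1.1]
    · linarith [hs.2, c2.2]
  have hs1 : |s| ≤ 1 := by
    have := abs_add_le (s - D.ang i.castSucc) (D.ang i.castSucc)
    rw [sub_add_cancel] at this
    linarith
  obtain ⟨p1, p2⟩ := slope_of_eq_smul_dir hy (by linarith [half_le_cos hs1]) hse
  refine ⟨s, hs, hs1, p1, p2, hsi, ?_⟩
  refine (abs_tan_sub_tan_le (by linarith) hs1).trans ?_
  linarith

theorem abs_arctan_sub_arctan_le (x y : ℝ) : |Real.arctan x - Real.arctan y| ≤ |x - y| := by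
  have key : ∀ {a b : ℝ}, a ≤ b → |Real.arctan b - Real.arctan a| ≤ |b - a| := by
    intro a b h
    obtain ⟨h1, h2⟩ := arctan_sub_arctan_bounds (X := max |a| |b|) (le_max_left _ _)
      (le_max_right _ _) h
    have h3 : 0 ≤ Real.arctan b - Real.arctan a := sub_nonneg.2 (Real.arctan_mono h)
    rw [abs_of_nonneg h3, abs_of_nonneg (by linarith)]
    exact h2
  rcases le_total x y with h | h
  · rw [abs_sub_comm, abs_sub_comm x]; exact key h
  · exact key h

/-- The angle supplied by `χ_support` may a priori lie beyond `±π/2`, since the sectors are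
enlarged. Positivity of `y 1` brings it back to the principal branch. -/
theorem arctan_mem_of_support (D : SectorDecomposition lam M C) {ν : Fin D.n}
    (hM : M * lam ^ (-(1 / 2) : ℝ) ≤ 1) {y : E2} (hy : 0 < y 1) (hχ : D.χ ν y ≠ 0) :
    Real.arctan (y 0 / y 1) ∈ Icc (D.ang ν.castSucc - M * lam ^ (-(1 / 2) : ℝ))
      (D.ang ν.succ + M * lam ^ (-(1 / 2) : ℝ)) := by
  have hy0 : y ≠ 0 := fun h => by rw [h] at hy; simp at hy
  obtain ⟨s, hsI, hse⟩ := D.χ_support ν y hy0 hχ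
  have hpi := Real.pi_gt_three
  have hcos : 0 < Real.cos s := by
    have h1 : y 1 = ‖y‖ * Real.cos s := congrArg (fun v : E2 => v 1) hse
    rw [h1] at hy
    exact pos_of_mul_pos_right hy (norm_nonneg _)
  have a1 := D.ang_mem ν.castSucc
  have a2 := D.ang_mem ν.succ
  have hs1 : s < Real.pi / 2 := by
    by_contra hc
    push Not at hc
    have := Real.cos_nonpos_of_pi_div_two_le_of_le hc (by linarith [hsI.2, a2.2])
    linarith
  have hs2 : -(Real.pi / 2) < s := by
    by_contra hc
    push Not at hc
    have := Real.cos_nonpos_of_pi_div_two_le_of_le (x := -s) (by linarith)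
      (by linarith [hsI.1, a1.1])
    rw [Real.cos_neg] at this
    linarith
  rwa [(slope_of_eq_smul_dir hy0 hcos hse).2, Real.arctan_tan hs2 hs1]

/-- More than `R L` sectors amount to an angle of at least `R δ / M`, whereas the direction lies
within `T δ` of the base angle and a cutoff reaches at most `M δ` beyond its sector. The condition
`M (M + T) < R` makes these incompatible. -/
theorem χ_eq_zero_of_far (hM : 0 < M) (hlam : 1 ≤ lam) (D : SectorDecomposition lam M C)
    {i ν : Fin D.n} {L R : ℕ} (hL : 1 ≤ L) {T : ℝ} (hR : M * (M + T) < R)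
    (hδ : M * (L * lam ^ (-(1 / 2) : ℝ)) ≤ 1)
    (hν : ¬ ((i : ℕ) ≤ ν + R * L ∧ (ν : ℕ) < i + L + R * L)) {y : E2} (hy : 0 < y 1)
    (hs : |y 0 / y 1 - Real.tan (D.ang i.castSucc)| ≤ T * (L * lam ^ (-(1 / 2) : ℝ))) :
    D.χ ν y = 0 := by
  by_contra hχ
  set h := lam ^ (-(1 / 2) : ℝ) with hh
  have hhpos : 0 < h := by positivity
  have hL1 : (1 : ℝ) ≤ L := by exact_mod_cast hL
  set δ := (L : ℝ) * h with hδdef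
  have hhδ : h ≤ δ := by rw [hδdef]; nlinarith
  have hδpos : 0 < δ := by positivity
  have hMh : M * h ≤ M * δ := by gcongr
  have hsI := D.arctan_mem_of_support (hMh.trans hδ) hy hχ
  have hsi : |Real.arctan (y 0 / y 1) - D.ang i.castSucc| ≤ T * δ := by
    have a3 := D.ang_mem i.castSucc
    have := abs_arctan_sub_arctan_le (y 0 / y 1) (Real.tan (D.ang i.castSucc))
    rw [Real.arctan_tan a3.1 a3.2] at this
    exact this.trans hs
  rw [abs_le] at hsi
  have hkey : (M + T) * δ < M⁻¹ * (R * δ) := by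
    rw [lt_inv_mul_iff₀ hM]
    nlinarith
  rw [not_and_or, not_le, not_lt] at hν
  rcases hν with hν | hν
  · have hle : ν.succ ≤ i.castSucc := by
      rw [Fin.le_def, Fin.val_succ, Fin.val_castSucc]; omega
    have b := (D.ang_sub_bounds' hle).1
    rw [Fin.val_castSucc, Fin.val_succ] at b
    push_cast at b
    have hν' : ((ν : ℕ) : ℝ) + R * L + 1 ≤ (i : ℕ) := by exact_mod_cast hν
    have b2 : M⁻¹ * h * (R * L) ≤ M⁻¹ * h * (((i : ℕ) : ℝ) - ((ν : ℕ) + 1)) := by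
      gcongr; linarith
    have e : M⁻¹ * h * (R * L) = M⁻¹ * (R * δ) := by rw [hδdef]; ring
    rw [e] at b2
    linarith [hsI.2]
  · have hle : i.castSucc ≤ ν.castSucc := by
      rw [Fin.le_def, Fin.val_castSucc, Fin.val_castSucc]
      have : 0 ≤ R * L := Nat.zero_le _
      omega
    have b := (D.ang_sub_bounds' hle).1
    rw [Fin.val_castSucc, Fin.val_castSucc] at b
    have hν' : ((i : ℕ) : ℝ) + L + R * L ≤ (ν : ℕ) := by exact_mod_cast hν
    have b2 : M⁻¹ * h * (R * L) ≤ M⁻¹ * h * (((ν : ℕ) : ℝ) - (i : ℕ)) := by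
      gcongr; linarith
    have e : M⁻¹ * h * (R * L) = M⁻¹ * (R * δ) := by rw [hδdef]; ring
    rw [e] at b2
    linarith [hsI.1]

end SectorDecomposition

end SqFn

end

noncomputable section

namespace SqFn

/-! ### Partial sums and square sums -/

namespace SectorDecomposition

variable {lam M : ℝ} {C : ℕ → ℝ}

/-- The sum of the operators `T^ν` over `ν ∈ Ω`. -/
def part (D : SectorDecomposition lam M C) (φ : E3 → E2 → ℝ) (a : E3 → E2 → ℂ)
    (Ω : Finset (Fin D.n)) (f : E2 → ℂ) (z : E3) : ℂ := ∑ ν ∈ Ω, osc φ (D.amp a ν) lam f z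

/-- The sum of the squares `|T^ν f|²` over `ν ∈ Ω`. -/
def sqSum (D : SectorDecomposition lam M C) (φ : E3 → E2 → ℝ) (a : E3 → E2 → ℂ)
    (Ω : Finset (Fin D.n)) (f : E2 → ℂ) (z : E3) : ENNReal :=
  ∑ ν ∈ Ω, ‖osc φ (D.amp a ν) lam f z‖ₑ ^ 2

theorem sqSum_mono (D : SectorDecomposition lam M C) (φ : E3 → E2 → ℝ) (a : E3 → E2 → ℂ)
    {Ω Ω' : Finset (Fin D.n)} (h : Ω ⊆ Ω') (f : E2 → ℂ) (z : E3) :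
    D.sqSum φ a Ω f z ≤ D.sqSum φ a Ω' f z :=
  Finset.sum_le_sum_of_subset h

theorem enorm_square_rpow (D : SectorDecomposition lam M C) (φ : E3 → E2 → ℝ) (a : E3 → E2 → ℂ)
    (Ω : Finset (Fin D.n)) (f : E2 → ℂ) (z : E3) :
    ‖D.square φ a Ω f z‖ₑ ^ (10 / 3 : ℝ) = D.sqSum φ a Ω f z ^ (5 / 3 : ℝ) := by
  have h0 : 0 ≤ ∑ ν ∈ Ω, ‖osc φ (D.amp a ν) lam f z‖ ^ 2 :=
    Finset.sum_nonneg fun _ _ => by positivity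
  have h1 : ‖D.square φ a Ω f z‖ₑ ^ 2 = D.sqSum φ a Ω f z := by
    rw [← ofReal_norm, ← ENNReal.ofReal_pow (norm_nonneg _), Real.norm_eq_abs, sq_abs, square,
      Real.sq_sqrt h0, ENNReal.ofReal_sum_of_nonneg fun _ _ => by positivity, sqSum]
    refine Finset.sum_congr rfl fun ν _ => ?_
    rw [ENNReal.ofReal_pow (norm_nonneg _), ofReal_norm]
  rw [← h1, ← ENNReal.rpow_natCast, ← ENNReal.rpow_mul]
  norm_num

end SectorDecomposition

/-! ### Rescaled operators -/

/-- Substitute `shear` for the frequency. The part of the phase independent of `v` and the Jacobian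
`δ` form `rescaleFun`; the rest is `λ δ²` times the rescaled phase. -/
theorem osc_resc {φ : E3 → E2 → ℝ} {P : E3 × ℝ → ℝ} {Z : ℝ × E3 → E3} {r₁ σ₁ κ : ℝ} {w₁ : E3}
    (hn : IsNormalized φ P Z r₁ σ₁ κ w₁) {c : E3 → E2 → ℂ}
    (hc : ∀ z η, c z η ≠ 0 → ‖z‖ < σ₁ ∧ 0 < η 1 ∧ |η 0 / η 1| < σ₁) {π : Par}
    (hσ : |π.2.1| ≤ r₁) (hδ : 0 < π.1) (lam : ℝ) {v : E3} (hv : ‖π.2.2 + aniso π.1 v - w₁‖ < r₁)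
    (f : E2 → ℂ) :
    osc (persp fun x => resc P Z (π, x)) (fun v η => c (place Z π v) (shear π.2.1 π.1 η))
      (lam * π.1 ^ 2) (rescaleFun lam π.1 π.2.1 π.2.2 f) v = osc φ c lam f (place Z π v) := by
  obtain ⟨δ, σ, w₀⟩ := π
  simp only at hσ hδ hv ⊢
  have hcoord : coords P (σ, place Z (δ, σ, w₀) v) = w₀ + aniso δ v := hn.right σ _ hσ hv
  unfold osc
  rw [← integral_comp_shear (σ := σ) hδ fun y =>
    Complex.exp (Complex.I * ((lam * φ (place Z (δ, σ, w₀) v) y : ℝ) : ℂ)) *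
      c (place Z (δ, σ, w₀) v) y * f y]
  congr 1; ext η
  by_cases h0 : c (place Z (δ, σ, w₀) v) (shear σ δ η) = 0
  · simp [h0]
  obtain ⟨hz, h1, hs⟩ := hc _ _ h0
  have h1' : 0 < η 1 := h1
  have hφ : lam * φ (place Z (δ, σ, w₀) v) (shear σ δ η) =
      lam * δ ^ 2 * persp (fun x => resc P Z ((δ, σ, w₀), x)) v η +
        lam * (w₀ 1 * η 1 + δ * w₀ 0 * η 0) := by
    have e1 : shear σ δ η 1 = η 1 := rfl
    rw [hn.eq _ hz _ h1 hs, persp, persp, shear_slope h1'.ne',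
      slopeForm_eq_resc (π := (δ, σ, w₀)) hn.smoothP hcoord, e1]
    field_simp
    ring
  rw [hφ, rescaleFun, Complex.ofReal_add, mul_add Complex.I, Complex.exp_add]
  ring

/-- The localised rescaled amplitude. -/
def rescAmp (Z : ℝ × E3 → E3) (b : E3 → ℝ) (β : ℝ → ℝ) (a : E3 → E2 → ℂ) (π : Par) :
    E3 → E2 → ℂ :=
  fun v η => ((b v * β (η 0) : ℝ) : ℂ) * a (place Z π v) (shear π.2.1 π.1 η)

theorem exists_bound_iteratedFDeriv_of_support {𝒜 : Par × (E3 × E2) → ℂ} (h : ContDiff ℝ ∞ 𝒜)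
    {K : Set Par} (hK : IsCompact K) {ρ r : ℝ}
    (hs : ∀ π v η, 𝒜 (π, v, η) ≠ 0 → ‖v‖ ≤ ρ ∧ ‖η‖ ≤ r) :
    ∃ B : ℕ → ℝ, ∀ k, ∀ π ∈ K, ∀ x, ‖iteratedFDeriv ℝ k (fun y => 𝒜 (π, y)) x‖ ≤ B k := by
  set S : Set (E3 × E2) := Metric.closedBall 0 ρ ×ˢ Metric.closedBall 0 r with hS
  have hSc : IsCompact S := (isCompact_closedBall _ _).prod (isCompact_closedBall _ _)
  obtain ⟨A, hA⟩ := exists_bound_iteratedFDeriv_slice isOpen_univ h.contDiffOn (hK.prod hSc)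
    (subset_univ _)
  refine ⟨fun k => |A k|, fun k π hπ x => ?_⟩
  by_cases hx : x ∈ S
  · exact (hA k π x ⟨hπ, hx⟩).trans (le_abs_self _)
  · have hev : (fun y => 𝒜 (π, y)) =ᶠ[nhds x] fun _ => 0 := by
      filter_upwards [hSc.isClosed.isOpen_compl.mem_nhds hx] with y hy
      by_contra hne
      obtain ⟨c1, c2⟩ := hs π y.1 y.2 hne
      exact hy ⟨by simpa using c1, by simpa using c2⟩
    rw [(hev.iteratedFDeriv ℝ k).eq_of_nhds]
    have : iteratedFDeriv ℝ k (fun _ : E3 × E2 => (0 : ℂ)) x = 0 := by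
      simp [iteratedFDeriv_fun_zero]
    rw [this, norm_zero]
    exact abs_nonneg _

/-- The amplitudes are jointly smooth in the parameters and the variables, with supports in a fixed
bounded set, so compactness bounds all derivatives. The radius `64 M + 2` comes from `|η 0| ≤ 32 M`
and `1/2 < η 1 < 3/2`. -/
theorem exists_controlled_rescAmp {Z : ℝ × E3 → E3} (hZ : ContDiff ℝ ∞ Z) {ε₀ : ℝ}
    {a : E3 → E2 → ℂ} (ha : IsLocalAmplitude ε₀ a) (hε₀ : ε₀ ≤ 1 / 2) {b : E3 → ℝ} {β : ℝ → ℝ}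
    (hb : ContDiff ℝ ∞ b) (hβ : ContDiff ℝ ∞ β) {ρ M : ℝ} (hM : 0 < M)
    (hbs : ∀ v, b v ≠ 0 → ‖v‖ ≤ ρ) (hβs : ∀ x, β x ≠ 0 → |x| ≤ 32 * M) {K : Set Par}
    (hK : IsCompact K) :
    ∃ B : ℕ → ℝ, ∀ π ∈ K, IsControlledAmplitude ρ (64 * M + 2) B (rescAmp Z b β a π) := by
  have hsup : ∀ (π : Par) (v : E3) (η : E2), rescAmp Z b β a π v η ≠ 0 →
      ‖v‖ ≤ ρ ∧ |η 0| ≤ (64 * M + 2) * η 1 ∧ (64 * M + 2)⁻¹ ≤ ‖η‖ ∧ ‖η‖ ≤ 64 * M + 2 := by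
    intro π v η hne
    unfold rescAmp at hne
    have h1 := left_ne_zero_of_mul hne
    have h2 := right_ne_zero_of_mul hne
    have h1' : b v * β (η 0) ≠ 0 := fun h => h1 (by rw [h]; simp)
    have h3 := hbs v (left_ne_zero_of_mul h1')
    have h4 := hβs _ (right_ne_zero_of_mul h1')
    obtain ⟨f1, f2, -⟩ := ha.freq hε₀ h2
    replace f1 : 1 / 2 < η 1 := f1
    replace f2 : η 1 < 3 / 2 := f2
    refine ⟨h3, by nlinarith, ?_, ?_⟩
    · have : ‖η 1‖ ≤ ‖η‖ := PiLp.norm_apply_le η 1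
      rw [Real.norm_eq_abs, abs_of_pos (by linarith)] at this
      have h5 : (64 * M + 2)⁻¹ ≤ 2⁻¹ := by
        apply inv_anti₀ <;> linarith
      linarith
    · rw [EuclideanSpace.norm_eq, Real.sqrt_le_left (by positivity), Fin.sum_univ_two,
        Real.norm_eq_abs, Real.norm_eq_abs, abs_of_pos (by linarith : 0 < η 1)]
      have := abs_nonneg (η 0)
      nlinarith
  have hshear : ContDiff ℝ ∞ fun x : Par × (E3 × E2) => shear x.1.2.1 x.1.1 x.2.2 := by
    rw [contDiff_euclidean]
    have h0 : ContDiff ℝ ∞ fun x : Par × (E3 × E2) => x.2.2 0 := by fun_prop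
    have h1 : ContDiff ℝ ∞ fun x : Par × (E3 × E2) => x.2.2 1 := by fun_prop
    intro i; fin_cases i
    · change ContDiff ℝ ∞ fun x : Par × (E3 × E2) => x.1.2.1 * x.2.2 1 + x.1.1 * x.2.2 0
      fun_prop
    · exact h1
  have hjoint : ContDiff ℝ ∞ fun x : Par × (E3 × E2) => rescAmp Z b β a x.1 x.2.1 x.2.2 := by
    unfold rescAmp
    refine ContDiff.mul ?_ ?_
    · refine Complex.ofRealCLM.contDiff.comp (ContDiff.mul (hb.comp (by fun_prop)) (hβ.comp ?_))
      fun_prop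
    · refine ha.smooth.comp (ContDiff.prodMk ?_ hshear)
      exact (contDiff_place hZ).comp (g := fun x : Par × E3 => place Z x.1 x.2)
        (f := fun p : Par × (E3 × E2) => (p.1, p.2.1)) (by fun_prop)
  obtain ⟨B, hB⟩ := exists_bound_iteratedFDeriv_of_support hjoint hK (ρ := ρ) (r := 64 * M + 2)
    (fun π v η h => ⟨(hsup π v η h).1, (hsup π v η h).2.2.2⟩)
  refine ⟨B, fun π hπ => ⟨?_, hsup π, fun k p => hB k π hπ p⟩⟩
  exact hjoint.comp (g := fun x : Par × (E3 × E2) => rescAmp Z b β a x.1 x.2.1 x.2.2)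
    (f := fun p : E3 × E2 => (π, p)) (by fun_prop)

/-- Both square functions are bounded by the same integral `I`, so their product contributes
`I^{1/2} I^{1/2} = I`. The factor `2^{2/3}` comes from convexity of the power `5/3`. -/
theorem rpow_bilinear {E x y S₁ S₂ G I J : ENNReal} (h : E ≤ x * S₁ * S₂ + y * G * G)
    (h₁ : S₁ ^ (10 / 3 : ℝ) ≤ I) (h₂ : S₂ ^ (10 / 3 : ℝ) ≤ I) (hG : G ^ (10 / 3 : ℝ) ≤ J) :
    E ^ (5 / 3 : ℝ) ≤ 2 ^ (2 / 3 : ℝ) * (x ^ (5 / 3 : ℝ) * I + y ^ (5 / 3 : ℝ) * J) := by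
  have key : ∀ {S I : ENNReal}, S ^ (10 / 3 : ℝ) ≤ I → S ^ (5 / 3 : ℝ) ≤ I ^ (1 / 2 : ℝ) := by
    intro S I hS
    have : S ^ (5 / 3 : ℝ) = (S ^ (10 / 3 : ℝ)) ^ (1 / 2 : ℝ) := by
      rw [← ENNReal.rpow_mul]; norm_num
    rw [this]
    exact ENNReal.rpow_le_rpow hS (by norm_num)
  have hsq : ∀ I : ENNReal, I ^ (1 / 2 : ℝ) * I ^ (1 / 2 : ℝ) = I := by
    intro I
    rw [← ENNReal.rpow_add_of_nonneg _ _ (by norm_num) (by norm_num)]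
    norm_num
  have h53 : (0 : ℝ) ≤ 5 / 3 := by norm_num
  calc E ^ (5 / 3 : ℝ) ≤ (x * S₁ * S₂ + y * G * G) ^ (5 / 3 : ℝ) := ENNReal.rpow_le_rpow h h53
    _ ≤ 2 ^ ((5 / 3 : ℝ) - 1) * ((x * S₁ * S₂) ^ (5 / 3 : ℝ) + (y * G * G) ^ (5 / 3 : ℝ)) :=
        ENNReal.rpow_add_le_mul_rpow_add_rpow _ _ (by norm_num)
    _ ≤ 2 ^ (2 / 3 : ℝ) * (x ^ (5 / 3 : ℝ) * I + y ^ (5 / 3 : ℝ) * J) := by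
        norm_num only
        simp only [ENNReal.mul_rpow_of_nonneg _ _ h53, mul_assoc]
        gcongr
        · calc _ ≤ I ^ (1 / 2 : ℝ) * I ^ (1 / 2 : ℝ) := by gcongr <;> exact key ‹_›
            _ = I := hsq I
        · calc _ ≤ J ^ (1 / 2 : ℝ) * J ^ (1 / 2 : ℝ) := by gcongr <;> exact key hG
            _ = J := hsq J

end SqFn

end

noncomputable section

namespace SqFn

namespace SectorDecomposition

variable {lam M : ℝ} {C : ℕ → ℝ}

/-! ### Separation and transversality after rescaling -/

/-- The hypothesis is an index gap of at least `L / K`, written without division; each intermediate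
sector has aperture at least `λ^{-1/2}/M`. -/
theorem le_ang_sub_of_le (hM : 0 < M) (hlam : 1 ≤ lam) (D : SectorDecomposition lam M C)
    {ν ν' : Fin D.n} {K L : ℕ} (hK : 1 ≤ K) (h : ((ν : ℕ) + 1) * K + L ≤ ν' * K) :
    (L * lam ^ (-(1 / 2) : ℝ)) / (M * K) ≤ D.ang ν'.castSucc - D.ang ν.succ := by
  have hle : ν.succ ≤ ν'.castSucc := by
    rw [Fin.le_def, Fin.val_succ, Fin.val_castSucc]
    by_contra hc
    push Not at hc
    have : (ν' : ℕ) * K ≤ ν * K := Nat.mul_le_mul_right _ (by omega)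
    nlinarith
  have b := (D.ang_sub_bounds' hle).1
  rw [Fin.val_castSucc, Fin.val_succ] at b
  push_cast at b
  have h' : (((ν : ℕ) : ℝ) + 1) * K + L ≤ (ν' : ℕ) * K := by exact_mod_cast h
  have hK' : (0 : ℝ) < K := by exact_mod_cast hK
  have hh : 0 < lam ^ (-(1 / 2) : ℝ) := by positivity
  refine le_trans ?_ b
  rw [div_le_iff₀ (by positivity)]
  have : M⁻¹ * lam ^ (-(1 / 2) : ℝ) * (((ν' : ℕ) : ℝ) - ((ν : ℕ) + 1)) * (M * K) =
      lam ^ (-(1 / 2) : ℝ) * ((ν' : ℕ) * K - ((ν : ℕ) + 1) * K) := by field_simp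
  rw [this, mul_comm (L : ℝ)]
  gcongr
  linarith

/-- The gap `δ/(M K)` between the parts is stretched at least by `1/(δ (1 + (4M)²))`, because the
whole block lies within slope distance `4 M δ` of `σ`. The factor `δ` cancels. -/
theorem separated_of_rescale (hM : 0 < M) (hlam : 1 ≤ lam) (D : SectorDecomposition lam M C)
    {i : Fin D.n} {K L : ℕ} (hK : 1 ≤ K) (hL : 1 ≤ L) (hi : |D.ang i.castSucc| ≤ 1 / 4)
    (hδ : M * (L * lam ^ (-(1 / 2) : ℝ)) ≤ 1 / 4)
    {Ω Ω' : Finset (Fin D.n)} (hΩ : Ω ⊆ D.block i L) (hΩ' : Ω' ⊆ D.block i L)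
    (hsep : ∀ ν ∈ Ω, ∀ ν' ∈ Ω', ((ν : ℕ) + 1) * K + L ≤ ν' * K)
    {lam' M' : ℝ} {C' : ℕ → ℝ} (D' : SectorDecomposition lam' M' C') (e : Fin D'.n → Fin D.n)
    (he : ∀ k, D'.ang k.castSucc = angMap (Real.tan (D.ang i.castSucc))
        (L * lam ^ (-(1 / 2) : ℝ)) (D.ang (e k).castSucc) ∧
      D'.ang k.succ = angMap (Real.tan (D.ang i.castSucc))
        (L * lam ^ (-(1 / 2) : ℝ)) (D.ang (e k).succ))
    {Ω₁ Ω₁' : Finset (Fin D'.n)} (h1 : ∀ k ∈ Ω₁, e k ∈ Ω) (h1' : ∀ k ∈ Ω₁', e k ∈ Ω')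
    {c : ℝ} (hc : c ≤ 1 / (M * K * (1 + (4 * M) ^ 2))) :
    D'.Separated c Ω₁ Ω₁' := by
  set δ := (L : ℝ) * lam ^ (-(1 / 2) : ℝ) with hδdef
  have hL0 : (0 : ℝ) < L := by exact_mod_cast hL
  have hK0 : (0 : ℝ) < K := by exact_mod_cast hK
  have hδ0 : 0 < δ := by positivity
  rintro k hk k' hk' _ ⟨s, hs, rfl⟩ _ ⟨s', hs', rfl⟩
  have hgap := D.le_ang_sub_of_le hM hlam hK (hsep _ (h1 k hk) _ (h1' k' hk'))
  have b1 := (D.abs_ang_sub_le_of_mem_block hM hlam (hΩ (h1 k hk))).2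
  have b2 := (D.abs_ang_sub_le_of_mem_block hM hlam (hΩ' (h1' k' hk'))).1
  rw [← hδdef] at hgap b1 b2
  have small : ∀ {t}, |t - D.ang i.castSucc| ≤ M * δ → |t| ≤ 1 := by
    intro t ht
    have := abs_add_le (t - D.ang i.castSucc) (D.ang i.castSucc)
    rw [sub_add_cancel] at this
    linarith
  have hX : ∀ {t}, |t - D.ang i.castSucc| ≤ M * δ →
      |Real.tan t - Real.tan (D.ang i.castSucc)| ≤ 4 * M * δ := by
    intro t ht
    refine (abs_tan_sub_tan_le (by linarith) (small ht)).trans ?_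
    linarith
  have hpos : 0 < δ / (M * K) := by positivity
  have hb := (angMap_bounds hδ0 (small b1) (small b2) (by linarith) (hX b1) (hX b2)).1
  have hkey : c ≤ D'.ang k'.castSucc - D'.ang k.succ := by
    rw [(he k').1, (he k).2]
    refine hc.trans (le_trans ?_ hb)
    calc 1 / (M * K * (1 + (4 * M) ^ 2)) = δ / (M * K) / (δ * (1 + (4 * M) ^ 2)) := by
          field_simp
      _ ≤ _ := by gcongr
  have hb0 : D'.ang k.succ ≤ D'.ang k'.castSucc := by
    rw [(he k').1, (he k).2]
    have : 0 ≤ (D.ang (e k').castSucc - D.ang (e k).succ) / (δ * (1 + (4 * M) ^ 2)) := by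
      apply div_nonneg <;> [linarith; positivity]
    linarith
  have m1 := (D'.ang_mem k.castSucc).1
  have m2 := (D'.ang_mem k'.succ).2
  have hss : s ≤ s' := hs.2.trans (hb0.trans hs'.1)
  have habs : |s - s'| = s' - s := by rw [abs_sub_comm, abs_of_nonneg (by linarith)]
  rw [angle_dir (by rw [habs]; linarith [hs.1, hs'.2]), habs]
  linarith [hs.2, hs'.1]

/-- Cutoffs reach beyond their sectors by `M λ^{-1/2}`. The condition `4 M² K ≤ L` makes the two
enlargements together at most half of the gap `δ/(M K)`; the other half survives rescaling. -/
theorem slope_separated (hM : 0 < M) (hlam : 1 ≤ lam) (D : SectorDecomposition lam M C)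
    {i ν ν' : Fin D.n} {K L : ℕ} (hK : 1 ≤ K) (hL : 1 ≤ L) (hKL : 4 * M ^ 2 * K ≤ L)
    (hi : |D.ang i.castSucc| ≤ 1 / 4) (hδ : 2 * M * (L * lam ^ (-(1 / 2) : ℝ)) ≤ 1 / 4)
    (hν : ν ∈ D.block i L) (hν' : ν' ∈ D.block i L) (hsep : ((ν : ℕ) + 1) * K + L ≤ ν' * K)
    {η η' : E2} (h1 : 0 < η 1) (h1' : 0 < η' 1)
    (hχ : D.χ ν (shear (Real.tan (D.ang i.castSucc)) (L * lam ^ (-(1 / 2) : ℝ)) η) ≠ 0)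
    (hχ' : D.χ ν' (shear (Real.tan (D.ang i.castSucc)) (L * lam ^ (-(1 / 2) : ℝ)) η') ≠ 0) :
    1 / (2 * K * M) ≤ |η 0 / η 1 - η' 0 / η' 1| := by
  set δ := (L : ℝ) * lam ^ (-(1 / 2) : ℝ) with hδdef
  have hL0 : (0 : ℝ) < L := by exact_mod_cast hL
  have hK0 : (0 : ℝ) < K := by exact_mod_cast hK
  have hδ0 : 0 < δ := by positivity
  have hne : ∀ {y : E2}, 0 < y 1 → y ≠ 0 := fun h h0 => by rw [h0] at h; simp at h
  obtain ⟨s, hs, hs1, -, hst, -, -⟩ := D.support_of_mem_block hM hlam hL hν hi hδ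
    (shear_ne_zero hδ0.ne' (hne h1)) hχ
  obtain ⟨s', hs', hs1', -, hst', -, -⟩ := D.support_of_mem_block hM hlam hL hν' hi hδ
    (shear_ne_zero hδ0.ne' (hne h1')) hχ'
  rw [shear_slope h1.ne'] at hst
  rw [shear_slope h1'.ne'] at hst'
  have hgap := D.le_ang_sub_of_le hM hlam hK hsep
  have hh : 0 < lam ^ (-(1 / 2) : ℝ) := by positivity
  have hMh : 2 * M * lam ^ (-(1 / 2) : ℝ) ≤ δ / (2 * (M * K)) := by
    rw [le_div_iff₀ (by positivity), hδdef]
    nlinarith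
  have hdiff : δ / (2 * (M * K)) ≤ s' - s := by
    have : δ / (M * K) = δ / (2 * (M * K)) + δ / (2 * (M * K)) := by field_simp; norm_num
    rw [← hδdef, this] at hgap
    linarith [hs.2, hs'.1]
  have hpos : 0 < δ / (2 * (M * K)) := by positivity
  have htan := (tan_sub_tan_bounds hs1 hs1' (by linarith)).1
  have e1 : δ * (η' 0 / η' 1 - η 0 / η 1) = Real.tan s' - Real.tan s := by
    rw [← hst, ← hst']; ring
  rw [abs_sub_comm]
  refine le_trans ?_ (le_abs_self _)
  rw [← mul_le_mul_iff_right₀ hδ0, e1]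
  calc δ * (1 / (2 * K * M)) = δ / (2 * (M * K)) := by field_simp
    _ ≤ _ := by linarith

/-- On the support of `β` the rescaled slope is at most `64 M`, so the cutoffs discarded in the
rescaling vanish there and the remaining ones still sum to one. -/
theorem isPartition_rescAmp (hM : 0 < M) (hlam : 1 ≤ lam) (D : SectorDecomposition lam M C)
    {a : E3 → E2 → ℂ} (hD : D.IsPartition a) {ε₀ : ℝ} (ha : IsLocalAmplitude ε₀ a)
    (hε₀ : ε₀ ≤ 1 / 2) {i : Fin D.n} {L R : ℕ} (hL : 1 ≤ L) (hR : M * (M + 64 * M) < R)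
    (hδ : M * (L * lam ^ (-(1 / 2) : ℝ)) ≤ 1) {Z : ℝ × E3 → E3} {b : E3 → ℝ} {β : ℝ → ℝ}
    (hβs : ∀ x, β x ≠ 0 → |x| ≤ 32 * M) {w₀ : E3}
    {lam' M' : ℝ} {C' : ℕ → ℝ} (D' : SectorDecomposition lam' M' C') (e : Fin D'.n ↪ Fin D.n)
    (he : ∀ ν : Fin D.n, (i : ℕ) ≤ ν + R * L → (ν : ℕ) < i + L + R * L → ∃ k, e k = ν)
    (heχ : ∀ k η, D'.χ k η =
      D.χ (e k) (shear (Real.tan (D.ang i.castSucc)) (L * lam ^ (-(1 / 2) : ℝ)) η)) :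
    D'.IsPartition (rescAmp Z b β a
      (L * lam ^ (-(1 / 2) : ℝ), Real.tan (D.ang i.castSucc), w₀)) := by
  intro v η hne
  set δ := (L : ℝ) * lam ^ (-(1 / 2) : ℝ) with hδdef
  have hL0 : (0 : ℝ) < L := by exact_mod_cast hL
  have hδ0 : 0 < δ := by positivity
  unfold rescAmp at hne
  have h1 := left_ne_zero_of_mul hne
  have h2 := right_ne_zero_of_mul hne
  have hβ0 : β (η 0) ≠ 0 := fun h => h1 (by rw [h]; simp)
  have h4 := hβs _ hβ0
  obtain ⟨f1, -, -⟩ := ha.freq hε₀ h2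
  replace f1 : 1 / 2 < η 1 := f1
  have hη1 : 0 < η 1 := by linarith
  rw [← hD _ _ h2]
  simp only [heχ]
  have hfar : ∀ ν, ν ∉ Finset.univ.map e →
      D.χ ν (shear (Real.tan (D.ang i.castSucc)) δ η) = 0 := by
    intro ν hν
    refine D.χ_eq_zero_of_far hM hlam (i := i) (R := R) (T := 64 * M) hL hR hδ (fun hc => hν ?_) hη1 ?_
    · obtain ⟨k, hk⟩ := he ν hc.1 hc.2
      simp only [Finset.mem_map, Finset.mem_univ, true_and]
      exact ⟨k, hk⟩
    · rw [shear_slope hη1.ne', add_sub_cancel_left, abs_mul, abs_of_pos hδ0, mul_comm]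
      gcongr
      rw [abs_div, abs_of_pos hη1, div_le_iff₀ hη1]
      nlinarith
  rw [← Finset.sum_subset (Finset.subset_univ (Finset.univ.map e)) fun ν _ hν => hfar ν hν,
    Finset.sum_map]

end SectorDecomposition

end SqFn

end

noncomputable section

namespace SqFn

/-! ### The bilinear estimate near a point, in rescaled coordinates -/

-- The bilinear hypothesis is applied at scale `L²` to the rescaled phase and the localised rescaled
-- amplitude. The constants given to it depend on neither `λ`, `L`, the block nor the centre `w₀`.
set_option maxHeartbeats 1000000 in
theorem exists_bilinear_rescaled (hbil : BilinearSquareFunctionEstimate)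
    {φ : E3 → E2 → ℝ} {P : E3 × ℝ → ℝ} {Z : ℝ × E3 → E3} {r₁ σ₁ κ : ℝ} {w₁ : E3}
    (hn : IsNormalized φ P Z r₁ σ₁ κ w₁) {ε₀ : ℝ} {a : E3 → E2 → ℂ} (ha : IsLocalAmplitude ε₀ a)
    (hε₀ : ε₀ ≤ 1 / 2) (hε₀σ : 2 * ε₀ ≤ σ₁) {M : ℝ} (hM : 0 < M) (C : ℕ → ℝ) {K : ℕ} (hK : 1 ≤ K)
    {ε : ℝ} (hε : 0 < ε) (N : ℕ) :
    ∃ d : ℝ, 0 < d ∧ d ≤ 1 ∧ 2 * M * d ≤ 1 / 4 ∧ ∃ B : ℝ, 0 ≤ B ∧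
      ∀ lam : ℝ, 1 ≤ lam → ∀ D : SectorDecomposition lam M C, D.IsPartition a →
      ∀ (i : Fin D.n) (L : ℕ), 1 ≤ L → 4 * M ^ 2 * K ≤ L → L * lam ^ (-(1 / 2) : ℝ) ≤ d →
      |D.ang i.castSucc| ≤ 1 / 4 → |Real.tan (D.ang i.castSucc)| ≤ r₁ →
      ∀ Ω Ω' : Finset (Fin D.n), Ω ⊆ D.block i L → Ω' ⊆ D.block i L →
      (∀ ν ∈ Ω, ∀ ν' ∈ Ω', ((ν : ℕ) + 1) * K + L ≤ ν' * K) →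
      ∀ w₀ : E3, ‖w₀ - w₁‖ ≤ r₁ / 2 → ∀ f : E2 → ℂ, MemLp f (10 / 3) volume →
      ∀ p : E3 → E3, p = place Z (L * lam ^ (-(1 / 2) : ℝ), Real.tan (D.ang i.castSucc), w₀) →
      ∫⁻ v in Metric.ball 0 (r₁ / 16),
          (‖D.part φ a Ω f (p v)‖ₑ * ‖D.part φ a Ω' f (p v)‖ₑ) ^ (5 / 3 : ℝ) ≤
        ENNReal.ofReal (B * ((L : ℝ) ^ 2) ^ ((1 / 10 + ε) * (5 / 3) : ℝ)) *
          (∫⁻ v in Metric.closedBall 0 (r₁ / 8), D.sqSum φ a (D.block i L) f (p v) ^ (5 / 3 : ℝ)) +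
        ENNReal.ofReal (B * ((L : ℝ) ^ 2) ^ (-(N : ℝ))) * ∫⁻ η, ‖f η‖ₑ ^ (10 / 3 : ℝ) := by
  have hr₁ : 0 < r₁ := hn.pos.trans_le hn.le_r
  have hK0 : (0 : ℝ) < K := by exact_mod_cast hK
  -- Here `64 M` bounds the rescaled slopes on the support of the amplitude, given `|η 0| ≤ 32 M`
  -- and `η 1 > 1/2`.
  obtain ⟨R, hR⟩ := exists_nat_gt (M * (M + 64 * M))
  -- The hypothesis asks for a phase on twice the cone of the amplitude. The values of `s` and `c`
  -- are those produced by `slope_separated` and `separated_of_rescale`.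
  obtain ⟨d₁, hd₁, c₀, hc₀, A, hcc, hphase⟩ := exists_controlled_resc hn.smoothP hn.smoothZ hr₁
    hn.right (r := 2 * (64 * M + 2)) (by positivity) (s := 1 / (2 * K * M)) (by positivity)
    (c := 1 / (M * K * (1 + (4 * M) ^ 2))) (by positivity)
  let b : ContDiffBump (0 : E3) := ⟨r₁ / 16, r₁ / 8, by positivity, by linarith⟩
  -- The shear stretches the support of `a` by `1/δ` in the first frequency variable. `β` cuts it
  -- down to bounded size without affecting the sectors of the block, where `|η 0| ≤ 12 M`.
  let β : ContDiffBump (0 : ℝ) := ⟨16 * M, 32 * M, by positivity, by linarith⟩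
  have hbs : ∀ v, b v ≠ 0 → ‖v‖ ≤ r₁ / 8 := by
    intro v hv
    have : v ∈ Function.support b := hv
    rw [b.support_eq] at this
    simpa using (Metric.mem_ball.1 this).le
  have hβs : ∀ x, β x ≠ 0 → |x| ≤ 32 * M := by
    intro x hx
    have : x ∈ Function.support β := hx
    rw [β.support_eq] at this
    simpa using (Metric.mem_ball.1 this).le
  have hβ1 : ∀ x, |x| ≤ 16 * M → β x = 1 := by
    intro x hx
    exact β.one_of_mem_closedBall (by simpa using hx)
  set Kp : Set Par := Icc 0 1 ×ˢ (Icc (-r₁) r₁ ×ˢ Metric.closedBall w₁ (r₁ / 2)) with hKp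
  have hKpc : IsCompact Kp := isCompact_Icc.prod (isCompact_Icc.prod (isCompact_closedBall _ _))
  obtain ⟨Bd, hBd⟩ := exists_controlled_rescAmp hn.smoothZ ha hε₀ b.contDiff β.contDiff hM hbs hβs
    hKpc
  obtain ⟨M', hM', C', hresc⟩ := SectorDecomposition.exists_rescale hM C R
  obtain ⟨K₀, hK₀⟩ := hbil c₀ (r₁ / 8) (64 * M + 2) M' A Bd C' hc₀ (by positivity) (by positivity)
    hM' ε hε N
  set d := min (min 1 d₁) (1 / (4 * ((R + 3) * M))) with hd
  have hd0 : 0 < d := by positivity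
  have hdle : d ≤ 1 ∧ d ≤ d₁ ∧ d ≤ 1 / (4 * ((R + 3) * M)) := by
    rw [← and_assoc, ← le_min_iff, ← le_min_iff]
  have hRd : (R + 3) * M * d ≤ 1 / 4 := by
    calc (R + 3) * M * d ≤ (R + 3) * M * (1 / (4 * ((R + 3) * M))) := by gcongr; exact hdle.2.2
      _ = 1 / 4 := by field_simp
  have hR0 : (0 : ℝ) ≤ R := Nat.cast_nonneg R
  refine ⟨d, hd0, hdle.1, by nlinarith [mul_pos hM hd0], 2 ^ (2 / 3 : ℝ) * (max K₀ 0) ^ (5 / 3 : ℝ),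
    by positivity, ?_⟩
  intro lam hlam D hD i L hL hKL hLd hi hti Ω Ω' hΩ hΩ' hsep w₀ hw₀ f hf p hp
  set δ := (L : ℝ) * lam ^ (-(1 / 2) : ℝ) with hδdef
  set σ := Real.tan (D.ang i.castSucc) with hσ
  have hL0 : (0 : ℝ) < L := by exact_mod_cast hL
  have hδ0 : 0 < δ := by positivity
  have hδ1 : δ ≤ 1 := hLd.trans hdle.1
  have hMδ : 2 * M * δ ≤ 1 / 4 := by nlinarith [mul_pos hM hd0, mul_pos hM hδ0]
  have hMδ' : M * δ ≤ 1 / 4 := by nlinarith [mul_pos hM hδ0]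
  -- The large parameter of the rescaled operator is exactly the scale of the rescaled
  -- decomposition.
  have hlamδ : lam * δ ^ 2 = (L : ℝ) ^ 2 := by
    rw [hδdef, mul_pow, ← Real.rpow_natCast (lam ^ _), ← Real.rpow_mul (by positivity)]
    norm_num
    rw [Real.rpow_neg_one]
    field_simp
  obtain ⟨D', e, he, heang, heχ⟩ := hresc lam hlam D i L hL hi
    (le_trans (by rw [← hδdef]; gcongr) hRd)
  rw [← hδdef, ← hσ] at heang heχ
  set π : Par := (δ, σ, w₀) with hπ
  have hπK : π ∈ Kp := ⟨⟨hδ0.le, hδ1⟩, abs_le.1 hti, by simpa [dist_eq_norm] using hw₀⟩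
  obtain ⟨hctrl, htrans⟩ := hphase δ σ w₀ (by rw [abs_of_pos hδ0]; exact hLd.trans hdle.2.1) hti hw₀
  have hpre : ∀ Θ : Finset (Fin D.n), Θ ⊆ D.block i L →
      (Finset.univ.filter fun k => e k ∈ Θ).map e = Θ := by
    intro Θ hΘ
    ext ν
    simp only [Finset.mem_map, Finset.mem_filter, Finset.mem_univ, true_and]
    constructor
    · rintro ⟨k, hk, rfl⟩; exact hk
    · intro hν
      obtain ⟨m1, m2⟩ := D.mem_block.1 (hΘ hν)
      obtain ⟨k, hk⟩ := he ν (by omega) (by omega)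
      exact ⟨k, by rwa [hk], hk⟩
  set Ω₁ := Finset.univ.filter fun k => e k ∈ Ω with hΩ₁
  set Ω₁' := Finset.univ.filter fun k => e k ∈ Ω' with hΩ₁'
  have mem₁ : ∀ k ∈ Ω₁, e k ∈ Ω := fun k hk => (Finset.mem_filter.1 hk).2
  have mem₁' : ∀ k ∈ Ω₁', e k ∈ Ω' := fun k hk => (Finset.mem_filter.1 hk).2
  set a' := rescAmp Z b β a π with ha'
  set φ' := persp fun x => resc P Z (π, x) with hφ'
  set q' := symbolOf (fun x => resc P Z (π, x)) (2 * (64 * M + 2)) with hq'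
  set g := rescaleFun lam δ σ w₀ f with hg
  -- For sectors of the block the frequency cutoff `β` equals one wherever the amplitude is nonzero,
  -- so only the spatial cutoff `b` is visible.
  have hamp : ∀ k, e k ∈ D.block i L → ∀ v η, D'.amp a' k v η =
      (b v : ℂ) * D.amp a (e k) (place Z π v) (shear σ δ η) := by
    intro k hk v η
    simp only [SectorDecomposition.amp, ha', rescAmp, heχ]
    change _ * (_ * a (place Z π v) (shear σ δ η)) = _
    by_cases h0 : a (place Z π v) (shear σ δ η) = 0
    · simp [h0]
    by_cases h1 : D.χ (e k) (shear σ δ η) = 0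
    · simp [h1]
    obtain ⟨f1, f2, -⟩ := ha.freq hε₀ h0
    replace f1 : 1 / 2 < η 1 := f1
    replace f2 : η 1 < 3 / 2 := f2
    have hη1 : 0 < η 1 := by linarith
    have hη0 : η ≠ 0 := fun h => by rw [h] at hη1; simp at hη1
    obtain ⟨s, -, -, -, hst, -, ht⟩ := D.support_of_mem_block hM hlam hL hk hi hMδ
      (shear_ne_zero hδ0.ne' hη0) h1
    rw [← hst, shear_slope hη1.ne', add_sub_cancel_left, ← hδdef, abs_mul, abs_of_pos hδ0,
      mul_comm, mul_le_mul_iff_left₀ hδ0, abs_div, abs_of_pos hη1, div_le_iff₀ hη1] at ht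
    rw [hβ1 (η 0) (by nlinarith)]
    push_cast
    ring
  have hosc : ∀ k, e k ∈ D.block i L → ∀ v,
      osc φ' (D'.amp a' k) ((L : ℝ) ^ 2) g v = (b v : ℂ) * osc φ (D.amp a (e k)) lam f (p v) := by
    intro k hk v
    have hlin : osc φ' (D'.amp a' k) ((L : ℝ) ^ 2) g v = (b v : ℂ) *
        osc φ' (fun v η => D.amp a (e k) (place Z π v) (shear σ δ η)) ((L : ℝ) ^ 2) g v := by
      unfold osc
      rw [← integral_const_mul]
      congr 1; ext η
      rw [hamp k hk]; ring
    rw [hlin]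
    -- The normal coordinates are valid only near `w₁`; where `b` vanishes there is nothing to
    -- compare.
    by_cases hv : b v = 0
    · simp [hv]
    congr 1
    have hc : ∀ z η, D.amp a (e k) z η ≠ 0 → ‖z‖ < σ₁ ∧ 0 < η 1 ∧ |η 0 / η 1| < σ₁ := by
      intro z η hne
      have hne' := right_ne_zero_of_mul hne
      obtain ⟨f1, f2, f3⟩ := ha.freq hε₀ hne'
      have hz := (ha.support z η hne').1
      have : 0 ≤ ε₀ := (norm_nonneg z).trans hz.le
      exact ⟨by linarith, by linarith, by linarith⟩
    have hvn : ‖π.2.2 + aniso π.1 v - w₁‖ < r₁ := by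
      have h1 := norm_aniso_le (by rwa [abs_of_pos hδ0] : |δ| ≤ 1) v
      have h2 := hbs v hv
      calc ‖w₀ + aniso δ v - w₁‖ = ‖(w₀ - w₁) + aniso δ v‖ := by congr 1; abel
        _ ≤ ‖w₀ - w₁‖ + ‖aniso δ v‖ := norm_add_le _ _
        _ < r₁ := by linarith
    rw [hp, ← osc_resc hn hc (π := π) hti hδ0 lam hvn f]
    exact congrArg (fun l => osc φ' (fun v η => D.amp a (e k) (place Z π v) (shear σ δ η)) l g v)
      hlamδ.symm
  have hpart : ∀ Θ : Finset (Fin D.n), Θ ⊆ D.block i L → ∀ v,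
      ∑ k ∈ Finset.univ.filter (fun k => e k ∈ Θ), osc φ' (D'.amp a' k) ((L : ℝ) ^ 2) g v =
        (b v : ℂ) * D.part φ a Θ f (p v) := by
    intro Θ hΘ v
    conv_rhs => rw [← hpre Θ hΘ]
    rw [SectorDecomposition.part, Finset.sum_map, Finset.mul_sum]
    exact Finset.sum_congr rfl fun k hk => hosc k (hΘ (Finset.mem_filter.1 hk).2) v
  have hsq : ∀ Θ : Finset (Fin D.n), Θ ⊆ D.block i L →
      eLpNorm (D'.square φ' a' (Finset.univ.filter fun k => e k ∈ Θ) g) (10 / 3) volume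
        ^ (10 / 3 : ℝ) ≤
      ∫⁻ v in Metric.closedBall 0 (r₁ / 8), D.sqSum φ a (D.block i L) f (p v) ^ (5 / 3 : ℝ) := by
    intro Θ hΘ
    rw [eLpNorm_rpow_eq, ← lintegral_indicator Metric.isClosed_closedBall.measurableSet]
    refine lintegral_mono fun v => ?_
    rw [SectorDecomposition.enorm_square_rpow]
    have hsum : D'.sqSum φ' a' (Finset.univ.filter fun k => e k ∈ Θ) g v =
        ‖(b v : ℂ)‖ₑ ^ 2 * D.sqSum φ a Θ f (p v) := by
      conv_rhs => rw [← hpre Θ hΘ]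
      rw [SectorDecomposition.sqSum, SectorDecomposition.sqSum, Finset.sum_map, Finset.mul_sum]
      refine Finset.sum_congr rfl fun k hk => ?_
      rw [hosc k (hΘ (Finset.mem_filter.1 hk).2) v, enorm_mul, mul_pow]
    rw [hsum]
    by_cases hv : v ∈ Metric.closedBall (0 : E3) (r₁ / 8)
    · rw [indicator_of_mem hv]
      refine ENNReal.rpow_le_rpow ?_ (by norm_num)
      refine (mul_le_of_le_one_left' ?_).trans (D.sqSum_mono φ a hΘ f _)
      refine pow_le_one₀ zero_le ?_
      rw [← ofReal_norm, Complex.norm_real, Real.norm_eq_abs, abs_of_nonneg b.nonneg]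
      exact ENNReal.ofReal_le_one.2 b.le_one
    · have : b v = 0 := by
        by_contra hc
        exact hv (by simpa using hbs v hc)
      rw [this]
      simp
  have hmain := hK₀ φ' q' a' (by
      have : 2 * (r₁ / 8) = r₁ / 4 := by ring
      rw [this]; exact hctrl) (hBd π hπK) ((L : ℝ) ^ 2) (one_le_pow₀ (by exact_mod_cast hL)) D'
    (D.isPartition_rescAmp hM hlam hD ha hε₀ hL hR (by rw [← hδdef]; linarith) hβs D' e he heχ)
    Ω₁ Ω₁'
    (D.separated_of_rescale hM hlam hK hL hi hMδ' hΩ hΩ' hsep D' e heang mem₁ mem₁' hcc)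
    (by
      intro k hk k' hk' v η η' hne hne'
      have s1 := (hBd π hπK).support v η (right_ne_zero_of_mul hne)
      have s2 := (hBd π hπK).support v η' (right_ne_zero_of_mul hne')
      have pos : ∀ {η : E2}, |η 0| ≤ (64 * M + 2) * η 1 → (64 * M + 2)⁻¹ ≤ ‖η‖ → 0 < η 1 := by
        intro η h1 h2
        have h3 : 0 ≤ η 1 := by
          have := (abs_nonneg (η 0)).trans h1
          exact nonneg_of_mul_nonneg_right this (by positivity)
        refine lt_of_le_of_ne h3 fun h4 => ?_
        rw [← h4, mul_zero] at h1
        have h5 : η 0 = 0 := abs_eq_zero.1 (le_antisymm h1 (abs_nonneg _))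
        have h6 : η = 0 := by
          ext j; fin_cases j
          · exact h5
          · exact h4.symm
        rw [h6, norm_zero] at h2
        have : 0 < (64 * M + 2)⁻¹ := by positivity
        linarith
      have p1 := pos s1.2.1 s1.2.2.1
      have p2 := pos s2.2.1 s2.2.2.1
      have c1 : η ∈ cone (2 * (64 * M + 2)) := by
        change |η 0| < _
        nlinarith [s1.2.1]
      have c2 : η' ∈ cone (2 * (64 * M + 2)) := by
        change |η' 0| < _
        nlinarith [s2.2.1]
      have hvb : v ∈ Metric.ball (0 : E3) (r₁ / 4) := by
        rw [mem_ball_zero_iff]; linarith [s1.1]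
      have x1 := left_ne_zero_of_mul hne
      have x2 := left_ne_zero_of_mul hne'
      rw [heχ] at x1 x2
      have hslope := D.slope_separated hM hlam hK hL hKL hi hMδ (hΩ (mem₁ k hk))
        (hΩ' (mem₁' k' hk')) (hsep _ (mem₁ k hk) _ (mem₁' k' hk')) p1 p2
        (fun h => x1 (by rw [h]; simp)) (fun h => x2 (by rw [h]; simp))
      have ht := htrans v hvb η c1 η' c2 hslope
      exact ⟨ht η (Or.inl rfl), ht η' (Or.inr rfl)⟩)
    g g (memLp_rescaleFun lam σ hδ0 hδ1 w₀ hf) (memLp_rescaleFun lam σ hδ0 hδ1 w₀ hf)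
  have hG : eLpNorm g (10 / 3) volume ^ (10 / 3 : ℝ) ≤ ∫⁻ η, ‖f η‖ₑ ^ (10 / 3 : ℝ) := by
    rw [← eLpNorm_rpow_eq]
    exact ENNReal.rpow_le_rpow (eLpNorm_rescaleFun_le lam σ hδ0 hδ1 w₀ f) (by norm_num)
  have hfin := rpow_bilinear hmain (hsq Ω hΩ) (hsq Ω' hΩ') hG
  rw [eLpNorm_rpow_eq'] at hfin
  have hlow : ∫⁻ v in Metric.ball 0 (r₁ / 16),
      (‖D.part φ a Ω f (p v)‖ₑ * ‖D.part φ a Ω' f (p v)‖ₑ) ^ (5 / 3 : ℝ) ≤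
      ∫⁻ v, ‖(∑ ν ∈ Ω₁, osc φ' (D'.amp a' ν) ((L : ℝ) ^ 2) g v) *
        (∑ ν' ∈ Ω₁', osc φ' (D'.amp a' ν') ((L : ℝ) ^ 2) g v)‖ₑ ^ (5 / 3 : ℝ) := by
    rw [← lintegral_indicator Metric.isOpen_ball.measurableSet]
    refine lintegral_mono fun v => ?_
    by_cases hv : v ∈ Metric.ball (0 : E3) (r₁ / 16)
    · rw [indicator_of_mem hv, hpart Ω hΩ v, hpart Ω' hΩ' v,
        b.one_of_mem_closedBall (Metric.ball_subset_closedBall hv)]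
      simp [enorm_mul]
    · rw [indicator_of_notMem hv]; exact zero_le
  refine hlow.trans (hfin.trans ?_)
  have hL2 : (1 : ℝ) ≤ (L : ℝ) ^ 2 := one_le_pow₀ (by exact_mod_cast hL)
  have hcoef : ∀ t : ℝ, (2 : ENNReal) ^ (2 / 3 : ℝ) *
      ENNReal.ofReal (K₀ * ((L : ℝ) ^ 2) ^ t) ^ (5 / 3 : ℝ) ≤
      ENNReal.ofReal (2 ^ (2 / 3 : ℝ) * (max K₀ 0) ^ (5 / 3 : ℝ) *
        ((L : ℝ) ^ 2) ^ (t * (5 / 3))) := by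
    intro t
    have h0 : (0 : ℝ) ≤ max K₀ 0 * ((L : ℝ) ^ 2) ^ t := by positivity
    calc _ ≤ (2 : ENNReal) ^ (2 / 3 : ℝ) *
        ENNReal.ofReal (max K₀ 0 * ((L : ℝ) ^ 2) ^ t) ^ (5 / 3 : ℝ) := by
          gcongr
          exact le_max_left _ _
      _ = _ := by
          have h2 : (2 : ENNReal) ^ (2 / 3 : ℝ) = ENNReal.ofReal (2 ^ (2 / 3 : ℝ)) := by
            rw [← ENNReal.ofReal_rpow_of_nonneg (by norm_num) (by norm_num)]; simp
          rw [h2, ENNReal.ofReal_rpow_of_nonneg h0 (by norm_num), Real.mul_rpow (by positivity)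
            (by positivity), ← Real.rpow_mul (by positivity), ← ENNReal.ofReal_mul (by positivity),
            mul_assoc]
  rw [mul_add, ← mul_assoc, ← mul_assoc]
  refine add_le_add (mul_le_mul_left (hcoef _) _) (mul_le_mul_left ((hcoef _).trans ?_) _)
  refine ENNReal.ofReal_le_ofReal (mul_le_mul_of_nonneg_left ?_ (by positivity))
  -- The error now has exponent `-(5/3) N`, which is weakened to `-N` since `L² ≥ 1`.
  refine Real.rpow_le_rpow_of_exponent_le hL2 ?_
  have : (0 : ℝ) ≤ N := Nat.cast_nonneg N
  linarith

end SqFn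

end

noncomputable section

namespace SqFn

/-! ### From rescaled coordinates to the original ones -/

theorem image_coords {φ : E3 → E2 → ℝ} {P : E3 × ℝ → ℝ} {Z : ℝ × E3 → E3} {r₁ σ₁ κ : ℝ} {w₁ : E3}
    (hn : IsNormalized φ P Z r₁ σ₁ κ w₁) {σ : ℝ} (hσ : |σ| ≤ σ₁) (G : E3 → ENNReal) :
    ∫⁻ w in (fun z => coords P (σ, z)) '' Metric.ball 0 σ₁, G (Z (σ, w)) =
      ∫⁻ z in Metric.ball 0 σ₁, ENNReal.ofReal |(coordsDeriv P (σ, z)).det| * G z := by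
  rw [lintegral_image_eq_lintegral_abs_det_fderiv_mul volume Metric.isOpen_ball.measurableSet
    (fun z _ => (hasFDerivAt_coords_slice hn.smoothP σ z).hasFDerivWithinAt)]
  · refine setLIntegral_congr_fun Metric.isOpen_ball.measurableSet fun z hz => ?_
    simp only [hn.left σ z hσ (by simpa using hz)]
  · intro z hz z' hz' h
    rw [← hn.left σ z hσ (by simpa using hz), ← hn.left σ z' hσ (by simpa using hz')]
    exact congrArg (fun w => Z (σ, w)) h

theorem setLIntegral_translate_le (H : E3 → ENNReal) {S T : Set E3} (hS : MeasurableSet S)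
    (hT : MeasurableSet T) {u : E3} (h : ∀ w ∈ S, w + u ∈ T) :
    ∫⁻ w in S, H (w + u) ≤ ∫⁻ w in T, H w := by
  rw [← lintegral_indicator hS, ← lintegral_indicator hT,
    ← lintegral_add_right_eq_self (T.indicator fun w => H w) u]
  refine lintegral_mono fun w => ?_
  by_cases hw : w ∈ S
  · rw [indicator_of_mem hw, indicator_of_mem (h w hw)]
  · rw [indicator_of_notMem hw]; exact zero_le

/-- Integrate the local estimates over the centre `w₀` and exchange the integrals. For fixed `v`,
integration over `w₀` is a translate of integration in the coordinate `w`, whose Jacobian is bounded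
above and below. No power of `δ` appears, and no covering by anisotropic boxes is needed. -/
theorem exists_lintegral_le_of_rescaled {φ : E3 → E2 → ℝ} {P : E3 × ℝ → ℝ} {Z : ℝ × E3 → E3}
    {r₁ σ₁ κ : ℝ} {w₁ : E3} (hn : IsNormalized φ P Z r₁ σ₁ κ w₁) :
    ∃ c : ℝ, 0 ≤ c ∧ ∀ (σ δ : ℝ), |σ| ≤ σ₁ → 0 < δ → δ ≤ 1 → ∀ G H : E3 → ENNReal,
      Measurable G → Measurable H → (∀ z, G z ≠ 0 → ‖z‖ < σ₁) → (∀ z, H z ≠ 0 → ‖z‖ < σ₁) →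
      ∀ X Y : ENNReal, (∀ w₀, ‖w₀ - w₁‖ ≤ r₁ / 2 →
        ∫⁻ v in Metric.ball 0 (r₁ / 16), G (place Z (δ, σ, w₀) v) ≤
          X * (∫⁻ v in Metric.closedBall 0 (r₁ / 8), H (place Z (δ, σ, w₀) v)) + Y) →
      ∫⁻ z, G z ≤ ENNReal.ofReal c * (X * (∫⁻ z, H z) + Y) := by
  have hr₁ : 0 < r₁ := hn.pos.trans_le hn.le_r
  have hκ := hn.κ_pos
  set V₁ := volume (Metric.ball (0 : E3) (r₁ / 16)) with hV₁
  set V₂ := volume (Metric.closedBall (0 : E3) (r₁ / 8)) with hV₂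
  set V₃ := volume (Metric.closedBall w₁ (r₁ / 2)) with hV₃
  have hV₁0 : V₁ ≠ 0 := (Metric.measure_ball_pos _ _ (by positivity)).ne'
  have hV₁t : V₁ ≠ ⊤ := measure_ball_lt_top.ne
  have hV₂t : V₂ ≠ ⊤ := measure_closedBall_lt_top.ne
  have hV₃t : V₃ ≠ ⊤ := measure_closedBall_lt_top.ne
  set c : ENNReal := V₁⁻¹ * ENNReal.ofReal κ * (V₂ * ENNReal.ofReal κ + V₃) with hc
  have hct : c ≠ ⊤ := by
    refine ENNReal.mul_ne_top (ENNReal.mul_ne_top (ENNReal.inv_ne_top.2 hV₁0) ENNReal.ofReal_ne_top)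
      (ENNReal.add_ne_top.2 ⟨ENNReal.mul_ne_top hV₂t ENNReal.ofReal_ne_top, hV₃t⟩)
  refine ⟨c.toReal, ENNReal.toReal_nonneg, ?_⟩
  intro σ δ hσ hδ hδ1 G H hG hH hGs hHs X Y hloc
  rw [ENNReal.ofReal_toReal hct]
  have hδabs : |δ| ≤ 1 := by rwa [abs_of_pos hδ]
  have hmeas : ∀ F : E3 → ENNReal, Measurable F →
      Measurable fun x : E3 × E3 => F (place Z (δ, σ, x.1) x.2) := by
    intro F hF
    refine hF.comp (Continuous.measurable ?_)
    exact (contDiff_place hn.smoothZ).continuous.comp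
      (g := fun x : Par × E3 => place Z x.1 x.2) (f := fun x : E3 × E3 => ((δ, σ, x.1), x.2))
      (by fun_prop)
  set S := Metric.closedBall w₁ (r₁ / 2) with hS
  have hSm : MeasurableSet S := Metric.isClosed_closedBall.measurableSet
  have hbm : MeasurableSet (Metric.ball w₁ (r₁ / 4)) := Metric.isOpen_ball.measurableSet
  have hcm : MeasurableSet (Metric.closedBall w₁ (5 * r₁ / 8)) :=
    Metric.isClosed_closedBall.measurableSet
  set I := (fun z => coords P (σ, z)) '' Metric.ball 0 σ₁ with hI
  -- the change of variables
  have lowG : ENNReal.ofReal κ⁻¹ * ∫⁻ z, G z ≤ ∫⁻ w in Metric.ball w₁ (r₁ / 4), G (Z (σ, w)) := by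
    have hsub : I ⊆ Metric.ball w₁ (r₁ / 4) := by
      rintro _ ⟨z, hz, rfl⟩
      rw [mem_ball_iff_norm]
      exact hn.near σ z hσ (by simpa using hz)
    refine le_trans ?_ (lintegral_mono_set hsub)
    rw [image_coords hn hσ G, ← lintegral_const_mul _ hG,
      ← lintegral_indicator Metric.isOpen_ball.measurableSet]
    refine lintegral_mono fun z => ?_
    by_cases hz : G z = 0
    · simp [hz]
    have hz' := hGs z hz
    rw [indicator_of_mem (by simpa using hz')]
    gcongr
    exact (hn.det σ z hσ hz').1
  have upH : ∫⁻ w in Metric.closedBall w₁ (5 * r₁ / 8), H (Z (σ, w)) ≤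
      ENNReal.ofReal κ * ∫⁻ z, H z := by
    have hle : ∫⁻ w in Metric.closedBall w₁ (5 * r₁ / 8), H (Z (σ, w)) ≤
        ∫⁻ w in I, H (Z (σ, w)) := by
      have hIm : MeasurableSet I := by
        refine (Metric.isOpen_ball.measurableSet).image_of_continuousOn_injOn ?_ ?_
        · exact fun z _ =>
            (hasFDerivAt_coords_slice hn.smoothP σ z).continuousAt.continuousWithinAt
        · intro z hz z' hz' h
          rw [← hn.left σ z hσ (by simpa using hz), ← hn.left σ z' hσ (by simpa using hz')]
          exact congrArg (fun w => Z (σ, w)) h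
      rw [← lintegral_indicator hcm, ← lintegral_indicator hIm]
      refine lintegral_mono fun w => ?_
      by_cases hw : w ∈ Metric.closedBall w₁ (5 * r₁ / 8)
      · rw [indicator_of_mem hw]
        by_cases h0 : H (Z (σ, w)) = 0
        · simp [h0]
        · rw [indicator_of_mem]
          rw [mem_closedBall_iff_norm] at hw
          exact ⟨Z (σ, w), by simpa using hHs _ h0, hn.right σ w (hσ.trans hn.le_r) (by linarith)⟩
      · rw [indicator_of_notMem hw]; exact zero_le
    refine hle.trans ?_
    rw [image_coords hn hσ H, ← lintegral_const_mul _ hH]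
    refine le_trans ?_ (setLIntegral_le_lintegral (Metric.ball 0 σ₁) _)
    refine setLIntegral_mono' Metric.isOpen_ball.measurableSet fun z hz => ?_
    gcongr
    exact (hn.det σ z hσ (by simpa using hz)).2
  -- averaging
  have avG : V₁ * (∫⁻ w in Metric.ball w₁ (r₁ / 4), G (Z (σ, w))) ≤
      ∫⁻ w₀ in S, ∫⁻ v in Metric.ball 0 (r₁ / 16), G (place Z (δ, σ, w₀) v) := by
    rw [lintegral_lintegral_swap (hmeas G hG).aemeasurable, mul_comm, hV₁, ← setLIntegral_const]
    refine setLIntegral_mono' Metric.isOpen_ball.measurableSet fun v hv => ?_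
    have hv1 := (norm_aniso_le hδabs v).trans_lt (mem_ball_zero_iff.1 hv)
    have := setLIntegral_translate_le (fun w => G (Z (σ, w + aniso δ v))) hbm hSm
      (u := -aniso δ v) (fun w hw => by
        rw [mem_closedBall_iff_norm]
        rw [mem_ball_iff_norm] at hw
        calc ‖w + -aniso δ v - w₁‖ = ‖(w - w₁) - aniso δ v‖ := by congr 1; abel
          _ ≤ ‖w - w₁‖ + ‖aniso δ v‖ := norm_sub_le _ _
          _ ≤ r₁ / 2 := by linarith)
    simp only [neg_add_cancel_right] at this
    exact this
  have avH : ∫⁻ w₀ in S, ∫⁻ v in Metric.closedBall 0 (r₁ / 8), H (place Z (δ, σ, w₀) v) ≤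
      V₂ * ∫⁻ w in Metric.closedBall w₁ (5 * r₁ / 8), H (Z (σ, w)) := by
    rw [lintegral_lintegral_swap (hmeas H hH).aemeasurable, mul_comm V₂, hV₂, ← setLIntegral_const]
    refine setLIntegral_mono' Metric.isClosed_closedBall.measurableSet fun v hv => ?_
    have hv1 := (norm_aniso_le hδabs v).trans (mem_closedBall_zero_iff.1 hv)
    exact setLIntegral_translate_le (fun w => H (Z (σ, w))) hSm hcm (u := aniso δ v) (fun w hw => by
      rw [mem_closedBall_iff_norm] at hw ⊢
      calc ‖w + aniso δ v - w₁‖ = ‖(w - w₁) + aniso δ v‖ := by congr 1; abel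
        _ ≤ ‖w - w₁‖ + ‖aniso δ v‖ := norm_add_le _ _
        _ ≤ 5 * r₁ / 8 := by linarith)
  have main : V₁ * (ENNReal.ofReal κ⁻¹ * ∫⁻ z, G z) ≤
      X * (V₂ * (ENNReal.ofReal κ * ∫⁻ z, H z)) + Y * V₃ := by
    calc V₁ * (ENNReal.ofReal κ⁻¹ * ∫⁻ z, G z)
        ≤ V₁ * ∫⁻ w in Metric.ball w₁ (r₁ / 4), G (Z (σ, w)) := by gcongr
      _ ≤ ∫⁻ w₀ in S, ∫⁻ v in Metric.ball 0 (r₁ / 16), G (place Z (δ, σ, w₀) v) := avG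
      _ ≤ ∫⁻ w₀ in S, (X * (∫⁻ v in Metric.closedBall 0 (r₁ / 8), H (place Z (δ, σ, w₀) v)) + Y) :=
          setLIntegral_mono' hSm fun w₀ hw₀ => hloc w₀ (mem_closedBall_iff_norm.1 hw₀)
      _ = X * (∫⁻ w₀ in S, ∫⁻ v in Metric.closedBall 0 (r₁ / 8), H (place Z (δ, σ, w₀) v)) +
            Y * V₃ := by
          have hm : Measurable fun w₀ =>
              ∫⁻ v in Metric.closedBall 0 (r₁ / 8), H (place Z (δ, σ, w₀) v) :=
            (hmeas H hH).lintegral_prod_right'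
          rw [lintegral_add_right _ measurable_const, lintegral_const_mul _ hm, setLIntegral_const]
      _ ≤ _ := by
          gcongr
          exact avH.trans (by gcongr)
  have hκ1 : ENNReal.ofReal κ * ENNReal.ofReal κ⁻¹ = 1 := by
    rw [← ENNReal.ofReal_mul hκ.le, mul_inv_cancel₀ hκ.ne', ENNReal.ofReal_one]
  calc ∫⁻ z, G z = V₁⁻¹ * ENNReal.ofReal κ * (V₁ * (ENNReal.ofReal κ⁻¹ * ∫⁻ z, G z)) := by
        calc ∫⁻ z, G z = (V₁⁻¹ * V₁) * (ENNReal.ofReal κ * ENNReal.ofReal κ⁻¹) * ∫⁻ z, G z := by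
              rw [hκ1, ENNReal.inv_mul_cancel hV₁0 hV₁t, one_mul, one_mul]
          _ = _ := by ring
    _ ≤ V₁⁻¹ * ENNReal.ofReal κ * (X * (V₂ * (ENNReal.ofReal κ * ∫⁻ z, H z)) + Y * V₃) := by
        gcongr
    _ ≤ c * (X * (∫⁻ z, H z) + Y) := by
        rw [hc, mul_assoc (V₁⁻¹ * ENNReal.ofReal κ)]
        gcongr
        rw [add_mul, mul_add, mul_add]
        have e1 : X * (V₂ * (ENNReal.ofReal κ * ∫⁻ z, H z)) =
          V₂ * ENNReal.ofReal κ * (X * ∫⁻ z, H z) := by ring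
        rw [e1, mul_comm Y]
        gcongr
        · exact le_self_add
        · exact le_add_self

/-! ### Measurability -/

/-- Nothing is known about `φ` away from the origin and the vertical direction, but where the
amplitude is nonzero it agrees with the measurable function `persp P`. -/
theorem measurable_kernel {φ : E3 → E2 → ℝ} {P : E3 × ℝ → ℝ} {Z : ℝ × E3 → E3} {r₁ σ₁ κ : ℝ}
    {w₁ : E3} (hn : IsNormalized φ P Z r₁ σ₁ κ w₁) {ε₀ : ℝ} {a : E3 → E2 → ℂ}
    (ha : IsLocalAmplitude ε₀ a) (hε₀ : ε₀ ≤ 1 / 2) (hε₀σ : 2 * ε₀ ≤ σ₁) {χ : E2 → ℝ}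
    (hχ : Measurable χ) (lam : ℝ) :
    Measurable fun x : E3 × E2 =>
      Complex.exp (Complex.I * ((lam * φ x.1 x.2 : ℝ) : ℂ)) * ((χ x.2 : ℂ) * a x.1 x.2) := by
  have heq : (fun x : E3 × E2 =>
      Complex.exp (Complex.I * ((lam * φ x.1 x.2 : ℝ) : ℂ)) * ((χ x.2 : ℂ) * a x.1 x.2)) =
      fun x => Complex.exp (Complex.I * ((lam * persp P x.1 x.2 : ℝ) : ℂ)) *
        ((χ x.2 : ℂ) * a x.1 x.2) := by
    ext ⟨z, η⟩
    by_cases h0 : a z η = 0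
    · simp [h0]
    obtain ⟨f1, f2, f3⟩ := ha.freq hε₀ h0
    have hz := (ha.support z η h0).1
    have : 0 ≤ ε₀ := (norm_nonneg z).trans hz.le
    simp only [hn.eq z (by linarith) η (by linarith) (by linarith)]
  rw [heq]
  have hpers : Measurable fun x : E3 × E2 => persp P x.1 x.2 := by
    unfold persp
    have h0 : Measurable fun x : E3 × E2 => x.2 0 := by fun_prop
    have h1 : Measurable fun x : E3 × E2 => x.2 1 := by fun_prop
    exact h1.mul (hn.smoothP.continuous.measurable.comp (measurable_fst.prodMk (h0.div h1)))
  have hexp : Measurable fun x : E3 × E2 =>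
      Complex.exp (Complex.I * ((lam * persp P x.1 x.2 : ℝ) : ℂ)) :=
    Complex.continuous_exp.measurable.comp
      ((Complex.measurable_ofReal.comp (hpers.const_mul lam)).const_mul _)
  exact hexp.mul ((Complex.measurable_ofReal.comp (hχ.comp measurable_snd)).mul
    ha.smooth.continuous.measurable)

theorem measurable_osc {φ : E3 → E2 → ℝ} {P : E3 × ℝ → ℝ} {Z : ℝ × E3 → E3} {r₁ σ₁ κ : ℝ} {w₁ : E3}
    (hn : IsNormalized φ P Z r₁ σ₁ κ w₁) {ε₀ : ℝ} {a : E3 → E2 → ℂ} (ha : IsLocalAmplitude ε₀ a)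
    (hε₀ : ε₀ ≤ 1 / 2) (hε₀σ : 2 * ε₀ ≤ σ₁) {χ : E2 → ℝ} (hχ : Measurable χ) (lam : ℝ)
    {f : E2 → ℂ} (hf : AEStronglyMeasurable f volume) :
    Measurable (osc φ (fun z η => (χ η : ℂ) * a z η) lam f) := by
  have heq : osc φ (fun z η => (χ η : ℂ) * a z η) lam f = fun z => ∫ η,
      Complex.exp (Complex.I * ((lam * φ z η : ℝ) : ℂ)) * ((χ η : ℂ) * a z η) * hf.mk f η := by
    ext z
    refine integral_congr_ae ?_
    filter_upwards [hf.ae_eq_mk] with η hη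
    rw [← hη]
  rw [heq]
  exact ((measurable_kernel hn ha hε₀ hε₀σ hχ lam).mul
    (hf.stronglyMeasurable_mk.measurable.comp
      measurable_snd)).stronglyMeasurable.integral_prod_right'.measurable

theorem SectorDecomposition.measurable_χ {lam M : ℝ} {C : ℕ → ℝ} (D : SectorDecomposition lam M C)
    (ν : Fin D.n) : Measurable (D.χ ν) :=
  measurable_of_continuousOn_compl_singleton 0 (D.χ_smooth ν).continuousOn

end SqFn

end

noncomputable section

namespace SqFn

/-! ### The bilinear estimate for two parts of a block of sectors -/

namespace SectorDecomposition

variable {lam M : ℝ} {C : ℕ → ℝ}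

theorem exists_amp_ne_zero_of_part (D : SectorDecomposition lam M C) {φ : E3 → E2 → ℝ}
    {a : E3 → E2 → ℂ} {Ω : Finset (Fin D.n)} {f : E2 → ℂ} {z : E3} (h : D.part φ a Ω f z ≠ 0) :
    ∃ ν ∈ Ω, ∃ η, D.amp a ν z η ≠ 0 := by
  obtain ⟨ν, hν, hne⟩ := Finset.exists_ne_zero_of_sum_ne_zero h
  refine ⟨ν, hν, ?_⟩
  by_contra hc
  push Not at hc
  exact hne (by simp [osc, hc])

theorem exists_amp_ne_zero_of_sqSum (D : SectorDecomposition lam M C) {φ : E3 → E2 → ℝ}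
    {a : E3 → E2 → ℂ} {Ω : Finset (Fin D.n)} {f : E2 → ℂ} {z : E3} (h : D.sqSum φ a Ω f z ≠ 0) :
    ∃ ν ∈ Ω, ∃ η, D.amp a ν z η ≠ 0 := by
  obtain ⟨ν, hν, hne⟩ := Finset.exists_ne_zero_of_sum_ne_zero h
  refine ⟨ν, hν, ?_⟩
  by_contra hc
  push Not at hc
  exact hne (by simp [osc, hc])

theorem measurable_part {φ : E3 → E2 → ℝ} {P : E3 × ℝ → ℝ} {Z : ℝ × E3 → E3} {r₁ σ₁ κ : ℝ} {w₁ : E3}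
    (hn : IsNormalized φ P Z r₁ σ₁ κ w₁) {ε₀ : ℝ} {a : E3 → E2 → ℂ} (ha : IsLocalAmplitude ε₀ a)
    (hε₀ : ε₀ ≤ 1 / 2) (hε₀σ : 2 * ε₀ ≤ σ₁) (D : SectorDecomposition lam M C)
    (Ω : Finset (Fin D.n)) {f : E2 → ℂ} (hf : AEStronglyMeasurable f volume) :
    Measurable (D.part φ a Ω f) :=
  Finset.measurable_sum _ fun ν _ =>
    measurable_osc hn ha hε₀ hε₀σ (D.measurable_χ ν) lam hf

theorem measurable_sqSum {φ : E3 → E2 → ℝ} {P : E3 × ℝ → ℝ} {Z : ℝ × E3 → E3} {r₁ σ₁ κ : ℝ}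
    {w₁ : E3} (hn : IsNormalized φ P Z r₁ σ₁ κ w₁) {ε₀ : ℝ} {a : E3 → E2 → ℂ}
    (ha : IsLocalAmplitude ε₀ a) (hε₀ : ε₀ ≤ 1 / 2) (hε₀σ : 2 * ε₀ ≤ σ₁)
    (D : SectorDecomposition lam M C) (Ω : Finset (Fin D.n)) {f : E2 → ℂ}
    (hf : AEStronglyMeasurable f volume) :
    Measurable (D.sqSum φ a Ω f) :=
  Finset.measurable_sum _ fun ν _ =>
    ((measurable_osc hn ha hε₀ hε₀σ (D.measurable_χ ν) lam hf).enorm).pow_const 2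

/-- If a sector of a block meets the support of the amplitude then the block is close to
the vertical direction. -/
theorem abs_ang_le_of_amp_ne_zero (hM : 0 < M) (hlam : 1 ≤ lam) (D : SectorDecomposition lam M C)
    {ε₀ : ℝ} {a : E3 → E2 → ℂ} (ha : IsLocalAmplitude ε₀ a) (hε₀ : ε₀ ≤ 1 / 2) {i ν : Fin D.n}
    {L : ℕ} (hL : 1 ≤ L) (hδ : M * (L * lam ^ (-(1 / 2) : ℝ)) ≤ 1) (hν : ν ∈ D.block i L) {z : E3}
    {η : E2} (hne : D.amp a ν z η ≠ 0) :
    |D.ang i.castSucc| ≤ 2 * ε₀ + 2 * M * (L * lam ^ (-(1 / 2) : ℝ)) := by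
  have h1 : D.χ ν η ≠ 0 := fun h => hne (by simp [amp, h])
  obtain ⟨f1, -, f3⟩ := ha.freq hε₀ (right_ne_zero_of_mul hne)
  have hh : 0 < lam ^ (-(1 / 2) : ℝ) := by positivity
  have hL1 : (1 : ℝ) ≤ L := by exact_mod_cast hL
  have hMh : M * lam ^ (-(1 / 2) : ℝ) ≤ M * (L * lam ^ (-(1 / 2) : ℝ)) := by
    gcongr; nlinarith
  have hs := D.arctan_mem_of_support (hMh.trans hδ) (by linarith) h1
  have ht := abs_arctan_sub_arctan_le (η 0 / η 1) 0
  rw [Real.arctan_zero, sub_zero, sub_zero] at ht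
  obtain ⟨c1, c2⟩ := D.abs_ang_sub_le_of_mem_block hM hlam hν
  rw [abs_le] at c1 c2 ht ⊢
  have := hs.1
  have := hs.2
  constructor <;> linarith

end SectorDecomposition

/-- The local estimates are averaged over the centres. Any block that contributes has its base slope
in the range of the normal coordinates. -/
theorem exists_bilinear_block (hbil : BilinearSquareFunctionEstimate)
    {φ : E3 → E2 → ℝ} {P : E3 × ℝ → ℝ} {Z : ℝ × E3 → E3} {r₁ σ₁ κ : ℝ} {w₁ : E3}
    (hn : IsNormalized φ P Z r₁ σ₁ κ w₁) {a : E3 → E2 → ℂ} (ha : IsLocalAmplitude (σ₁ / 64) a)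
    {M : ℝ} (hM : 0 < M) (C : ℕ → ℝ) {K : ℕ} (hK : 1 ≤ K) {ε : ℝ} (hε : 0 < ε) (N : ℕ) :
    ∃ d : ℝ, 0 < d ∧ d ≤ 1 ∧ ∃ B : ℝ, 0 ≤ B ∧
      ∀ lam : ℝ, 1 ≤ lam → ∀ D : SectorDecomposition lam M C, D.IsPartition a →
      ∀ i L : ℕ, 1 ≤ L → 4 * M ^ 2 * K ≤ L → L * lam ^ (-(1 / 2) : ℝ) ≤ d →
      ∀ Ω Ω' : Finset (Fin D.n), Ω ⊆ D.block i L → Ω' ⊆ D.block i L →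
      (∀ ν ∈ Ω, ∀ ν' ∈ Ω', ((ν : ℕ) + 1) * K + L ≤ ν' * K) →
      ∀ f : E2 → ℂ, MemLp f (10 / 3) volume →
      ∫⁻ z, (‖D.part φ a Ω f z‖ₑ * ‖D.part φ a Ω' f z‖ₑ) ^ (5 / 3 : ℝ) ≤
        ENNReal.ofReal (B * ((L : ℝ) ^ 2) ^ ((1 / 10 + ε) * (5 / 3) : ℝ)) *
          (∫⁻ z, D.sqSum φ a (D.block i L) f z ^ (5 / 3 : ℝ)) +
        ENNReal.ofReal (B * ((L : ℝ) ^ 2) ^ (-(N : ℝ))) * ∫⁻ η, ‖f η‖ₑ ^ (10 / 3 : ℝ) := by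
  have hσ₁ := hn.pos
  have hσ₁' := hn.le_one
  have hε₀ : σ₁ / 64 ≤ 1 / 2 := by linarith
  have hε₀σ : 2 * (σ₁ / 64) ≤ σ₁ := by linarith
  obtain ⟨d, hd, hd1, hMd, B, hB, hloc⟩ :=
    exists_bilinear_rescaled hbil hn ha hε₀ hε₀σ hM C hK hε N
  obtain ⟨c, hc, hglob⟩ := exists_lintegral_le_of_rescaled hn
  -- The bound `M δ ≤ σ₁/32` and the support radius `σ₁/64` place the base angle of a contributing
  -- block within `σ₁/8`, hence its slope within `σ₁`.
  refine ⟨min d (σ₁ / (32 * M)), by positivity, (min_le_left _ _).trans hd1, c * B, by positivity,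
    ?_⟩
  intro lam hlam D hD i L hL hKL hLd Ω Ω' hΩ hΩ' hsep f hf
  have hL0 : (0 : ℝ) < L := by exact_mod_cast hL
  -- If the first factor does not vanish identically, then `i` is a genuine sector index and the
  -- block is nearly vertical.
  by_cases htriv : ∀ z, D.part φ a Ω f z = 0
  · simp [htriv]
  push Not at htriv
  obtain ⟨z₀, hz₀⟩ := htriv
  obtain ⟨ν, hν, η, hne⟩ := D.exists_amp_ne_zero_of_part hz₀
  have hin : i < D.n := lt_of_le_of_lt (D.mem_block.1 (hΩ hν)).1 ν.2
  lift i to Fin D.n using hin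
  set δ := (L : ℝ) * lam ^ (-(1 / 2) : ℝ) with hδdef
  have hδ0 : 0 < δ := by positivity
  have hδd : δ ≤ d := hLd.trans (min_le_left _ _)
  have hδσ : M * δ ≤ σ₁ / 32 := by
    have := hLd.trans (min_le_right _ _)
    rw [le_div_iff₀ (by positivity)] at this
    linarith
  have hang : |D.ang i.castSucc| ≤ σ₁ / 8 := by
    have := D.abs_ang_le_of_amp_ne_zero hM hlam ha hε₀ hL (by rw [← hδdef]; linarith) (hΩ hν) hne
    rw [← hδdef] at this
    linarith
  have htan : |Real.tan (D.ang i.castSucc)| ≤ σ₁ := by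
    have := abs_tan_sub_tan_le (a := 0) (b := D.ang i.castSucc) (by simp) (by linarith)
    rw [Real.tan_zero, sub_zero, sub_zero] at this
    linarith
  have hmp : ∀ Θ, Measurable (D.part φ a Θ f) := fun Θ =>
    D.measurable_part hn ha hε₀ hε₀σ Θ hf.1
  have hms : ∀ Θ, Measurable (D.sqSum φ a Θ f) := fun Θ =>
    D.measurable_sqSum hn ha hε₀ hε₀σ Θ hf.1
  have hsmall : ∀ {ν z η}, D.amp a ν z η ≠ 0 → ‖z‖ < σ₁ := by
    intro ν z η hne
    have := (ha.support z η (right_ne_zero_of_mul hne)).1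
    linarith
  have key := hglob (Real.tan (D.ang i.castSucc)) δ htan hδ0 (hδd.trans hd1)
    (fun z => (‖D.part φ a Ω f z‖ₑ * ‖D.part φ a Ω' f z‖ₑ) ^ (5 / 3 : ℝ))
    (fun z => D.sqSum φ a (D.block i L) f z ^ (5 / 3 : ℝ))
    (((hmp Ω).enorm.mul (hmp Ω').enorm).pow_const _) ((hms _).pow_const _)
    (fun z hz => by
      have : D.part φ a Ω f z ≠ 0 := fun h => hz (by simp [h])
      obtain ⟨ν, -, η, hne⟩ := D.exists_amp_ne_zero_of_part this
      exact hsmall hne)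
    (fun z hz => by
      have : D.sqSum φ a (D.block i L) f z ≠ 0 := fun h => hz (by simp [h])
      obtain ⟨ν, -, η, hne⟩ := D.exists_amp_ne_zero_of_sqSum this
      exact hsmall hne)
    (ENNReal.ofReal (B * ((L : ℝ) ^ 2) ^ ((1 / 10 + ε) * (5 / 3) : ℝ)))
    (ENNReal.ofReal (B * ((L : ℝ) ^ 2) ^ (-(N : ℝ))) * ∫⁻ η, ‖f η‖ₑ ^ (10 / 3 : ℝ))
    (fun w₀ hw₀ => hloc lam hlam D hD i L hL hKL hδd (by linarith) (htan.trans hn.le_r) Ω Ω' hΩ hΩ'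
      hsep w₀ hw₀ f hf _ rfl)
  refine key.trans (le_of_eq ?_)
  rw [mul_add, ← mul_assoc, ← mul_assoc, ← ENNReal.ofReal_mul hc, ← ENNReal.ofReal_mul hc,
    mul_assoc c, mul_assoc c]

end SqFn

end

noncomputable section

namespace SqFn

/-! ### Sums: a dichotomy -/

/-- Either one term and its neighbours dominate the sum, or two separated terms do. -/
theorem sum_rpow_le_broad_narrow {K : ℕ} (hK : 1 ≤ K) (x : ℕ → ENNReal) :
    (∑ c ∈ Finset.range K, x c) ^ (10 / 3 : ℝ) ≤
      256 * ∑ c ∈ Finset.range K, x c ^ (10 / 3 : ℝ) +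
      (K : ENNReal) ^ 5 * ∑ c ∈ Finset.range K, ∑ c' ∈ Finset.range K,
        if c + 2 ≤ c' then (x c * x c') ^ (5 / 3 : ℝ) else 0 := by
  obtain ⟨m, hm, hmax⟩ := Finset.exists_max_image (Finset.range K) x ⟨0, Finset.mem_range.2 hK⟩
  have hK0 : (K : ENNReal) ≠ 0 := by exact_mod_cast (by omega : K ≠ 0)
  have hKt : (K : ENNReal) ≠ ⊤ := ENNReal.natCast_ne_top K
  -- Narrow case: the terms far from the largest add up to at most `x m` and the at most three near
  -- ones to `3 x m`; the constant is `4^{10/3} ≤ 256`, independent of `K`.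
  by_cases hA : ∀ c ∈ Finset.range K, (c + 2 ≤ m ∨ m + 2 ≤ c) → K * x c ≤ x m
  · have hsum : ∑ c ∈ Finset.range K, x c ≤ 4 * x m := by
      rw [← Finset.sum_filter_add_sum_filter_not (Finset.range K) fun c => c + 2 ≤ m ∨ m + 2 ≤ c]
      have h1 : ∑ c ∈ (Finset.range K).filter (fun c => c + 2 ≤ m ∨ m + 2 ≤ c), x c ≤ x m := by
        calc _ ≤ ∑ c ∈ (Finset.range K).filter (fun c => c + 2 ≤ m ∨ m + 2 ≤ c), x m / K :=
              Finset.sum_le_sum fun c hc => by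
                rw [Finset.mem_filter] at hc
                rw [ENNReal.le_div_iff_mul_le (Or.inl hK0) (Or.inl hKt), mul_comm]
                exact hA c hc.1 hc.2
          _ ≤ ∑ c ∈ Finset.range K, x m / K := Finset.sum_le_sum_of_subset (Finset.filter_subset _ _)
          _ = x m := by
              rw [Finset.sum_const, Finset.card_range, nsmul_eq_mul, ENNReal.mul_div_cancel hK0 hKt]
      have h2 : ∑ c ∈ (Finset.range K).filter (fun c => ¬(c + 2 ≤ m ∨ m + 2 ≤ c)), x c ≤
          3 * x m := by
        have hsub : (Finset.range K).filter (fun c => ¬(c + 2 ≤ m ∨ m + 2 ≤ c)) ⊆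
            {m - 1, m, m + 1} := by
          intro c hc
          simp only [Finset.mem_filter, Finset.mem_insert, Finset.mem_singleton] at hc ⊢
          omega
        calc _ ≤ ((Finset.range K).filter (fun c => ¬(c + 2 ≤ m ∨ m + 2 ≤ c))).card • x m :=
              Finset.sum_le_card_nsmul _ _ _ fun c hc => hmax c (Finset.mem_of_mem_filter c hc)
          _ ≤ 3 * x m := by
              rw [nsmul_eq_mul]
              gcongr
              exact_mod_cast (Finset.card_le_card hsub).trans Finset.card_le_three
      calc _ ≤ x m + 3 * x m := add_le_add h1 h2
        _ = 4 * x m := by ring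
    refine le_trans ?_ le_self_add
    calc _ ≤ (4 * x m) ^ (10 / 3 : ℝ) := ENNReal.rpow_le_rpow hsum (by norm_num)
      _ = 4 ^ (10 / 3 : ℝ) * x m ^ (10 / 3 : ℝ) := ENNReal.mul_rpow_of_nonneg _ _ (by norm_num)
      _ ≤ 256 * ∑ c ∈ Finset.range K, x c ^ (10 / 3 : ℝ) := by
          gcongr
          · calc (4 : ENNReal) ^ (10 / 3 : ℝ) ≤ 4 ^ (4 : ℝ) :=
                  ENNReal.rpow_le_rpow_of_exponent_le (by norm_num) (by norm_num)
              _ = 256 := by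
                  rw [show (4 : ℝ) = ((4 : ℕ) : ℝ) by norm_num, ENNReal.rpow_natCast]; norm_num
          · exact Finset.single_le_sum (f := fun c => x c ^ (10 / 3 : ℝ))
              (fun _ _ => zero_le) hm
  · push Not at hA
    -- Broad case: the sum is at most `K x m` and `(x m)² ≤ K x m x c`, which costs `K^{10/3}
    -- K^{5/3} = K^5`.
    obtain ⟨c, hc, hfar, hlt⟩ := hA
    have hsum : ∑ c ∈ Finset.range K, x c ≤ K * x m := by
      calc _ ≤ (Finset.range K).card • x m := Finset.sum_le_card_nsmul _ _ _ hmax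
        _ = K * x m := by rw [Finset.card_range, nsmul_eq_mul]
    have hterm : (x m * x c) ^ (5 / 3 : ℝ) ≤ ∑ c ∈ Finset.range K, ∑ c' ∈ Finset.range K,
        if c + 2 ≤ c' then (x c * x c') ^ (5 / 3 : ℝ) else 0 := by
      have hpick : ∀ u ∈ Finset.range K, ∀ v ∈ Finset.range K, u + 2 ≤ v →
          (x u * x v) ^ (5 / 3 : ℝ) ≤ ∑ c ∈ Finset.range K, ∑ c' ∈ Finset.range K,
            if c + 2 ≤ c' then (x c * x c') ^ (5 / 3 : ℝ) else 0 := by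
        intro u hu v hv huv
        refine le_trans ?_ (Finset.single_le_sum (f := fun c => ∑ c' ∈ Finset.range K,
          if c + 2 ≤ c' then (x c * x c') ^ (5 / 3 : ℝ) else 0) (fun _ _ => zero_le) hu)
        refine le_trans ?_ (Finset.single_le_sum (f := fun c' =>
          if u + 2 ≤ c' then (x u * x c') ^ (5 / 3 : ℝ) else 0) (fun _ _ => zero_le) hv)
        simp [huv]
      rcases hfar with h | h
      · rw [mul_comm]; exact hpick c hc m hm h
      · exact hpick m hm c hc h
    refine le_trans ?_ le_add_self
    calc _ ≤ (K * x m) ^ (10 / 3 : ℝ) := ENNReal.rpow_le_rpow hsum (by norm_num)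
      _ = (K : ENNReal) ^ (10 / 3 : ℝ) * (x m * x m) ^ (5 / 3 : ℝ) := by
          rw [ENNReal.mul_rpow_of_nonneg _ _ (by norm_num), ← sq, ← ENNReal.rpow_natCast (x m),
            ← ENNReal.rpow_mul]
          norm_num
      _ ≤ (K : ENNReal) ^ (10 / 3 : ℝ) * (K * (x m * x c)) ^ (5 / 3 : ℝ) := by
          have h : x m * x m ≤ K * (x m * x c) :=
            calc x m * x m ≤ x m * (K * x c) := by gcongr
              _ = K * (x m * x c) := by ring
          gcongr
      _ = (K : ENNReal) ^ 5 * (x m * x c) ^ (5 / 3 : ℝ) := by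
          rw [ENNReal.mul_rpow_of_nonneg _ _ (by norm_num), ← mul_assoc,
            ← ENNReal.rpow_add _ _ hK0 hKt]
          norm_num
      _ ≤ _ := by gcongr

theorem sum_range_mul_add {α : Type*} [AddCommMonoid α] (g : ℕ → α) (m K : ℕ) :
    ∑ b ∈ Finset.range m, ∑ c ∈ Finset.range K, g (b * K + c) = ∑ i ∈ Finset.range (m * K), g i := by
  induction m with
  | zero => simp
  | succ m ih => rw [Finset.sum_range_succ, ih, Nat.succ_mul, Finset.sum_range_add]

theorem sum_rpow_le_rpow_sum {ι : Type*} (s : Finset ι) (x : ι → ENNReal) :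
    ∑ i ∈ s, x i ^ (5 / 3 : ℝ) ≤ (∑ i ∈ s, x i) ^ (5 / 3 : ℝ) := by
  classical
  induction s using Finset.induction_on with
  | empty => simp
  | insert i s hi ih =>
    rw [Finset.sum_insert hi, Finset.sum_insert hi]
    exact (add_le_add le_rfl ih).trans (ENNReal.add_rpow_le_rpow_add _ _ (by norm_num))

/-- Each step down in scale multiplies the number of blocks by `K` and the bound by `256`. The
number `W` caps the blocks at all scales, so that one error `E` serves for every step. -/
theorem le_of_recursion {A : ℕ → ℕ → ENNReal} {K W T : ℕ} (hK : 1 ≤ K) {E : ENNReal}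
    (h : ∀ s < T, ∀ m ≤ W, A (s + 1) m ≤ 256 * A s (m * K) + E) :
    ∀ t ≤ T, ∀ m, m * K ^ t ≤ W → A t m ≤ 256 ^ t * (A 0 (m * K ^ t) + t * E) := by
  intro t
  induction t with
  | zero => intro _ m _; simp
  | succ t ih =>
    intro ht m hm
    have hm1 : m * K * K ^ t ≤ W := by rw [mul_assoc, ← pow_succ']; exact hm
    have hmW : m ≤ W := le_trans (Nat.le_mul_of_pos_right m (by positivity)) hm
    calc A (t + 1) m ≤ 256 * A t (m * K) + E := h t (by omega) m hmW
      _ ≤ 256 * (256 ^ t * (A 0 (m * K * K ^ t) + t * E)) + 256 ^ (t + 1) * E := by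
          gcongr
          · exact ih (by omega) _ hm1
          · exact le_mul_of_one_le_left' (one_le_pow₀ (by norm_num))
      _ = 256 ^ (t + 1) * (A 0 (m * K ^ (t + 1)) + (t + 1 : ℕ) * E) := by
          rw [mul_assoc m, ← pow_succ']
          push_cast
          ring

/-! ### Blocks of sectors -/

namespace SectorDecomposition

variable {lam M : ℝ} {C : ℕ → ℝ}

theorem sum_sum_block {α : Type*} [AddCommMonoid α] (D : SectorDecomposition lam M C) (L : ℕ) (i : ℕ)
    (g : Fin D.n → α) (m : ℕ) :
    ∑ b ∈ Finset.range m, ∑ ν ∈ D.block (i + b * L) L, g ν = ∑ ν ∈ D.block i (m * L), g ν := by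
  induction m with
  | zero =>
    have : D.block i (0 * L) = ∅ := by
      ext ν
      simp only [mem_block, Finset.notMem_empty, iff_false]
      omega
    rw [this]; simp
  | succ m ih =>
    rw [Finset.sum_range_succ, ih, ← Finset.sum_union]
    · refine Finset.sum_congr ?_ fun _ _ => rfl
      ext ν
      simp only [Finset.mem_union, mem_block, Nat.succ_mul]
      omega
    · rw [Finset.disjoint_left]
      intro ν h1 h2
      rw [mem_block] at h1 h2
      omega

theorem block_zero_of_le (D : SectorDecomposition lam M C) {L : ℕ} (h : D.n ≤ L) :
    D.block 0 L = Finset.univ := by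
  ext ν
  simp only [mem_block, Finset.mem_univ, iff_true]
  omega

theorem card_block_le (D : SectorDecomposition lam M C) (i L : ℕ) : (D.block i L).card ≤ L := by
  calc (D.block i L).card = ((D.block i L).map Fin.valEmbedding).card := (Finset.card_map _).symm
    _ ≤ (Finset.Ico i (i + L)).card := Finset.card_le_card fun x hx => by
        obtain ⟨ν, hν, rfl⟩ := Finset.mem_map.1 hx
        exact Finset.mem_Ico.2 (D.mem_block.1 hν)
    _ = L := by simp

/-- Cauchy–Schwarz for the sum over `Ω`. -/
theorem part_rpow_le (D : SectorDecomposition lam M C) (φ : E3 → E2 → ℝ) (a : E3 → E2 → ℂ)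
    (Ω : Finset (Fin D.n)) (f : E2 → ℂ) (z : E3) :
    ‖D.part φ a Ω f z‖ₑ ^ (10 / 3 : ℝ) ≤
      (Ω.card : ENNReal) ^ (5 / 3 : ℝ) * D.sqSum φ a Ω f z ^ (5 / 3 : ℝ) := by
  have h2 : ‖D.part φ a Ω f z‖ₑ ^ 2 ≤ Ω.card * D.sqSum φ a Ω f z := by
    have h1 : ‖D.part φ a Ω f z‖ₑ ≤ ∑ ν ∈ Ω, ‖osc φ (D.amp a ν) lam f z‖ₑ := enorm_sum_le _ _
    have h3 := ENNReal.rpow_sum_le_const_mul_sum_rpow Ω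
      (fun ν => ‖osc φ (D.amp a ν) lam f z‖ₑ) (p := 2) (by norm_num)
    have e : (2 : ℝ) - 1 = 1 := by norm_num
    rw [e, ENNReal.rpow_one] at h3
    simp only [ENNReal.rpow_two] at h3
    exact (pow_le_pow_left₀ zero_le h1 2).trans h3
  calc _ = (‖D.part φ a Ω f z‖ₑ ^ 2) ^ (5 / 3 : ℝ) := by
        rw [← ENNReal.rpow_two, ← ENNReal.rpow_mul]; norm_num
    _ ≤ _ := by
        rw [← ENNReal.mul_rpow_of_nonneg _ _ (by norm_num)]
        exact ENNReal.rpow_le_rpow h2 (by norm_num)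

/-- The sectors fill an angle less than `π ≤ 4`, and each has aperture at least `λ^{-1/2}/M`. -/
theorem n_le (hM : 0 < M) (hlam : 1 ≤ lam) (D : SectorDecomposition lam M C) :
    (D.n : ℝ) ≤ 4 * M * lam ^ (1 / 2 : ℝ) := by
  have h := (D.ang_sub_bounds' (Fin.zero_le (Fin.last D.n))).1
  have h1 := (D.ang_mem 0).1
  have h2 := (D.ang_mem (Fin.last D.n)).2
  have hpi := Real.pi_le_four
  rw [Fin.val_last, Fin.val_zero, Nat.cast_zero, sub_zero] at h
  have h3 : M⁻¹ * lam ^ (-(1 / 2) : ℝ) * D.n ≤ 4 := by linarith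
  have h4 : lam ^ (-(1 / 2) : ℝ) * lam ^ (1 / 2 : ℝ) = 1 := by
    rw [← Real.rpow_add (by linarith)]; norm_num
  calc (D.n : ℝ) = (M⁻¹ * lam ^ (-(1 / 2) : ℝ) * D.n) * (M * lam ^ (1 / 2 : ℝ)) := by
        calc (D.n : ℝ) = (M⁻¹ * M) * (lam ^ (-(1 / 2) : ℝ) * lam ^ (1 / 2 : ℝ)) * D.n := by
              rw [h4, inv_mul_cancel₀ hM.ne', one_mul, one_mul]
          _ = _ := by ring
    _ ≤ 4 * (M * lam ^ (1 / 2 : ℝ)) := by gcongr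
    _ = _ := by ring

end SectorDecomposition

end SqFn

end

noncomputable section

namespace SqFn

/-! ### The full operator as a sum of its pieces -/

namespace SectorDecomposition

variable {lam M : ℝ} {C : ℕ → ℝ}

theorem abs_χ_le (D : SectorDecomposition lam M C) (ν : Fin D.n) {η : E2} (hη : η ≠ 0) :
    |D.χ ν η| ≤ C 0 := by
  have hn : 0 < ‖η‖ := norm_pos_iff.2 hη
  have h := D.χ_bound ν 0 (‖η‖⁻¹ • η) (by rw [norm_smul, norm_inv, norm_norm]; field_simp)
  rw [norm_iteratedFDeriv_zero, D.χ_homogeneous ν η hη _ (by positivity)] at h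
  simpa using h

/-- Integral and sum may be exchanged because each piece converges: `f` is integrable on the bounded
frequency support and the kernel is bounded. -/
theorem osc_eq_part {φ : E3 → E2 → ℝ} {P : E3 × ℝ → ℝ} {Z : ℝ × E3 → E3} {r₁ σ₁ κ : ℝ} {w₁ : E3}
    (hn : IsNormalized φ P Z r₁ σ₁ κ w₁) {ε₀ : ℝ} {a : E3 → E2 → ℂ} (ha : IsLocalAmplitude ε₀ a)
    (hε₀ : ε₀ ≤ 1 / 2) (hε₀σ : 2 * ε₀ ≤ σ₁) (D : SectorDecomposition lam M C) (hD : D.IsPartition a)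
    {f : E2 → ℂ} (hf : MemLp f (10 / 3) volume) (z : E3) :
    osc φ a lam f z = D.part φ a Finset.univ f z := by
  obtain ⟨A, hA⟩ : ∃ A : ℝ, ∀ η, ‖a z η‖ ≤ A := by
    have hc : Continuous (a z) := ha.smooth.continuous.comp (by fun_prop : Continuous fun η => (z, η))
    refine hc.bounded_above_of_compact_support ?_
    refine HasCompactSupport.of_support_subset_isCompact (isCompact_closedBall e₂ ε₀) fun η hη => ?_
    rw [mem_closedBall_iff_norm]
    exact (ha.support z η hη).2.le
  have hinteg : ∀ ν, Integrable fun η =>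
      Complex.exp (Complex.I * ((lam * φ z η : ℝ) : ℂ)) * D.amp a ν z η * f η := by
    intro ν
    have hloc : Integrable ((Metric.closedBall e₂ ε₀).indicator f) := by
      rw [integrable_indicator_iff Metric.isClosed_closedBall.measurableSet]
      have : IsFiniteMeasure (volume.restrict (Metric.closedBall e₂ ε₀)) :=
        ⟨by rw [Measure.restrict_apply_univ]; exact measure_closedBall_lt_top⟩
      refine (hf.restrict _).integrable ?_
      rw [ENNReal.le_div_iff_mul_le (by simp) (by simp)]
      norm_num
    have hmeas : Measurable fun η =>
        Complex.exp (Complex.I * ((lam * φ z η : ℝ) : ℂ)) * ((D.χ ν η : ℂ) * a z η) :=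
      (measurable_kernel hn ha hε₀ hε₀σ (D.measurable_χ ν) lam).comp
        (measurable_const.prodMk measurable_id : Measurable fun η : E2 => (z, η))
    have hbdd := hloc.bdd_mul (c := |C 0| * A) hmeas.aestronglyMeasurable (.of_forall fun η => by
      have hA0 : 0 ≤ A := (norm_nonneg _).trans (hA η)
      rw [norm_mul, mul_comm Complex.I, Complex.norm_exp_ofReal_mul_I, one_mul, norm_mul]
      by_cases h0 : a z η = 0
      · rw [h0, norm_zero, mul_zero]; positivity
      have hη : η ≠ 0 := fun h => by
        have := (ha.freq hε₀ h0).1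
        rw [h] at this
        norm_num at this
      gcongr
      · rw [Complex.norm_real, Real.norm_eq_abs]
        exact (D.abs_χ_le ν hη).trans (le_abs_self _)
      · exact hA η)
    refine hbdd.congr (.of_forall fun η => ?_)
    by_cases h0 : a z η = 0
    · simp [amp, h0]
    · have hmem : η ∈ Metric.closedBall e₂ ε₀ :=
        mem_closedBall_iff_norm.2 (ha.support z η h0).2.le
      simp only [indicator_of_mem hmem]
      rfl
  unfold part osc
  rw [← integral_finsetSum _ fun ν _ => hinteg ν]
  congr 1; ext η
  by_cases h0 : a z η = 0
  · simp [amp, h0]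
  · have hsum : ∑ ν, (D.χ ν η : ℂ) = 1 := by exact_mod_cast hD z η h0
    rw [← Finset.sum_mul, ← Finset.mul_sum]
    simp only [amp]
    rw [← Finset.sum_mul, hsum, one_mul]

/-! ### One step of the induction on scales -/

/-- Disjoint blocks recombine without loss because `5/3 ≥ 1` makes the power superadditive. -/
theorem sum_sqSum_block_le (D : SectorDecomposition lam M C) (φ : E3 → E2 → ℝ) (a : E3 → E2 → ℂ)
    (f : E2 → ℂ) (hms : ∀ Ω, Measurable (D.sqSum φ a Ω f)) (L m : ℕ) :
    ∑ b ∈ Finset.range m, ∫⁻ z, D.sqSum φ a (D.block (b * L) L) f z ^ (5 / 3 : ℝ) ≤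
      ∫⁻ z, D.sqSum φ a Finset.univ f z ^ (5 / 3 : ℝ) := by
  rw [← lintegral_finsetSum _ fun b _ => (hms _).pow_const _]
  refine lintegral_mono fun z => ?_
  refine (sum_rpow_le_rpow_sum _ _).trans (ENNReal.rpow_le_rpow ?_ (by norm_num))
  have := D.sum_sum_block L 0 (fun ν => ‖osc φ (D.amp a ν) lam f z‖ₑ ^ 2) m
  simp only [zero_add] at this
  exact this.le.trans (Finset.sum_le_sum_of_subset (Finset.subset_univ _))

/-- The broad–narrow dichotomy is integrated on each block and summed. The power `K^7` is `K^5` from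
the dichotomy times the number `K²` of pairs. -/
theorem sum_block_step (D : SectorDecomposition lam M C) (φ : E3 → E2 → ℝ) (a : E3 → E2 → ℂ)
    (f : E2 → ℂ) (hmp : ∀ Ω, Measurable (D.part φ a Ω f))
    (hms : ∀ Ω, Measurable (D.sqSum φ a Ω f)) {K L : ℕ} (hK : 1 ≤ K) {X Y : ENNReal}
    (hpair : ∀ b : ℕ, ∀ Ω Ω' : Finset (Fin D.n), Ω ⊆ D.block (b * (K * L)) (K * L) →
      Ω' ⊆ D.block (b * (K * L)) (K * L) →
      (∀ ν ∈ Ω, ∀ ν' ∈ Ω', ((ν : ℕ) + 1) * K + K * L ≤ ν' * K) →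
      ∫⁻ z, (‖D.part φ a Ω f z‖ₑ * ‖D.part φ a Ω' f z‖ₑ) ^ (5 / 3 : ℝ) ≤
        X * (∫⁻ z, D.sqSum φ a (D.block (b * (K * L)) (K * L)) f z ^ (5 / 3 : ℝ)) + Y)
    {m W : ℕ} (hm : m ≤ W) :
    ∑ b ∈ Finset.range m, ∫⁻ z, ‖D.part φ a (D.block (b * (K * L)) (K * L)) f z‖ₑ ^ (10 / 3 : ℝ) ≤
      256 * (∑ i ∈ Finset.range (m * K), ∫⁻ z, ‖D.part φ a (D.block (i * L) L) f z‖ₑ ^ (10 / 3 : ℝ)) +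
      (K : ENNReal) ^ 7 * (X * (∫⁻ z, D.sqSum φ a Finset.univ f z ^ (5 / 3 : ℝ)) + W * Y) := by
  have hone : ∀ b, ∫⁻ z, ‖D.part φ a (D.block (b * (K * L)) (K * L)) f z‖ₑ ^ (10 / 3 : ℝ) ≤
      256 * (∑ c ∈ Finset.range K,
        ∫⁻ z, ‖D.part φ a (D.block ((b * K + c) * L) L) f z‖ₑ ^ (10 / 3 : ℝ)) +
      (K : ENNReal) ^ 7 * (X *
        (∫⁻ z, D.sqSum φ a (D.block (b * (K * L)) (K * L)) f z ^ (5 / 3 : ℝ)) + Y) := by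
    intro b
    set x : ℕ → E3 → ENNReal := fun c z => ‖D.part φ a (D.block ((b * K + c) * L) L) f z‖ₑ with hx
    have hxm : ∀ c, Measurable (x c) := fun c => (hmp _).enorm
    have hidx : ∀ c, (b * K + c) * L = b * (K * L) + c * L := fun c => by ring
    have hsplit : ∀ z, ‖D.part φ a (D.block (b * (K * L)) (K * L)) f z‖ₑ ≤
        ∑ c ∈ Finset.range K, x c z := by
      intro z
      have := D.sum_sum_block L (b * (K * L)) (fun ν => osc φ (D.amp a ν) lam f z) K
      rw [part, ← this]
      refine (enorm_sum_le _ _).trans (le_of_eq (Finset.sum_congr rfl fun c _ => ?_))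
      rw [hx, ← hidx]; rfl
    have hpt : ∀ z, ‖D.part φ a (D.block (b * (K * L)) (K * L)) f z‖ₑ ^ (10 / 3 : ℝ) ≤
        256 * (∑ c ∈ Finset.range K, x c z ^ (10 / 3 : ℝ)) +
        (K : ENNReal) ^ 5 * (∑ c ∈ Finset.range K, ∑ c' ∈ Finset.range K,
          if c + 2 ≤ c' then (x c z * x c' z) ^ (5 / 3 : ℝ) else 0) := fun z =>
      (ENNReal.rpow_le_rpow (hsplit z) (by norm_num)).trans
        (sum_rpow_le_broad_narrow hK fun c => x c z)
    have hm1 : ∀ c, Measurable fun z => x c z ^ (10 / 3 : ℝ) := fun c => (hxm c).pow_const _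
    have hm2 : ∀ c c', Measurable fun z =>
        if c + 2 ≤ c' then (x c z * x c' z) ^ (5 / 3 : ℝ) else 0 := by
      intro c c'
      by_cases h : c + 2 ≤ c'
      · simp only [h, if_true]; exact ((hxm c).mul (hxm c')).pow_const _
      · simp only [h, if_false]; exact measurable_const
    have hm3 : ∀ c, Measurable fun z => ∑ c' ∈ Finset.range K,
        if c + 2 ≤ c' then (x c z * x c' z) ^ (5 / 3 : ℝ) else 0 := fun c =>
      Finset.measurable_sum _ fun c' _ => hm2 c c'
    have hsub : ∀ c < K, D.block ((b * K + c) * L) L ⊆ D.block (b * (K * L)) (K * L) := by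
      intro c hc ν hν
      rw [mem_block, hidx] at hν
      rw [mem_block]
      have : c * L + L ≤ K * L := by
        rw [← Nat.succ_mul]; exact Nat.mul_le_mul_right _ hc
      omega
    set R := X * (∫⁻ z, D.sqSum φ a (D.block (b * (K * L)) (K * L)) f z ^ (5 / 3 : ℝ)) + Y with hR
    have hterm : ∀ c ∈ Finset.range K, ∀ c' ∈ Finset.range K,
        ∫⁻ z, (if c + 2 ≤ c' then (x c z * x c' z) ^ (5 / 3 : ℝ) else 0) ≤ R := by
      intro c hc c' hc'
      by_cases h : c + 2 ≤ c'
      · simp only [h, if_true]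
        refine hpair b _ _ (hsub c (Finset.mem_range.1 hc)) (hsub c' (Finset.mem_range.1 hc')) ?_
        intro ν hν ν' hν'
        rw [mem_block, hidx] at hν hν'
        -- Non-adjacent sub-blocks leave a whole sub-block of `L` sectors between them, that is, the
        -- fraction `1/K` of the block.
        have h1 : (c + 2) * L ≤ c' * L := Nat.mul_le_mul_right _ h
        have h2 : (ν : ℕ) + 1 + L ≤ ν' := by
          rw [add_mul] at h1; omega
        calc ((ν : ℕ) + 1) * K + K * L = (ν + 1 + L) * K := by ring
          _ ≤ ν' * K := Nat.mul_le_mul_right _ h2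
      · simp [h]
    calc _ ≤ ∫⁻ z, (256 * (∑ c ∈ Finset.range K, x c z ^ (10 / 3 : ℝ)) +
        (K : ENNReal) ^ 5 * (∑ c ∈ Finset.range K, ∑ c' ∈ Finset.range K,
          if c + 2 ≤ c' then (x c z * x c' z) ^ (5 / 3 : ℝ) else 0)) := lintegral_mono hpt
      _ = 256 * (∑ c ∈ Finset.range K, ∫⁻ z, x c z ^ (10 / 3 : ℝ)) +
        (K : ENNReal) ^ 5 * (∑ c ∈ Finset.range K, ∑ c' ∈ Finset.range K,
          ∫⁻ z, if c + 2 ≤ c' then (x c z * x c' z) ^ (5 / 3 : ℝ) else 0) := by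
        rw [lintegral_add_left ((Finset.measurable_sum _ fun c _ => hm1 c).const_mul _),
          lintegral_const_mul _ (Finset.measurable_sum _ fun c _ => hm1 c),
          lintegral_const_mul _ (Finset.measurable_sum _ fun c _ => hm3 c),
          lintegral_finsetSum _ fun c _ => hm1 c, lintegral_finsetSum _ fun c _ => hm3 c]
        congr 2
        refine Finset.sum_congr rfl fun c _ => ?_
        rw [lintegral_finsetSum _ fun c' _ => hm2 c c']
      _ ≤ 256 * (∑ c ∈ Finset.range K, ∫⁻ z, x c z ^ (10 / 3 : ℝ)) +
        (K : ENNReal) ^ 5 * (∑ c ∈ Finset.range K, ∑ c' ∈ Finset.range K, R) := by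
        gcongr with c hc c' hc'
        exact hterm c hc c' hc'
      _ = _ := by
        simp only [Finset.sum_const, Finset.card_range, nsmul_eq_mul]
        ring
  calc _ ≤ ∑ b ∈ Finset.range m, _ := Finset.sum_le_sum fun b _ => hone b
    _ = 256 * (∑ b ∈ Finset.range m, ∑ c ∈ Finset.range K,
          ∫⁻ z, ‖D.part φ a (D.block ((b * K + c) * L) L) f z‖ₑ ^ (10 / 3 : ℝ)) +
        (K : ENNReal) ^ 7 * (X * (∑ b ∈ Finset.range m,
          ∫⁻ z, D.sqSum φ a (D.block (b * (K * L)) (K * L)) f z ^ (5 / 3 : ℝ)) + m * Y) := by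
        rw [Finset.sum_add_distrib, ← Finset.mul_sum, ← Finset.mul_sum, Finset.sum_add_distrib,
          ← Finset.mul_sum, Finset.sum_const, Finset.card_range, nsmul_eq_mul]
    _ ≤ _ := by
        rw [sum_range_mul_add (fun i =>
          ∫⁻ z, ‖D.part φ a (D.block (i * L) L) f z‖ₑ ^ (10 / 3 : ℝ)) m K]
        gcongr
        exact D.sum_sqSum_block_le φ a f hms (K * L) m

end SectorDecomposition

end SqFn

end

noncomputable section

namespace SqFn

/-! ### Induction on scales -/

/-- The bottom scale `K^J` is comparable to `λ^ε` and the top scale `K^{J+T}` to `d λ^{1/2}`; the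
hypothesis `h` makes the first fit below the second. -/
theorem exists_scales {K : ℕ} (hK : 2 ≤ K) {d ε lam : ℝ} (hlam : 1 ≤ lam) (hε : 0 < ε)
    (h : K / d ≤ lam ^ (1 / 2 - ε : ℝ)) (hd : 0 < d) :
    ∃ J T : ℕ, lam ^ ε ≤ (K : ℝ) ^ J ∧ (K : ℝ) ^ J ≤ K * lam ^ ε ∧
      (K : ℝ) ^ (J + T) ≤ d * lam ^ (1 / 2 : ℝ) ∧ d * lam ^ (1 / 2 : ℝ) ≤ K * (K : ℝ) ^ (J + T) := by
  have hK1 : (1 : ℝ) < K := by exact_mod_cast (by omega : 1 < K)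
  have hlε : 1 ≤ lam ^ ε := Real.one_le_rpow hlam hε.le
  have hd2 : K * lam ^ ε ≤ d * lam ^ (1 / 2 : ℝ) := by
    rw [div_le_iff₀ hd] at h
    calc K * lam ^ ε ≤ lam ^ (1 / 2 - ε : ℝ) * d * lam ^ ε := by gcongr
      _ = d * (lam ^ (1 / 2 - ε : ℝ) * lam ^ ε) := by ring
      _ = d * lam ^ (1 / 2 : ℝ) := by
          rw [← Real.rpow_add (by linarith)]; congr 2; ring
  obtain ⟨n, hn1, hn2⟩ := exists_nat_pow_near hlε hK1
  obtain ⟨m, hm1, hm2⟩ := exists_nat_pow_near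
    (by nlinarith : 1 ≤ d * lam ^ (1 / 2 : ℝ)) hK1
  have hnm : n + 1 ≤ m := by
    have h1 : (K : ℝ) ^ (n + 1) < (K : ℝ) ^ (m + 1) := by
      calc (K : ℝ) ^ (n + 1) = K * (K : ℝ) ^ n := by ring
        _ ≤ K * lam ^ ε := by gcongr
        _ < _ := hd2.trans_lt hm2
    have := (pow_lt_pow_iff_right₀ hK1).1 h1
    omega
  refine ⟨n + 1, m - (n + 1), hn2.le, ?_, ?_, ?_⟩
  · rw [pow_succ']; gcongr
  · rw [Nat.add_sub_cancel' hnm]; exact hm1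
  · rw [Nat.add_sub_cancel' hnm, ← pow_succ']; exact hm2.le

/-- The bound for the `p`-th powers in terms of the scales, before the choice of exponents. -/
theorem lintegral_part_le_of_scales {lam M : ℝ} {C : ℕ → ℝ} (D : SectorDecomposition lam M C)
    (φ : E3 → E2 → ℝ) (a : E3 → E2 → ℂ) (f : E2 → ℂ) (hmp : ∀ Ω, Measurable (D.part φ a Ω f))
    (hms : ∀ Ω, Measurable (D.sqSum φ a Ω f)) {K J T m : ℕ} (hK : 1 ≤ K)
    (hm : D.n ≤ m * K ^ (J + T)) {X Y : ENNReal}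
    (hpair : ∀ s < T, ∀ b : ℕ, ∀ Ω Ω' : Finset (Fin D.n),
      Ω ⊆ D.block (b * (K * K ^ (J + s))) (K * K ^ (J + s)) →
      Ω' ⊆ D.block (b * (K * K ^ (J + s))) (K * K ^ (J + s)) →
      (∀ ν ∈ Ω, ∀ ν' ∈ Ω', ((ν : ℕ) + 1) * K + K * K ^ (J + s) ≤ ν' * K) →
      ∫⁻ z, (‖D.part φ a Ω f z‖ₑ * ‖D.part φ a Ω' f z‖ₑ) ^ (5 / 3 : ℝ) ≤
        X * (∫⁻ z, D.sqSum φ a (D.block (b * (K * K ^ (J + s))) (K * K ^ (J + s))) f z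
          ^ (5 / 3 : ℝ)) + Y) :
    ∫⁻ z, ‖D.part φ a Finset.univ f z‖ₑ ^ (10 / 3 : ℝ) ≤
      (m : ENNReal) ^ (7 / 3 : ℝ) * (256 ^ T * (((K ^ J : ℕ) : ENNReal) ^ (5 / 3 : ℝ) *
        (∫⁻ z, D.sqSum φ a Finset.univ f z ^ (5 / 3 : ℝ)) + T * ((K : ENNReal) ^ 7 *
        (X * (∫⁻ z, D.sqSum φ a Finset.univ f z ^ (5 / 3 : ℝ)) + (m * K ^ T : ℕ) * Y)))) := by
  set A : ℕ → ℕ → ENNReal := fun s m => ∑ b ∈ Finset.range m,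
    ∫⁻ z, ‖D.part φ a (D.block (b * K ^ (J + s)) (K ^ (J + s))) f z‖ₑ ^ (10 / 3 : ℝ) with hA
  have hrec := le_of_recursion (A := A) (K := K) (W := m * K ^ T) (T := T) hK
    (E := (K : ENNReal) ^ 7 *
      (X * (∫⁻ z, D.sqSum φ a Finset.univ f z ^ (5 / 3 : ℝ)) + (m * K ^ T : ℕ) * Y))
    (fun s hs m' hm' => by
      have := D.sum_block_step φ a f hmp hms hK (hpair s hs) hm'
      simp only [hA]
      rw [← add_assoc, pow_succ']
      exact this) T le_rfl m le_rfl
  -- At the bottom scale Cauchy–Schwarz over the at most `K^J` sectors of a block suffices.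
  have hA0 : ∀ m', A 0 m' ≤ ((K ^ J : ℕ) : ENNReal) ^ (5 / 3 : ℝ) *
      ∫⁻ z, D.sqSum φ a Finset.univ f z ^ (5 / 3 : ℝ) := by
    intro m'
    calc A 0 m' ≤ ∑ b ∈ Finset.range m', ((K ^ J : ℕ) : ENNReal) ^ (5 / 3 : ℝ) *
          ∫⁻ z, D.sqSum φ a (D.block (b * K ^ J) (K ^ J)) f z ^ (5 / 3 : ℝ) := by
          refine Finset.sum_le_sum fun b _ => ?_
          rw [← lintegral_const_mul _ ((hms _).pow_const _)]
          refine lintegral_mono fun z => (D.part_rpow_le φ a _ f z).trans ?_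
          simp only [add_zero]
          gcongr
          exact D.card_block_le _ _
      _ ≤ _ := by
          rw [← Finset.mul_sum]
          gcongr
          exact D.sum_sqSum_block_le φ a f hms _ _
  -- At the top scale `m` blocks exhaust all sectors, and Hölder's inequality for the sum costs
  -- `m^{7/3}`.
  have htop : ∫⁻ z, ‖D.part φ a Finset.univ f z‖ₑ ^ (10 / 3 : ℝ) ≤
      (m : ENNReal) ^ (7 / 3 : ℝ) * A T m := by
    simp only [hA]
    rw [← lintegral_finsetSum _ fun b _ => (hmp _).enorm.pow_const _,
      ← lintegral_const_mul _ (Finset.measurable_sum _ fun b _ => (hmp _).enorm.pow_const _)]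
    refine lintegral_mono fun z => ?_
    have h1 : ‖D.part φ a Finset.univ f z‖ₑ ≤ ∑ b ∈ Finset.range m,
        ‖D.part φ a (D.block (b * K ^ (J + T)) (K ^ (J + T))) f z‖ₑ := by
      have := D.sum_sum_block (K ^ (J + T)) 0 (fun ν => osc φ (D.amp a ν) lam f z) m
      rw [D.block_zero_of_le hm] at this
      simp only [zero_add] at this
      rw [SectorDecomposition.part, ← this]
      exact enorm_sum_le _ _
    have h2 := ENNReal.rpow_sum_le_const_mul_sum_rpow (Finset.range m)
      (fun b => ‖D.part φ a (D.block (b * K ^ (J + T)) (K ^ (J + T))) f z‖ₑ) (p := 10 / 3)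
      (by norm_num)
    rw [Finset.card_range, show (10 / 3 : ℝ) - 1 = 7 / 3 by norm_num] at h2
    exact (ENNReal.rpow_le_rpow h1 (by norm_num)).trans h2
  refine htop.trans ?_
  gcongr
  refine hrec.trans ?_
  gcongr
  exact hA0 _

-- This fixes the scales and exponents in `lintegral_part_le_of_scales`. All losses are powers
-- `λ^{O(ε')}` or constants depending on `K`, `m` and `B`.
set_option maxHeartbeats 1000000 in
theorem exists_linear_rpow (hbil : BilinearSquareFunctionEstimate)
    {φ : E3 → E2 → ℝ} {P : E3 × ℝ → ℝ} {Z : ℝ × E3 → E3} {r₁ σ₁ κ : ℝ} {w₁ : E3}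
    (hn : IsNormalized φ P Z r₁ σ₁ κ w₁) {a : E3 → E2 → ℂ} (ha : IsLocalAmplitude (σ₁ / 64) a)
    {M : ℝ} (hM : 0 < M) (C : ℕ → ℝ) {ε : ℝ} (hε : 0 < ε) (N : ℕ) :
    ∃ c : ENNReal, c ≠ ⊤ ∧ ∀ lam : ℝ, 1 ≤ lam → ∀ D : SectorDecomposition lam M C,
      D.IsPartition a → ∀ f : E2 → ℂ, MemLp f (10 / 3) volume →
      ∫⁻ z, ‖D.part φ a Finset.univ f z‖ₑ ^ (10 / 3 : ℝ) ≤
        c * ENNReal.ofReal (lam ^ ((1 / 20 + ε) * (10 / 3) : ℝ)) *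
          (∫⁻ z, D.sqSum φ a Finset.univ f z ^ (5 / 3 : ℝ)) +
        c * ENNReal.ofReal (lam ^ (-(N : ℝ) * (10 / 3) : ℝ)) * ∫⁻ η, ‖f η‖ₑ ^ (10 / 3 : ℝ) := by
  have hσ₁ := hn.pos
  have hσ₁' := hn.le_one
  have hε₀ : σ₁ / 64 ≤ 1 / 2 := by linarith
  have hε₀σ : 2 * (σ₁ / 64) ≤ σ₁ := by linarith
  -- The losses total at most `(11/3) ε'`, to be covered by `(10/3) ε`. The cap `1/4` gives `2ε' +
  -- 1/2 ≤ 1` in the error term and keeps `1/2 - ε'` positive.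
  set ε' := min (ε / 2) (1 / 4) with hε'
  have hε'0 : 0 < ε' := by positivity
  have hε'1 : ε' ≤ ε / 2 := min_le_left _ _
  have hε'2 : ε' ≤ 1 / 4 := min_le_right _ _
  -- This makes `256 ≤ K^{2ε'}`, so that `T` steps with `K^T ≤ λ^{1/2}` lose at most `λ^{ε'}`.
  obtain ⟨K₀, hK₀⟩ := exists_nat_ge ((256 : ℝ) ^ (1 / (2 * ε')))
  set K := K₀ + 2 with hKdef
  have hK : 2 ≤ K := by omega
  have hKr : (256 : ℝ) ^ (1 / (2 * ε')) ≤ K := by rw [hKdef]; push_cast; linarith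
  have hK256 : (256 : ℝ) ≤ (K : ℝ) ^ (2 * ε') := by
    calc (256 : ℝ) = ((256 : ℝ) ^ (1 / (2 * ε'))) ^ (2 * ε') := by
          rw [← Real.rpow_mul (by norm_num)]; field_simp; norm_num
      _ ≤ _ := by gcongr
  -- The errors `(L²)^{-N'} ≤ λ^{-2ε'N'}` must beat `λ^{-10N/3}` after summation over `O(λ^{1/2})`
  -- blocks and multiplication by `λ^{2ε'}`.
  obtain ⟨N', hN'⟩ := exists_nat_ge ((10 * N / 3 + 1) / (2 * ε'))
  rw [div_le_iff₀ (by positivity)] at hN'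
  obtain ⟨d, hd, hd1, B, hB, hblock⟩ :=
    exists_bilinear_block hbil hn ha hM C (by omega : 1 ≤ K) hε'0 N'
  obtain ⟨m, hm⟩ := exists_nat_ge (4 * M * K / d)
  -- The first condition yields `4 M² K ≤ K^{J+1} ≤ L` at every scale; the second is the room
  -- required by `exists_scales`.
  obtain ⟨lam₀, hlam₀⟩ : ∃ lam₀ : ℝ, ∀ lam ≥ lam₀,
      4 * M ^ 2 ≤ lam ^ ε' ∧ K / d ≤ lam ^ (1 / 2 - ε' : ℝ) :=
    Filter.eventually_atTop.1
      (((tendsto_rpow_atTop hε'0).eventually_ge_atTop _).and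
        ((tendsto_rpow_atTop (by linarith : 0 < 1 / 2 - ε')).eventually_ge_atTop _))
  set c₁ : ENNReal := ENNReal.ofReal ((4 * M * (max lam₀ 1) ^ (1 / 2 : ℝ)) ^ (5 / 3 : ℝ)) with hc₁
  set c₂ : ENNReal := (m : ENNReal) ^ (7 / 3 : ℝ) *
    ((K : ENNReal) ^ (5 / 3 : ℝ) + (K : ENNReal) ^ 7 * ENNReal.ofReal B) with hc₂
  set c₃ : ENNReal := (m : ENNReal) ^ (7 / 3 : ℝ) * ((K : ENNReal) ^ 7 * (m * ENNReal.ofReal B))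
    with hc₃
  have hfin : c₁ + (c₂ + c₃) ≠ ⊤ := by
    have h1 : (m : ENNReal) ^ (7 / 3 : ℝ) ≠ ⊤ :=
      ENNReal.rpow_ne_top_of_nonneg (by norm_num) (ENNReal.natCast_ne_top m)
    have h2 : (K : ENNReal) ^ (5 / 3 : ℝ) ≠ ⊤ :=
      ENNReal.rpow_ne_top_of_nonneg (by norm_num) (ENNReal.natCast_ne_top K)
    have h3 : (K : ENNReal) ^ 7 ≠ ⊤ := ENNReal.pow_ne_top (ENNReal.natCast_ne_top K)
    have hB' : ENNReal.ofReal B ≠ ⊤ := ENNReal.ofReal_ne_top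
    refine ENNReal.add_ne_top.2 ⟨ENNReal.ofReal_ne_top, ENNReal.add_ne_top.2 ⟨?_, ?_⟩⟩
    · exact ENNReal.mul_ne_top h1 (ENNReal.add_ne_top.2 ⟨h2, ENNReal.mul_ne_top h3 hB'⟩)
    · exact ENNReal.mul_ne_top h1 (ENNReal.mul_ne_top h3
        (ENNReal.mul_ne_top (ENNReal.natCast_ne_top m) hB'))
  refine ⟨c₁ + (c₂ + c₃), hfin, ?_⟩
  intro lam hlam D hD f hf
  have hlam0 : 0 < lam := by linarith
  set Q := ∫⁻ z, D.sqSum φ a Finset.univ f z ^ (5 / 3 : ℝ) with hQ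
  set F := ∫⁻ η, ‖f η‖ₑ ^ (10 / 3 : ℝ) with hF
  have hmp : ∀ Θ, Measurable (D.part φ a Θ f) := fun Θ =>
    D.measurable_part hn ha hε₀ hε₀σ Θ hf.1
  have hms : ∀ Θ, Measurable (D.sqSum φ a Θ f) := fun Θ =>
    D.measurable_sqSum hn ha hε₀ hε₀σ Θ hf.1
  have hn_le := D.n_le hM hlam
  -- For bounded `λ` there are boundedly many sectors, and Cauchy–Schwarz is enough.
  rcases lt_or_ge lam lam₀ with hsmall | hlarge
  · have h1 : ∫⁻ z, ‖D.part φ a Finset.univ f z‖ₑ ^ (10 / 3 : ℝ) ≤ c₁ * Q := by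
      rw [hQ, ← lintegral_const_mul _ ((hms _).pow_const _)]
      refine lintegral_mono fun z => (D.part_rpow_le φ a _ f z).trans ?_
      gcongr
      rw [hc₁, ← ENNReal.ofReal_rpow_of_nonneg (by positivity) (by norm_num), Finset.card_univ,
        Fintype.card_fin, ← ENNReal.ofReal_natCast]
      gcongr
      refine hn_le.trans ?_
      gcongr
      exact hsmall.le.trans (le_max_left _ _)
    refine h1.trans (le_trans ?_ le_self_add)
    gcongr
    calc c₁ ≤ c₁ + (c₂ + c₃) := le_self_add
      _ ≤ _ := by
        refine le_mul_of_one_le_right' ?_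
        rw [ENNReal.one_le_ofReal]
        exact Real.one_le_rpow hlam (by positivity)
  obtain ⟨hl1, hl2⟩ := hlam₀ lam hlarge
  obtain ⟨J, T, hJ1, hJ2, hT1, hT2⟩ := exists_scales hK hlam hε'0 hl2 hd
  have hK1 : (1 : ℝ) ≤ K := by exact_mod_cast (by omega : 1 ≤ K)
  have hnm : D.n ≤ m * K ^ (J + T) := by
    have : (D.n : ℝ) ≤ m * (K : ℝ) ^ (J + T) := by
      calc (D.n : ℝ) ≤ 4 * M * lam ^ (1 / 2 : ℝ) := hn_le
        _ = 4 * M / d * (d * lam ^ (1 / 2 : ℝ)) := by field_simp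
        _ ≤ 4 * M / d * (K * (K : ℝ) ^ (J + T)) := by gcongr
        _ = 4 * M * K / d * (K : ℝ) ^ (J + T) := by ring
        _ ≤ _ := by gcongr
    exact_mod_cast this
  have hlamhalf : lam ^ (1 / 2 : ℝ) * lam ^ (-(1 / 2) : ℝ) = 1 := by
    rw [← Real.rpow_add hlam0]; norm_num
  have hJT : (K : ℝ) ^ (J + T) ≤ lam ^ (1 / 2 : ℝ) := by
    refine hT1.trans ?_
    have : 0 < lam ^ (1 / 2 : ℝ) := by positivity
    nlinarith
  have hmain := lintegral_part_le_of_scales D φ a f hmp hms (by omega : 1 ≤ K) hnm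
    (X := ENNReal.ofReal (B * lam ^ ((1 / 10 + ε') * (5 / 3) : ℝ)))
    (Y := ENNReal.ofReal (B * lam ^ (-(2 * ε' * N') : ℝ)) * F)
    (fun s hs b Ω Ω' hΩ hΩ' hsep => by
      have hLcast : ((K * K ^ (J + s) : ℕ) : ℝ) = (K : ℝ) ^ (J + s + 1) := by push_cast; ring
      have hLle : ((K * K ^ (J + s) : ℕ) : ℝ) ≤ d * lam ^ (1 / 2 : ℝ) := by
        rw [hLcast]
        refine le_trans (pow_le_pow_right₀ hK1 (by omega)) hT1
      have hLge : (K : ℝ) ^ J * K ≤ ((K * K ^ (J + s) : ℕ) : ℝ) := by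
        rw [hLcast, ← pow_succ]
        exact pow_le_pow_right₀ hK1 (by omega)
      have hLge' : lam ^ ε' ≤ ((K * K ^ (J + s) : ℕ) : ℝ) := by
        refine hJ1.trans (le_trans ?_ hLge)
        exact le_mul_of_one_le_right (by positivity) hK1
      have hpos : 0 < ((K * K ^ (J + s) : ℕ) : ℝ) := lt_of_lt_of_le (by positivity) hLge'
      refine (hblock lam hlam D hD _ _ (by exact_mod_cast hpos) ?_ ?_ Ω Ω' hΩ hΩ' hsep f hf).trans ?_
      · refine le_trans ?_ hLge
        gcongr
        exact hl1.trans hJ1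
      · calc _ ≤ d * lam ^ (1 / 2 : ℝ) * lam ^ (-(1 / 2) : ℝ) := by gcongr
          _ = d := by rw [mul_assoc, hlamhalf, mul_one]
      · have h1 : ((K * K ^ (J + s) : ℕ) : ℝ) ^ 2 ≤ lam := by
          calc _ ≤ (lam ^ (1 / 2 : ℝ)) ^ 2 := by
                gcongr
                refine hLle.trans ?_
                have : 0 < lam ^ (1 / 2 : ℝ) := by positivity
                nlinarith
            _ = lam := by
                rw [← Real.rpow_natCast, ← Real.rpow_mul hlam0.le]; norm_num
        have h2 : lam ^ (2 * ε') ≤ ((K * K ^ (J + s) : ℕ) : ℝ) ^ 2 := by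
          calc lam ^ (2 * ε') = (lam ^ ε') ^ 2 := by
                rw [← Real.rpow_natCast, ← Real.rpow_mul hlam0.le]; congr 1; push_cast; ring
            _ ≤ _ := by gcongr
        have h3 : (((K * K ^ (J + s) : ℕ) : ℝ) ^ 2) ^ (-(N' : ℝ)) ≤ lam ^ (-(2 * ε' * N') : ℝ) := by
          calc _ ≤ (lam ^ (2 * ε')) ^ (-(N' : ℝ)) :=
                Real.rpow_le_rpow_of_nonpos (by positivity) h2 (by simp)
            _ = _ := by rw [← Real.rpow_mul hlam0.le]; congr 1; ring
        gcongr)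
  refine hmain.trans ?_
  set ℓ : ℝ → ENNReal := fun s => ENNReal.ofReal (lam ^ s) with hℓ
  have hadd : ∀ s t, ℓ s * ℓ t = ℓ (s + t) := fun s t => by
    simp only [hℓ]
    rw [← ENNReal.ofReal_mul (by positivity), ← Real.rpow_add hlam0]
  have hmono : ∀ {s t}, s ≤ t → ℓ s ≤ ℓ t := fun h =>
    ENNReal.ofReal_le_ofReal (Real.rpow_le_rpow_of_exponent_le hlam h)
  have hK0 : (0 : ℝ) ≤ K := by positivity
  have h256r : (256 : ℝ) ^ T ≤ lam ^ ε' := by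
    calc (256 : ℝ) ^ T ≤ ((K : ℝ) ^ (2 * ε')) ^ T := by gcongr
      _ = ((K : ℝ) ^ T) ^ (2 * ε') := by
          rw [← Real.rpow_natCast, ← Real.rpow_natCast, ← Real.rpow_mul hK0, ← Real.rpow_mul hK0,
            mul_comm]
      _ ≤ (lam ^ (1 / 2 : ℝ)) ^ (2 * ε') := by
          gcongr
          exact (pow_le_pow_right₀ hK1 (by omega)).trans hJT
      _ = lam ^ ε' := by rw [← Real.rpow_mul hlam0.le]; congr 1; ring
  have h256 : (256 : ENNReal) ^ T ≤ ℓ ε' := by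
    have : (256 : ENNReal) ^ T = ENNReal.ofReal ((256 : ℝ) ^ T) := by
      rw [ENNReal.ofReal_pow (by norm_num)]; norm_num
    rw [this]
    exact ENNReal.ofReal_le_ofReal h256r
  -- The number of steps is absorbed through `T < 256^T`.
  have hTle : (T : ENNReal) ≤ ℓ ε' := by
    refine le_trans ?_ h256
    exact_mod_cast (Nat.lt_pow_self (by norm_num : 1 < 256)).le
  have hKJ : ((K ^ J : ℕ) : ENNReal) ^ (5 / 3 : ℝ) ≤ (K : ENNReal) ^ (5 / 3 : ℝ) * ℓ (5 / 3 * ε') := by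
    calc ((K ^ J : ℕ) : ENNReal) ^ (5 / 3 : ℝ) ≤ (K * ℓ ε') ^ (5 / 3 : ℝ) := by
          gcongr
          rw [← ENNReal.ofReal_natCast, ← ENNReal.ofReal_natCast, hℓ,
            ← ENNReal.ofReal_mul (by positivity)]
          refine ENNReal.ofReal_le_ofReal ?_
          push_cast
          exact hJ2
      _ = _ := by
          rw [ENNReal.mul_rpow_of_nonneg _ _ (by norm_num)]
          simp only [hℓ]
          rw [ENNReal.ofReal_rpow_of_nonneg (by positivity) (by norm_num),
            ← Real.rpow_mul hlam0.le, mul_comm ε']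
  have hW : ((m * K ^ T : ℕ) : ENNReal) ≤ m * ℓ (1 / 2) := by
    rw [Nat.cast_mul]
    gcongr
    rw [← ENNReal.ofReal_natCast]
    refine ENNReal.ofReal_le_ofReal ?_
    push_cast
    exact (pow_le_pow_right₀ hK1 (by omega)).trans hJT
  have hX : ENNReal.ofReal (B * lam ^ ((1 / 10 + ε') * (5 / 3) : ℝ)) =
      ENNReal.ofReal B * ℓ ((1 / 10 + ε') * (5 / 3)) := ENNReal.ofReal_mul hB
  have hY : ENNReal.ofReal (B * lam ^ (-(2 * ε' * N') : ℝ)) =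
      ENNReal.ofReal B * ℓ (-(2 * ε' * N')) := ENNReal.ofReal_mul hB
  rw [hX, hY]
  have e1 : ℓ ε' * ℓ (5 / 3 * ε') ≤ ℓ ((1 / 20 + ε) * (10 / 3)) := by
    rw [hadd]; exact hmono (by linarith)
  have e2 : ℓ ε' * (ℓ ε' * ℓ ((1 / 10 + ε') * (5 / 3))) ≤ ℓ ((1 / 20 + ε) * (10 / 3)) := by
    rw [hadd, hadd]; exact hmono (by linarith)
  have e3 : ℓ ε' * (ℓ ε' * (ℓ (1 / 2) * ℓ (-(2 * ε' * N')))) ≤ ℓ (-(N : ℝ) * (10 / 3)) := by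
    rw [hadd, hadd, hadd]; exact hmono (by linarith)
  calc _ ≤ (m : ENNReal) ^ (7 / 3 : ℝ) * (ℓ ε' * ((K : ENNReal) ^ (5 / 3 : ℝ) * ℓ (5 / 3 * ε') * Q +
        ℓ ε' * ((K : ENNReal) ^ 7 * (ENNReal.ofReal B * ℓ ((1 / 10 + ε') * (5 / 3)) * Q +
          m * ℓ (1 / 2) * (ENNReal.ofReal B * ℓ (-(2 * ε' * N')) * F))))) := by gcongr
    _ = (m : ENNReal) ^ (7 / 3 : ℝ) * ((K : ENNReal) ^ (5 / 3 : ℝ) * (ℓ ε' * ℓ (5 / 3 * ε')) +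
        (K : ENNReal) ^ 7 * ENNReal.ofReal B * (ℓ ε' * (ℓ ε' * ℓ ((1 / 10 + ε') * (5 / 3))))) * Q +
        c₃ * (ℓ ε' * (ℓ ε' * (ℓ (1 / 2) * ℓ (-(2 * ε' * N'))))) * F := by
          rw [hc₃]; ring
    _ ≤ (m : ENNReal) ^ (7 / 3 : ℝ) * ((K : ENNReal) ^ (5 / 3 : ℝ) * ℓ ((1 / 20 + ε) * (10 / 3)) +
        (K : ENNReal) ^ 7 * ENNReal.ofReal B * ℓ ((1 / 20 + ε) * (10 / 3))) * Q +
        c₃ * ℓ (-(N : ℝ) * (10 / 3)) * F := by gcongr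
    _ = c₂ * ℓ ((1 / 20 + ε) * (10 / 3)) * Q + c₃ * ℓ (-(N : ℝ) * (10 / 3)) * F := by
          rw [hc₂]; ring
    _ ≤ _ := by
          gcongr
          · exact le_add_self.trans' le_self_add
          · exact le_add_self.trans' le_add_self

/-- Take the `3/10`-th power, which is subadditive, of the bound for the `10/3`-th powers. -/
theorem squareFunctionEstimate_of_isNormalized (hbil : BilinearSquareFunctionEstimate)
    {φ : E3 → E2 → ℝ} {P : E3 × ℝ → ℝ} {Z : ℝ × E3 → E3} {r₁ σ₁ κ : ℝ} {w₁ : E3}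
    (hn : IsNormalized φ P Z r₁ σ₁ κ w₁) {a : E3 → E2 → ℂ} (ha : IsLocalAmplitude (σ₁ / 64) a) :
    SquareFunctionEstimate φ a := by
  intro M C hM ε hε N
  obtain ⟨c, hc, h⟩ := exists_linear_rpow hbil hn ha hM C hε N
  have hσ₁ := hn.pos
  have hσ₁' := hn.le_one
  refine ⟨(c ^ (3 / 10 : ℝ)).toReal, fun lam hlam D hD f hf => ?_⟩
  have hlam0 : 0 < lam := by linarith
  have hmain := h lam hlam D hD f hf
  have hosc : osc φ a lam f = D.part φ a Finset.univ f :=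
    funext fun z => D.osc_eq_part hn ha (by linarith) (by linarith) hD hf z
  have hsq : ∫⁻ z, D.sqSum φ a Finset.univ f z ^ (5 / 3 : ℝ) =
      eLpNorm (D.square φ a Finset.univ f) (10 / 3) volume ^ (10 / 3 : ℝ) := by
    rw [eLpNorm_rpow_eq]
    simp only [D.enorm_square_rpow]
  rw [← eLpNorm_rpow_eq, ← eLpNorm_rpow_eq, hsq, ← hosc] at hmain
  have hct : c ^ (3 / 10 : ℝ) ≠ ⊤ := ENNReal.rpow_ne_top_of_nonneg (by norm_num) hc
  have hroot : ∀ x : ENNReal, (x ^ (10 / 3 : ℝ)) ^ (3 / 10 : ℝ) = x := fun x => by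
    rw [← ENNReal.rpow_mul]; norm_num
  have hterm : ∀ (s : ℝ) (x : ENNReal),
      (c * ENNReal.ofReal (lam ^ (s * (10 / 3) : ℝ)) * x ^ (10 / 3 : ℝ)) ^ (3 / 10 : ℝ) =
      ENNReal.ofReal ((c ^ (3 / 10 : ℝ)).toReal * lam ^ s) * x := by
    intro s x
    rw [ENNReal.mul_rpow_of_nonneg _ _ (by norm_num), ENNReal.mul_rpow_of_nonneg _ _ (by norm_num),
      hroot, ENNReal.ofReal_mul ENNReal.toReal_nonneg, ENNReal.ofReal_toReal hct,
      ENNReal.ofReal_rpow_of_nonneg (by positivity) (by norm_num), ← Real.rpow_mul hlam0.le]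
    congr 4
    ring
  have hfin := ENNReal.rpow_le_rpow hmain (by norm_num : (0 : ℝ) ≤ 3 / 10)
  rw [hroot] at hfin
  refine hfin.trans ((ENNReal.rpow_add_le_add_rpow _ _ (by norm_num) (by norm_num)).trans ?_)
  rw [hterm, hterm]

end SqFn

end

theorem proposition3p1 (hbil : SqFn.BilinearSquareFunctionEstimate)
    (r : ℝ) (hr : 0 < r) (φ : SqFn.E3 → SqFn.E2 → ℝ) (hφ : SqFn.IsPhase r r φ) :
    ∃ ε₀ : ℝ, 0 < ε₀ ∧ ∀ a : SqFn.E3 → SqFn.E2 → ℂ,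
      ContDiff ℝ ∞ (fun p : SqFn.E3 × SqFn.E2 => a p.1 p.2) →
      HasCompactSupport (fun p : SqFn.E3 × SqFn.E2 => a p.1 p.2) →
      tsupport (fun p : SqFn.E3 × SqFn.E2 => a p.1 p.2) ⊆
        Metric.ball 0 ε₀ ×ˢ Metric.ball SqFn.e₂ ε₀ →
      SqFn.SquareFunctionEstimate φ a := by
  obtain ⟨P, Z, r₁, σ₁, κ, w₁, hn⟩ := hφ.exists_isNormalized hr
  -- The normalised region has size `σ₁`; the factor `64` leaves room for blocks that extend beyond
  -- the support of `a`.
  refine ⟨σ₁ / 64, div_pos hn.pos (by norm_num), fun a ha _ hs => ?_⟩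
  refine SqFn.squareFunctionEstimate_of_isNormalized hbil hn ⟨ha, fun z η hne => ?_⟩
  have hmem := hs (subset_tsupport (fun p : SqFn.E3 × SqFn.E2 => a p.1 p.2)
    (show ((z, η) : SqFn.E3 × SqFn.E2) ∈ Function.support _ from hne))
  exact ⟨mem_ball_zero_iff.1 hmem.1, mem_ball_iff_norm.1 hmem.2⟩
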